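/- Fix an integer $q\ge 2$. There is an algorithm (a program for a unit-cost word RAM) that, given a finite simple graph $G$ on $n$ vertices together with a tree decomposition $(T,\{B_x\}_{x\in V(T)})$ of $G$ of width $t=\max_x|B_x|-1$ (read as $0$ if $n=0$), decides whether $G$ has a clique coloring with $q$ colors, that is, a map $\varphi\colon V(G)\to\{1,\dots,q\}$ such that no (nonempty, inclusion-wise) maximal clique of $G$ is monochromatic under $\varphi$, and that outputs such a coloring if one exists. With $N=|V(T)|$, its running time is $$O\bigl((t+1)^{O(1)}\cdot(q^{t}\cdot n+N)\bigr),$$ which is $O(q^{t}\cdot t^{O(1)}\cdot n)$ when $t\ge 1$ and the given decomposition has $N=O(n)$ nodes, as is usually assumed. Here the constants depend only on $q$. The input consists of $n$, $N$, the adjacency lists of $G$ and of $T$, and lists of the elements of the bags, all lists in arbitrary order; the memory is zero apart from the input; arithmetic operations ($+$, truncated $-$, $\cdot$, integer division), memory accesses and tests cost one step each; and all words that occur in the computation have $O(1+t+\log(n+N))$ bits. -/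

import Mathlib

/-! ### Clique colorings and tree decompositions -/

/-- A coloring `φ` is a clique coloring if no maximal clique is monochromatic. (Cliques are
nonempty; this only matters for the graph without vertices.) -/
def IsCliqueColoring {V α : Type*} (G : SimpleGraph V) (φ : V → α) : Prop :=
  ∀ X : Set V, X.Nonempty → Maximal G.IsClique X → ¬ ∃ i : α, ∀ v ∈ X, φ v = i

/-- A tree decomposition of `G` over the tree `T`. -/
structure TreeDecomposition {V ι : Type*} (G : SimpleGraph V) (T : SimpleGraph ι) where
  /-- The bag of each node of the tree. -/
  bag : ι → Finset V
  isTree : T.IsTree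
  vertex_mem : ∀ v, ∃ x, v ∈ bag x
  edge_mem : ∀ u v, G.Adj u v → ∃ x, u ∈ bag x ∧ v ∈ bag x
  connected : ∀ v, (T.induce {x | v ∈ bag x}).Connected

/-- The width: maximum size of a bag, minus one. (If all bags are empty, that is, if the graph has
no vertices, this is `0` instead of `-1`.) -/
def TreeDecomposition.width {V ι : Type*} [Fintype ι] {G : SimpleGraph V} {T : SimpleGraph ι}
    (D : TreeDecomposition G T) : ℕ :=
  (Finset.univ.sup fun x => (D.bag x).card) - 1

/-! ### A random access machine with unit cost and bounded words

A program uses finitely many registers and a random access memory, each cell of which holds a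
natural number. Programs are built from assignments and stores by sequencing, branching and
looping. Every arithmetic operation, register access, memory access, assignment and test costs one
time step. The machine has a word bound `W`: a computation in which some constant, intermediate
value or address is not smaller than `W` gets stuck, that is, it has no execution. -/

namespace RAM

/-- Arithmetic operations: sum, truncated difference, product, and quotient rounded down. -/
inductive Op where
  | add
  | sub
  | mul
  | div

/-- The value of an arithmetic operation (division by zero gives zero). -/
def Op.eval : Op → ℕ → ℕ → ℕ
  | .add, a, b => a + b
  | .sub, a, b => a - b
  | .mul, a, b => a * b
  | .div, a, b => a / b

/-- Expressions: constants, registers, memory cells `M[a]`, and arithmetic. -/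
inductive Expr where
  | const (k : ℕ)
  | reg (i : ℕ)
  | mem (a : Expr)
  | bin (o : Op) (a b : Expr)

/-- Programs. -/
inductive Cmd where
  /-- Assign the value of `e` to register `i`. -/
  | assign (i : ℕ) (e : Expr)
  /-- Write the value of `e` into the memory cell whose address is the value of `a`. -/
  | store (a e : Expr)
  | seq (c d : Cmd)
  /-- Execute `c` if the value of `e` is nonzero, and `d` otherwise. -/
  | cond (e : Expr) (c d : Cmd)
  /-- Repeat `c` as long as the value of `e` is nonzero. -/
  | loop (e : Expr) (c : Cmd)

/-- The contents of the registers and of the memory. -/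
structure State where
  reg : ℕ → ℕ
  mem : ℕ → ℕ

/-- The value of an expression. -/
def Expr.eval (s : State) : Expr → ℕ
  | .const k => k
  | .reg i => s.reg i
  | .mem a => s.mem (a.eval s)
  | .bin o a b => o.eval (a.eval s) (b.eval s)

/-- The number of time steps needed to evaluate an expression. -/
def Expr.cost : Expr → ℕ
  | .const _ => 1
  | .reg _ => 1
  | .mem a => a.cost + 1
  | .bin _ a b => a.cost + b.cost + 1

/-- All values and addresses that occur in the evaluation of the expression are below `W`. -/
def Expr.Fits (W : ℕ) (s : State) : Expr → Prop
  | .const k => k < W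
  | .reg i => s.reg i < W
  | .mem a => a.Fits W s ∧ s.mem (a.eval s) < W
  | .bin o a b => a.Fits W s ∧ b.Fits W s ∧ o.eval (a.eval s) (b.eval s) < W

/-- `Exec W c s s' k`: on the machine with word bound `W`, the program `c` started in state `s`
halts in state `s'` after exactly `k` time steps. -/
inductive Exec (W : ℕ) : Cmd → State → State → ℕ → Prop where
  | assign {i : ℕ} {e : Expr} {s : State} (he : e.Fits W s) :
      Exec W (.assign i e) s ⟨Function.update s.reg i (e.eval s), s.mem⟩ (e.cost + 1)
  | store {a e : Expr} {s : State} (ha : a.Fits W s) (he : e.Fits W s) :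
      Exec W (.store a e) s ⟨s.reg, Function.update s.mem (a.eval s) (e.eval s)⟩
        (a.cost + e.cost + 1)
  | seq {c d : Cmd} {s s' s'' : State} {k l : ℕ} (hc : Exec W c s s' k) (hd : Exec W d s' s'' l) :
      Exec W (.seq c d) s s'' (k + l)
  | cond_true {e : Expr} {c d : Cmd} {s s' : State} {k : ℕ} (he : e.Fits W s)
      (h : e.eval s ≠ 0) (hc : Exec W c s s' k) :
      Exec W (.cond e c d) s s' (e.cost + 1 + k)
  | cond_false {e : Expr} {c d : Cmd} {s s' : State} {k : ℕ} (he : e.Fits W s)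
      (h : e.eval s = 0) (hd : Exec W d s s' k) :
      Exec W (.cond e c d) s s' (e.cost + 1 + k)
  | loop_true {e : Expr} {c : Cmd} {s s' s'' : State} {k l : ℕ} (he : e.Fits W s)
      (h : e.eval s ≠ 0) (hc : Exec W c s s' k) (hl : Exec W (.loop e c) s' s'' l) :
      Exec W (.loop e c) s s'' (e.cost + 1 + k + l)
  | loop_false {e : Expr} {c : Cmd} {s : State} (he : e.Fits W s) (h : e.eval s = 0) :
      Exec W (.loop e c) s s (e.cost + 1)

/-- The initial state: the input stands at the beginning of the memory, everything else is `0`. -/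
def State.init (input : List ℕ) : State := ⟨fun _ => 0, fun i => input.getD i 0⟩

end RAM

/-! ### Input and output -/

/-- Each `L i` lists the elements of `S i` without repetition, in an arbitrary order. -/
def ListsFamily {k m : ℕ} (L : Fin k → List (Fin m)) (S : Fin k → Set (Fin m)) : Prop :=
  ∀ i, (L i).Nodup ∧ ∀ x, x ∈ L i ↔ x ∈ S i

/-- A family of lists as a sequence of words: each list is written as its length, followed by its
elements. -/
def encodeLists {k m : ℕ} (L : Fin k → List (Fin m)) : List ℕ :=
  (List.ofFn L).flatMap fun l => l.length :: l.map Fin.val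

/-- `input` describes the graph `G` and its tree decomposition `D`: it consists of the number of
vertices, the number of nodes, the adjacency lists of `G`, the adjacency lists of the tree, and the
lists of the vertices in the bags. -/
def IsEncoding {n N : ℕ} {G : SimpleGraph (Fin n)} {T : SimpleGraph (Fin N)}
    (D : TreeDecomposition G T) (input : List ℕ) : Prop :=
  ∃ (A : Fin n → List (Fin n)) (B : Fin N → List (Fin N)) (L : Fin N → List (Fin n)),
    ListsFamily A G.neighborSet ∧ ListsFamily B T.neighborSet ∧
      ListsFamily L (fun x => (D.bag x : Set (Fin n))) ∧
      input = n :: N :: (encodeLists A ++ encodeLists B ++ encodeLists L)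

/-- The memory `M` holds the correct answer: either `M[0] = 1` and `M[1], …, M[n]` are the colors
of the vertices in a clique coloring with colors `0, …, q - 1`, or `M[0] = 0` and there is no such
coloring. -/
def IsAnswer {n : ℕ} (q : ℕ) (G : SimpleGraph (Fin n)) (M : ℕ → ℕ) : Prop :=
  (M 0 = 1 ∧ ∃ φ : Fin n → Fin q, IsCliqueColoring G φ ∧ ∀ v : Fin n, M (v + 1) = φ v) ∨
    (M 0 = 0 ∧ ¬ ∃ φ : Fin n → Fin q, IsCliqueColoring G φ)

/-! ### A machine with named registers and arrays

The programs below are written for an abstract machine with finitely many named registers and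
named two-dimensional arrays, which is implemented on the RAM. -/

set_option linter.constructorNameAsVariable false
namespace RAM

/-! The combinatorial half. Rank the vertices in the order in which they first turn up when the tree
is searched from a root, and let the bag of `v` consist of `v` and the earlier vertices at the node
where `v` first appears. Since the nodes of each vertex form a subtree, this bag contains all
earlier neighbors of `v`, and the bag of `w` without `w` lies in the bag of one earlier vertex, the
parent of `w` (`Elimination`, `exists_elimination`). Hence every maximal clique lies in the bag of
its last vertex, and a coloring is a clique coloring iff it is good at every `v`: no maximal clique
of the whole graph with last vertex `v` is monochromatic (`Elimination.isCliqueColoring_iff`).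
Goodness at `v` depends only on the colors in the bag of `v`, so it fits into a table with at most
`q ^ (t + 1)` entries.

Testing all subcliques separately for each coloring would be too slow. Instead, a table records
which supports contain a maximal clique through `v`: either the support is such a clique, or
deleting one of its vertices leaves a support that contains one (`Elimination.covers_iff`). Deletion
lowers the code of the support, so the entries can be filled in by increasing code, each in time
polynomial in `t` and the degree of `v`; the degrees sum to `O(t n)` (`Elimination.sum_degree_le`).
Goodness is then read off at the indicator function of the color class of `v`
(`Elimination.good_iff_not_covers`).

The vertices are eliminated from the last to the second: the table of the parent of `w` is
restricted to the colorings that some color of `w` makes feasible for `w` (`Elimination.Feasible`).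
This costs a factor `q` per entry, and each vertex is absorbed only once, so tables are never
multiplied. Finally the vertices are colored in increasing order; the table of the parent guarantees
a color (`Elimination.exists_feasible`), so that only the first vertex can fail, and it fails only
if no coloring exists.

The machine half. Programs are written with named registers and two-dimensional arrays, whose
entries sit at polynomial addresses behind the input; the memory is zero there, so nothing has to be
initialized. `Machine.Runs` is a Hoare triple with a time bound, and the program rules reduce each
routine to a loop invariant. Stored values stay below a bound `U`, intermediate values and addresses
below a fixed power of `U`, and this power is polynomial in `q ^ t * (n + N)`. -/

/-- The named registers. -/
inductive Reg where
  | n | N | q | D | Q | p | v | w | u | x | y | z | i | j | a | b | c | e | r | pw | ok | dom | old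
  | cnt | best | found | flag
  deriving DecidableEq

/-- The named arrays. -/
inductive Arr where
  | deg | nb | tdeg | tnb | bsz | bag | adj | queue | seen | num | ord | slot | par | hh | bad | col
  deriving DecidableEq

/-- The position of a register in the register file. -/
def Reg.idx (r : Reg) : ℕ := r.ctorIdx

/-- The number of an array. -/
def Arr.idx (A : Arr) : ℕ := A.ctorIdx

theorem Reg.idx_inj {r r' : Reg} : r.idx = r'.idx ↔ r = r' := by
  refine ⟨fun h => ?_, fun h => h ▸ rfl⟩
  rw [← Reg.ofNat_ctorIdx r, ← Reg.ofNat_ctorIdx r']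
  exact congrArg Reg.ofNat h

theorem Arr.idx_inj {A A' : Arr} : A.idx = A'.idx ↔ A = A' := by
  refine ⟨fun h => ?_, fun h => h ▸ rfl⟩
  rw [← Arr.ofNat_ctorIdx A, ← Arr.ofNat_ctorIdx A']
  exact congrArg Arr.ofNat h

theorem Arr.idx_lt (A : Arr) : A.idx < 32 := by
  cases A <;> decide

/-- The states of the abstract machine; `low` is the part of the memory that holds input and
output. -/
structure Store where
  reg : Reg → ℕ
  arr : Arr → ℕ → ℕ → ℕ
  low : ℕ → ℕ

/-- Assign a value to a register. -/
def Store.set (h : Store) (r : Reg) (v : ℕ) : Store :=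
  { h with reg := Function.update h.reg r v }

/-- Write a value into an array. -/
def Store.put (h : Store) (A : Arr) (a b v : ℕ) : Store :=
  { h with
    arr := Function.update h.arr A
      (Function.update (h.arr A) a (Function.update (h.arr A a) b v)) }

/-- Write a value into the input and output area. -/
def Store.putLow (h : Store) (a v : ℕ) : Store :=
  { h with low := Function.update h.low a v }

@[simp] theorem Store.reg_set (h : Store) (r r' : Reg) (v : ℕ) :
    (h.set r v).reg r' = if r' = r then v else h.reg r' := by
  simp [Store.set, Function.update_apply]

@[simp] theorem Store.arr_set (h : Store) (r : Reg) (v : ℕ) : (h.set r v).arr = h.arr := rfl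

@[simp] theorem Store.low_set (h : Store) (r : Reg) (v : ℕ) : (h.set r v).low = h.low := rfl

@[simp] theorem Store.reg_put (h : Store) (A : Arr) (a b v : ℕ) : (h.put A a b v).reg = h.reg := rfl

@[simp] theorem Store.low_put (h : Store) (A : Arr) (a b v : ℕ) : (h.put A a b v).low = h.low := rfl

@[simp] theorem Store.arr_put (h : Store) (A A' : Arr) (a b v a' b' : ℕ) :
    (h.put A a b v).arr A' a' b' = if A' = A ∧ a' = a ∧ b' = b then v else h.arr A' a' b' := by
  by_cases h1 : A' = A
  · subst h1
    by_cases h2 : a' = a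
    · subst h2
      by_cases h3 : b' = b
      · subst h3; simp [Store.put]
      · simp [Store.put, h3]
    · simp [Store.put, h2]
  · simp [Store.put, h1]

theorem Store.arr_put_of_ne (h : Store) {A A' : Arr} (a b v : ℕ) (hA : A' ≠ A) :
    (h.put A a b v).arr A' = h.arr A' := by
  simp [Store.put, hA]

@[simp] theorem Store.reg_putLow (h : Store) (a v : ℕ) : (h.putLow a v).reg = h.reg := rfl

@[simp] theorem Store.arr_putLow (h : Store) (a v : ℕ) : (h.putLow a v).arr = h.arr := rfl

@[simp] theorem Store.low_putLow (h : Store) (a v i : ℕ) :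
    (h.putLow a v).low i = if i = a then v else h.low i := by
  simp [Store.putLow, Function.update_apply]

/-- `Agree R As h h'`: the states agree except for the registers in `R` and the arrays in `As`. -/
structure Agree (R : List Reg) (As : List Arr) (h h' : Store) : Prop where
  reg : ∀ r, r ∉ R → h.reg r = h'.reg r
  arr : ∀ A, A ∉ As → h.arr A = h'.arr A
  low : h.low = h'.low

theorem Agree.refl (R : List Reg) (As : List Arr) (h : Store) : Agree R As h h :=
  ⟨fun _ _ => rfl, fun _ _ => rfl, rfl⟩

theorem Agree.trans {R R' : List Reg} {As As' : List Arr} {h h' h'' : Store}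
    (h₁ : Agree R' As' h h') (h₂ : Agree R As h' h'')
    (hR : R' ⊆ R := by decide) (hA : As' ⊆ As := by decide) : Agree R As h h'' :=
  ⟨fun r hr => (h₁.reg r fun h => hr (hR h)).trans (h₂.reg r hr),
    fun A hr => (h₁.arr A fun h => hr (hA h)).trans (h₂.arr A hr), h₁.low.trans h₂.low⟩

theorem Agree.set {R : List Reg} {As : List Arr} {h h' : Store} (H : Agree R As h h') {r : Reg}
    {v : ℕ} (hr : r ∈ R := by simp) : Agree R As (h.set r v) h' :=
  ⟨fun r' hr' => by
    rw [Store.reg_set, if_neg (fun e : r' = r => hr' (e ▸ hr)), H.reg r' hr'], H.arr, H.low⟩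

theorem Agree.put {R : List Reg} {As : List Arr} {h h' : Store} (H : Agree R As h h') {A : Arr}
    {a b v : ℕ} (hA : A ∈ As := by simp) : Agree R As (h.put A a b v) h' :=
  ⟨H.reg, fun A' hA' => by
    rw [Store.arr_put_of_ne _ _ _ _ (fun e : A' = A => hA' (e ▸ hA)), H.arr A' hA'], H.low⟩

/-- An injective encoding of pairs by a polynomial. -/
def pair (a b : ℕ) : ℕ := (a + b) * (a + b) + a

/-- With `s = a + b`, the value lies between `s ^ 2` and `s ^ 2 + s < (s + 1) ^ 2`, so it determines
`s`, and then `a`. -/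
theorem pair_inj {a b a' b' : ℕ} : pair a b = pair a' b' ↔ a = a' ∧ b = b' := by
  refine ⟨fun h => ?_, fun h => by rw [h.1, h.2]⟩
  unfold pair at h
  have key : a + b = a' + b' := by
    rcases lt_trichotomy (a + b) (a' + b') with hlt | heq | hgt
    · nlinarith
    · exact heq
    · nlinarith
  rw [key] at h
  omega

/-- Expressions of the abstract machine. -/
inductive Exp where
  | zero
  | one
  | reg (r : Reg)
  | get (A : Arr) (a b : Exp)
  | bin (o : Op) (a b : Exp)

instance : Zero Exp := ⟨Exp.zero⟩
instance : One Exp := ⟨Exp.one⟩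
instance : Add Exp := ⟨Exp.bin .add⟩
instance : Sub Exp := ⟨Exp.bin .sub⟩
instance : Mul Exp := ⟨Exp.bin .mul⟩
instance : Div Exp := ⟨Exp.bin .div⟩

/-- The value of an expression. -/
def Exp.eval (h : Store) : Exp → ℕ
  | .zero => 0
  | .one => 1
  | .reg r => h.reg r
  | .get A a b => h.arr A (a.eval h) (b.eval h)
  | .bin o a b => o.eval (a.eval h) (b.eval h)

section
variable (h : Store) (a b : Exp)
@[simp] theorem Exp.eval_zero : (0 : Exp).eval h = 0 := rfl
@[simp] theorem Exp.eval_one : (1 : Exp).eval h = 1 := rfl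
@[simp] theorem Exp.eval_reg (r : Reg) : (Exp.reg r).eval h = h.reg r := rfl
@[simp] theorem Exp.eval_get (A : Arr) :
    (Exp.get A a b).eval h = h.arr A (a.eval h) (b.eval h) := rfl
@[simp] theorem Exp.eval_add : (a + b).eval h = a.eval h + b.eval h := rfl
@[simp] theorem Exp.eval_sub : (a - b).eval h = a.eval h - b.eval h := rfl
@[simp] theorem Exp.eval_mul : (a * b).eval h = a.eval h * b.eval h := rfl
@[simp] theorem Exp.eval_div : (a / b).eval h = a.eval h / b.eval h := rfl
end

/-- The address of an array entry. -/
def address (A : Arr) (a b : Expr) : Expr :=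
  .bin .add (.reg 0) (.bin .add
    (.bin .mul (.const 32) (.bin .add (.bin .mul (.bin .add a b) (.bin .add a b)) a))
    (.const A.idx))

/-- The implementation of expressions on the RAM. -/
def Exp.compile : Exp → Expr
  | .zero => .const 0
  | .one => .const 1
  | .reg r => .reg (r.idx + 1)
  | .get A a b => .mem (address A a.compile b.compile)
  | .bin o a b => .bin o a.compile b.compile

/-! ### Size of the values in an expression -/

/-- A measure for the size of the values that occur in an expression. -/
def Expr.weight : Expr → ℕ
  | .const _ => 1
  | .reg _ => 1
  | .mem a => a.weight
  | .bin _ a b => a.weight + b.weight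

/-- All constants in the expression are at most `U`. -/
def Expr.ConstLe (U : ℕ) : Expr → Prop
  | .const k => k ≤ U
  | .reg _ => True
  | .mem a => a.ConstLe U
  | .bin _ a b => a.ConstLe U ∧ b.ConstLe U

theorem Expr.one_le_weight (e : Expr) : 1 ≤ e.weight := by
  induction e with
  | const => exact le_rfl
  | reg => exact le_rfl
  | mem a ih => exact ih
  | bin o a b iha ihb => simp only [Expr.weight]; omega

/-- Both bounds are at least 2, so that even a sum is at most their product. This makes weights
additive for all four operations. -/
theorem Op.eval_le {U x y i j : ℕ} (hU : 2 ≤ U) (hi : 1 ≤ i) (hj : 1 ≤ j) (hx : x ≤ U ^ i)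
    (hy : y ≤ U ^ j) (o : Op) : o.eval x y ≤ U ^ (i + j) := by
  have h1 : 2 ≤ U ^ i := hU.trans (Nat.le_self_pow (by omega) U)
  have h2 : 2 ≤ U ^ j := hU.trans (Nat.le_self_pow (by omega) U)
  rw [pow_add]
  cases o with
  | add => simp only [Op.eval]; nlinarith
  | sub => simp only [Op.eval]; have : x - y ≤ x := Nat.sub_le _ _; nlinarith
  | mul => simp only [Op.eval]; exact Nat.mul_le_mul hx hy
  | div => simp only [Op.eval]; have : x / y ≤ x := Nat.div_le_self _ _; nlinarith

/-- A memory access brings the value back to at most `U`. Its weight still counts that of the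
address, because the address has to fit into a word too. -/
theorem Expr.eval_le {U : ℕ} {s : State} (hU : 2 ≤ U) (hr : ∀ i, s.reg i ≤ U)
    (hm : ∀ i, s.mem i ≤ U) (e : Expr) (he : e.ConstLe U) : e.eval s ≤ U ^ e.weight := by
  induction e with
  | const k => simpa [Expr.weight, Expr.eval, Expr.ConstLe] using he
  | reg i => simpa [Expr.weight, Expr.eval] using hr i
  | mem a ih =>
    exact (hm _).trans (Nat.le_self_pow (Nat.ne_of_gt (Expr.mem a).one_le_weight) U)
  | bin o a b iha ihb =>
    exact Op.eval_le hU a.one_le_weight b.one_le_weight (iha he.1) (ihb he.2) o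

theorem Expr.fits {U W : ℕ} {s : State} (hU : 2 ≤ U) (hr : ∀ i, s.reg i ≤ U)
    (hm : ∀ i, s.mem i ≤ U) (e : Expr) (he : e.ConstLe U) (hW : U ^ e.weight < W) :
    e.Fits W s := by
  have hUW : U < W := (Nat.le_self_pow (by have := e.one_le_weight; omega) U).trans_lt hW
  induction e with
  | const k => exact lt_of_le_of_lt he hUW
  | reg i => exact (hr i).trans_lt hUW
  | mem a ih => exact ⟨ih he hW, (hm _).trans_lt hUW⟩
  | bin o a b iha ihb =>
    refine ⟨iha he.1 (lt_of_le_of_lt (Nat.pow_le_pow_right (by omega) ?_) hW),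
      ihb he.2 (lt_of_le_of_lt (Nat.pow_le_pow_right (by omega) ?_) hW),
      ((Expr.bin o a b).eval_le hU hr hm he).trans_lt hW⟩ <;> simp only [Expr.weight] <;> omega

/-- The expression is small enough to fit into the word size and the time unit. -/
def Exp.safe (e : Exp) : Bool :=
  Nat.ble e.compile.weight 256 && Nat.ble e.compile.cost 450

theorem Exp.constLe {U : ℕ} (hU : 32 ≤ U) (e : Exp) : e.compile.ConstLe U := by
  induction e with
  | zero => simp [Exp.compile, Expr.ConstLe]
  | one => simp [Exp.compile, Expr.ConstLe]; omega
  | reg => simp [Exp.compile, Expr.ConstLe]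
  | get A a b iha ihb =>
    have := A.idx_lt
    simp only [Exp.compile, address, Expr.ConstLe, iha, ihb, and_true, true_and]
    omega
  | bin o a b iha ihb => exact ⟨iha, ihb⟩

/-! ### Simulation of the abstract machine -/

/-- The parameters of an implementation of the abstract machine: the word bound `W`, a bound `U` on
the values that are stored, and the beginning of the area of the arrays. -/
structure Machine where
  W : ℕ
  U : ℕ
  base : ℕ
  le_U : 32 ≤ U
  base_le : base ≤ U
  pow_lt : U ^ 256 < W

variable {M : Machine}

/-- The state `s` of the RAM represents the state `h` of the abstract machine. -/
structure Machine.Rel (M : Machine) (h : Store) (s : State) : Prop where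
  base : s.reg 0 = M.base
  reg : ∀ r : Reg, s.reg (r.idx + 1) = h.reg r
  arr : ∀ A a b, s.mem (M.base + (32 * pair a b + Arr.idx A)) = h.arr A a b
  low : ∀ i < M.base, s.mem i = h.low i
  reg_le : ∀ i, s.reg i ≤ M.U
  mem_le : ∀ i, s.mem i ≤ M.U

theorem Machine.Rel.eval {h : Store} {s : State} (H : M.Rel h s) (e : Exp) :
    e.compile.eval s = e.eval h := by
  induction e with
  | zero => rfl
  | one => rfl
  | reg r => exact H.reg r
  | get A a b iha ihb =>
    rw [Exp.eval_get, ← H.arr A, ← iha, ← ihb, ← H.base]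
    rfl
  | bin o a b iha ihb =>
    simp only [Exp.compile, Expr.eval, Exp.eval, iha, ihb]

theorem Machine.Rel.address_eval {h : Store} {s : State} (H : M.Rel h s) (A : Arr) (a b : Exp) :
    (address A a.compile b.compile).eval s =
      M.base + (32 * pair (a.eval h) (b.eval h) + A.idx) := by
  rw [← H.eval a, ← H.eval b, ← H.base]
  rfl

theorem Machine.pow_weight_lt {e : Expr} (h : e.weight ≤ 256) : M.U ^ e.weight < M.W :=
  lt_of_le_of_lt (Nat.pow_le_pow_right (by have := M.le_U; omega) h) M.pow_lt

theorem Exp.weight_le {e : Exp} (he : e.safe = true) : e.compile.weight ≤ 256 := by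
  simp [Exp.safe] at he; exact he.1

theorem Exp.cost_le {e : Exp} (he : e.safe = true) : e.compile.cost ≤ 450 := by
  simp [Exp.safe] at he; exact he.2

theorem Machine.Rel.fits {h : Store} {s : State} (H : M.Rel h s) (e : Exp) (he : e.safe = true) :
    e.compile.Fits M.W s :=
  Expr.fits (by have := M.le_U; omega) H.reg_le H.mem_le _ (e.constLe M.le_U)
    (M.pow_weight_lt (Exp.weight_le he))

/-! ### Total correctness with running times -/

/-- `M.Runs c h k Q`: the program `c`, started in the state `h`, halts within `k` time units in a
state that satisfies `Q`. (A time unit has 1000 steps of the RAM.) -/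
def Machine.Runs (M : Machine) (c : Cmd) (h : Store) (k : ℕ) (Q : Store → Prop) : Prop :=
  ∀ s, M.Rel h s → ∃ s' k' h', Exec M.W c s s' k' ∧ k' ≤ 1000 * k ∧ M.Rel h' s' ∧ Q h'

theorem Machine.Runs.mono {c : Cmd} {h : Store} {k k' : ℕ} {Q Q' : Store → Prop}
    (H : M.Runs c h k Q) (hQ : ∀ h', Q h' → Q' h') (hk : k ≤ k') : M.Runs c h k' Q' := by
  intro s hs
  obtain ⟨s', l, h', h1, h2, h3, h4⟩ := H s hs
  exact ⟨s', l, h', h1, by omega, h3, hQ _ h4⟩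

theorem Machine.Runs.le {c : Cmd} {h : Store} {k k' : ℕ} {Q : Store → Prop}
    (H : M.Runs c h k Q) (hk : k ≤ k') : M.Runs c h k' Q :=
  H.mono (fun _ h => h) hk

/-- Only states represented in the RAM matter, and representation includes the bound `U` on all
contents. So this bound comes for free and need not be carried through invariants. -/
theorem Machine.runs_of_le {c : Cmd} {h : Store} {k : ℕ} {Q : Store → Prop}
    (H : (∀ r, h.reg r ≤ M.U) → (∀ A a b, h.arr A a b ≤ M.U) → M.Runs c h k Q) :
    M.Runs c h k Q := fun s hs =>
  H (fun r => hs.reg r ▸ hs.reg_le _) (fun A a b => hs.arr A a b ▸ hs.mem_le _) s hs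

/-- Assignment to a register. -/
def set (r : Reg) (e : Exp) : Cmd := .assign (r.idx + 1) e.compile

/-- Read a word of the input. -/
def load (r : Reg) (e : Exp) : Cmd := .assign (r.idx + 1) (.mem e.compile)

/-- Write into an array. -/
def put (A : Arr) (a b e : Exp) : Cmd := .store (address A a.compile b.compile) e.compile

/-- Write a word of the output. -/
def putLow (a e : Exp) : Cmd := .store a.compile e.compile

/-- Branching. -/
def ifz (e : Exp) (c d : Cmd) : Cmd := .cond e.compile c d

/-- Repeat `c` for `i = 0, …, m - 1`. -/
def forRange (i : Reg) (m : Exp) (c : Cmd) : Cmd :=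
  .seq (set i 0) (.loop (m - .reg i : Exp).compile (.seq c (set i (.reg i + 1))))

/-- Do nothing (except for clearing a scratch register). -/
def skip : Cmd := set .z 0

notation:60 c:61 ";;" d:60 => Cmd.seq c d

theorem Machine.Rel.set {h : Store} {s : State} (H : M.Rel h s) (r : Reg) {v : ℕ} (hv : v ≤ M.U) :
    M.Rel (h.set r v) ⟨Function.update s.reg (r.idx + 1) v, s.mem⟩ where
  base := by simpa using H.base
  reg r' := by
    rw [Store.reg_set]
    simp only [Function.update_apply, Nat.add_right_cancel_iff, Reg.idx_inj, H.reg]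
  arr := H.arr
  low := H.low
  reg_le i := by
    simp only [Function.update_apply]
    split_ifs
    · exact hv
    · exact H.reg_le i
  mem_le := H.mem_le

theorem Machine.Rel.put {h : Store} {s : State} (H : M.Rel h s) (A : Arr) (a b : ℕ) {v : ℕ}
    (hv : v ≤ M.U) :
    M.Rel (h.put A a b v)
      ⟨s.reg, Function.update s.mem (M.base + (32 * pair a b + A.idx)) v⟩ where
  base := H.base
  reg := H.reg
  arr A' a' b' := by
    -- Array numbers are below 32, so an address determines the array as well as the pair of
    -- indices.
    have key : M.base + (32 * pair a' b' + A'.idx) = M.base + (32 * pair a b + A.idx) ↔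
        A' = A ∧ a' = a ∧ b' = b := by
      rw [← pair_inj, ← Arr.idx_inj]
      have := A.idx_lt
      have := A'.idx_lt
      omega
    rw [Store.arr_put]
    simp only [Function.update_apply, key, H.arr]
  low i hi := by
    simp only [Function.update_apply]
    rw [if_neg (by omega)]
    exact H.low i hi
  reg_le := H.reg_le
  mem_le i := by
    simp only [Function.update_apply]
    split_ifs
    · exact hv
    · exact H.mem_le i

theorem Machine.Rel.putLow {h : Store} {s : State} (H : M.Rel h s) {a v : ℕ} (ha : a < M.base)
    (hv : v ≤ M.U) :
    M.Rel (h.putLow a v) ⟨s.reg, Function.update s.mem a v⟩ where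
  base := H.base
  reg := H.reg
  arr A' a' b' := by
    simp only [Function.update_apply, Store.arr_putLow]
    rw [if_neg (by omega)]
    exact H.arr A' a' b'
  low i hi := by
    simp only [Function.update_apply, Store.low_putLow, H.low i hi]
  reg_le := H.reg_le
  mem_le i := by
    simp only [Function.update_apply]
    split_ifs
    · exact hv
    · exact H.mem_le i

theorem Machine.runs_set {r : Reg} {e : Exp} {h : Store} {Q : Store → Prop}
    (hv : e.eval h ≤ M.U) (hQ : Q (h.set r (e.eval h))) (hs : e.safe = true := by rfl) :
    M.Runs (set r e) h 1 Q := by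
  intro s H
  refine ⟨_, _, _, Exec.assign (H.fits e hs), ?_, H.set r (v := e.compile.eval s) ?_, ?_⟩
  rotate_left
  · rwa [H.eval]
  · rwa [H.eval]
  have := Exp.cost_le hs
  omega

theorem Machine.runs_skip {h : Store} {Q : Store → Prop} (hQ : Q (h.set .z 0)) :
    M.Runs skip h 1 Q :=
  runs_set (by simp) hQ

theorem Machine.runs_load {r : Reg} {e : Exp} {h : Store} {Q : Store → Prop}
    (he : e.eval h < M.base) (hQ : Q (h.set r (h.low (e.eval h))))
    (hs : e.safe = true := by rfl) :
    M.Runs (load r e) h 1 Q := by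
  intro s H
  have hev : (Expr.mem e.compile).eval s = h.low (e.eval h) := by
    rw [Expr.eval, H.eval, H.low _ he]
  have hU : h.low (e.eval h) ≤ M.U := H.low _ he ▸ H.mem_le _
  refine ⟨_, _, _, Exec.assign ⟨H.fits e hs, ?_⟩, ?_,
    H.set r (v := (Expr.mem e.compile).eval s) ?_, ?_⟩
  rotate_left 2
  · rwa [hev]
  · rwa [hev]
  · refine (H.mem_le _).trans_lt (lt_of_le_of_lt (Nat.le_self_pow (by omega) _) M.pow_lt)
  · have := Exp.cost_le hs
    simp only [Expr.cost]
    omega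

theorem Machine.runs_put {A : Arr} {a b e : Exp} {h : Store} {Q : Store → Prop}
    (hv : e.eval h ≤ M.U) (hQ : Q (h.put A (a.eval h) (b.eval h) (e.eval h)))
    (hs : e.safe = true := by rfl) (hs' : (Exp.get A a b).safe = true := by rfl) :
    M.Runs (put A a b e) h 1 Q := by
  intro s H
  refine ⟨_, _, _, Exec.store (H.fits _ hs').1 (H.fits e hs), ?_,
    H.address_eval A a b ▸ H.put A _ _ (v := e.compile.eval s) ?_, ?_⟩
  rotate_left
  · rwa [H.eval]
  · rwa [H.eval]
  have := Exp.cost_le hs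
  have := Exp.cost_le hs'
  simp only [Exp.compile, Expr.cost] at this
  omega

theorem Machine.runs_putLow {a e : Exp} {h : Store} {Q : Store → Prop}
    (ha : a.eval h < M.base) (hv : e.eval h ≤ M.U) (hQ : Q (h.putLow (a.eval h) (e.eval h)))
    (hs : e.safe = true := by rfl) (hs' : a.safe = true := by rfl) :
    M.Runs (RAM.putLow a e) h 1 Q := by
  intro s H
  refine ⟨_, _, _, Exec.store (H.fits _ hs') (H.fits e hs), ?_,
    H.putLow (a := a.compile.eval s) (v := e.compile.eval s) ?_ ?_, ?_⟩
  rotate_left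
  · rwa [H.eval]
  · rwa [H.eval]
  · rwa [H.eval, H.eval]
  have := Exp.cost_le hs
  have := Exp.cost_le hs'
  omega

theorem Machine.runs_seq {c d : Cmd} {h : Store} {k l : ℕ} {R Q : Store → Prop}
    (hc : M.Runs c h k R) (hd : ∀ h', R h' → M.Runs d h' l Q) : M.Runs (c ;; d) h (k + l) Q := by
  intro s H
  obtain ⟨s', k', h', h1, h2, h3, h4⟩ := hc s H
  obtain ⟨s'', l', h'', h5, h6, h7, h8⟩ := hd h' h4 s' h3
  exact ⟨s'', _, h'', Exec.seq h1 h5, by omega, h7, h8⟩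

theorem Machine.runs_set_seq {r : Reg} {e : Exp} {d : Cmd} {h : Store} {l : ℕ} {Q : Store → Prop}
    (hv : e.eval h ≤ M.U) (hd : M.Runs d (h.set r (e.eval h)) l Q)
    (hs : e.safe = true := by rfl) : M.Runs (RAM.set r e ;; d) h (l + 1) Q :=
  (runs_seq (runs_set (Q := fun h' => h' = h.set r (e.eval h)) hv rfl hs)
    fun _ h' => h' ▸ hd).le (by omega)

theorem Machine.runs_load_seq {r : Reg} {e : Exp} {d : Cmd} {h : Store} {l : ℕ}
    {Q : Store → Prop}
    (he : e.eval h < M.base) (hd : M.Runs d (h.set r (h.low (e.eval h))) l Q)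
    (hs : e.safe = true := by rfl) : M.Runs (load r e ;; d) h (l + 1) Q :=
  (runs_seq (runs_load (Q := fun h' => h' = h.set r (h.low (e.eval h))) he rfl hs)
    fun _ h' => h' ▸ hd).le (by omega)

theorem Machine.runs_put_seq {A : Arr} {a b e : Exp} {d : Cmd} {h : Store} {l : ℕ}
    {Q : Store → Prop}
    (hv : e.eval h ≤ M.U) (hd : M.Runs d (h.put A (a.eval h) (b.eval h) (e.eval h)) l Q)
    (hs : e.safe = true := by rfl) (hs' : (Exp.get A a b).safe = true := by rfl) :
    M.Runs (RAM.put A a b e ;; d) h (l + 1) Q :=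
  (runs_seq (runs_put (Q := fun h' => h' = h.put A (a.eval h) (b.eval h) (e.eval h)) hv rfl hs hs')
    fun _ h' => h' ▸ hd).le (by omega)

/-- As in `Cmd.cond`, the first branch is the one for a nonzero value. -/
theorem Machine.runs_ifz {e : Exp} {c d : Cmd} {h : Store} {k : ℕ} {Q : Store → Prop}
    (hc : e.eval h ≠ 0 → M.Runs c h k Q) (hd : e.eval h = 0 → M.Runs d h k Q)
    (hs : e.safe = true := by rfl) : M.Runs (ifz e c d) h (k + 1) Q := by
  intro s H
  have := Exp.cost_le hs
  by_cases he : e.eval h = 0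
  · obtain ⟨s', k', h', h1, h2, h3, h4⟩ := hd he s H
    exact ⟨s', _, h', Exec.cond_false (H.fits e hs) (by rwa [H.eval]) h1, by omega, h3, h4⟩
  · obtain ⟨s', k', h', h1, h2, h3, h4⟩ := hc he s H
    exact ⟨s', _, h', Exec.cond_true (H.fits e hs) (by rwa [H.eval]) h1, by omega, h3, h4⟩

/-- The function `spent` acts as a potential: it pays for each round and is at most `K` at the end.
This serves loops such as the tree search, in which the cost of a round depends on the state and not
on its index alone. Each round has two further units, for the increment and the test; the last two
units pay for the initialization and the final test. -/
theorem Machine.runs_forRange_amortized {i : Reg} {m : Exp} {c : Cmd} {h : Store}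
    {Q : Store → Prop} (I : ℕ → Store → Prop) (B K : ℕ) (spent : ℕ → Store → ℕ) (hB : B ≤ M.U)
    (h0 : I 0 (h.set i 0)) (hm : ∀ j h', j ≤ B → I j h' → m.eval h' = B)
    (hb : ∀ j h', j < B → I j h' → h'.reg i = j →
      ∃ k, M.Runs c h' k fun h'' => h''.reg i = j ∧ I (j + 1) (h''.set i (j + 1)) ∧
        spent j h' + k ≤ spent (j + 1) (h''.set i (j + 1)))
    (hQ : ∀ h', I B h' → h'.reg i = B → spent B h' ≤ K ∧ Q h')
    (hs : (m - .reg i : Exp).safe = true := by rfl) :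
    M.Runs (forRange i m c) h (K + 2 * B + 2) Q := by
  have hcost := Exp.cost_le hs
  have main : ∀ d j h', j + d = B → I j h' → h'.reg i = j → ∀ s, M.Rel h' s →
      ∃ s' k' h'' t, Exec M.W (.loop (m - .reg i : Exp).compile (c ;; RAM.set i (.reg i + 1)))
        s s' k' ∧ k' ≤ 1000 * (t + 2 * d + 1) ∧ spent j h' + t ≤ K ∧ M.Rel h'' s' ∧ Q h'' := by
    intro d
    induction d with
    | zero =>
      intro j h' hj hI hi s H
      obtain rfl : j = B := by omega
      obtain ⟨hK, hQ'⟩ := hQ h' hI hi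
      refine ⟨s, _, h', 0, Exec.loop_false (H.fits _ hs) ?_, ?_, hK, H, hQ'⟩
      · rw [H.eval]; simp [hm j h' le_rfl hI, hi]
      · omega
    | succ d ih =>
      intro j h' hj hI hi s H
      obtain ⟨k, hk⟩ := hb j h' (by omega) hI hi
      have hbody : M.Runs (c ;; RAM.set i (.reg i + 1)) h' (k + 1)
          (fun h'' => h''.reg i = j + 1 ∧ I (j + 1) h'' ∧ spent j h' + k ≤ spent (j + 1) h'') := by
        refine runs_seq hk ?_
        rintro h'' ⟨h1, h2⟩
        refine runs_set ?_ ?_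
        · simp [h1]; omega
        · simpa [h1] using h2
      obtain ⟨s', k', h1', h1, h2, h3, h4, h5, h10⟩ := hbody s H
      obtain ⟨s'', l', h'', t, h6, h7, h11, h8, h9⟩ := ih (j + 1) h1' (by omega) h5 h4 s' h3
      refine ⟨s'', _, h'', k + t, Exec.loop_true (H.fits _ hs) ?_ h1 h6, ?_, ?_, h8, h9⟩
      · rw [H.eval]; simp [hm j h' (by omega) hI, hi]; omega
      · omega
      · omega
  refine (runs_seq (l := K + 2 * B + 1)
    (runs_set (Q := fun h' => h' = h.set i 0) ?_ rfl) ?_).le ?_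
  · simp
  · rintro _ rfl s H
    obtain ⟨s', k', h'', t, h1, h2, h3, h4, h5⟩ := main B 0 _ (by omega) h0 (by simp) s H
    exact ⟨s', k', h'', h1, by omega, h4, h5⟩
  · omega

theorem Machine.runs_forRange {i : Reg} {m : Exp} {c : Cmd} {h : Store} {Q : Store → Prop}
    (I : ℕ → Store → Prop) (B : ℕ) (f : ℕ → ℕ) (hB : B ≤ M.U) (h0 : I 0 (h.set i 0))
    (hm : ∀ j h', j ≤ B → I j h' → m.eval h' = B)
    (hb : ∀ j h', j < B → I j h' → h'.reg i = j →
      M.Runs c h' (f j) fun h'' => h''.reg i = j ∧ I (j + 1) (h''.set i (j + 1)))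
    (hQ : ∀ h', I B h' → h'.reg i = B → Q h')
    (hs : (m - .reg i : Exp).safe = true := by rfl) :
    M.Runs (forRange i m c) h (∑ j ∈ Finset.range B, (f j + 2) + 2) Q := by
  refine (runs_forRange_amortized I B (∑ j ∈ Finset.range B, f j)
    (fun j _ => ∑ j ∈ Finset.range j, f j) hB h0 hm (fun j h' hj hI hi => ⟨f j, ?_⟩)
    (fun h' hI hi => ⟨le_rfl, hQ h' hI hi⟩) hs).le ?_
  · exact (hb j h' hj hI hi).mono (fun h'' h => ⟨h.1, h.2, by rw [Finset.sum_range_succ]⟩) le_rfl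
  · simp [Finset.sum_add_distrib]; omega

theorem Machine.runs_forRange_const {i : Reg} {m : Exp} {c : Cmd} {h : Store} {Q : Store → Prop}
    (I : ℕ → Store → Prop) (B : ℕ) (k : ℕ) (hB : B ≤ M.U) (h0 : I 0 (h.set i 0))
    (hm : ∀ j h', j ≤ B → I j h' → m.eval h' = B)
    (hb : ∀ j h', j < B → I j h' → h'.reg i = j →
      M.Runs c h' k fun h'' => h''.reg i = j ∧ I (j + 1) (h''.set i (j + 1)))
    (hQ : ∀ h', I B h' → h'.reg i = B → Q h')
    (hs : (m - .reg i : Exp).safe = true := by rfl) :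
    M.Runs (forRange i m c) h (B * (k + 2) + 2) Q :=
  (runs_forRange I B (fun _ => k) hB h0 hm hb hQ hs).le (by simp)

end RAM

/-! ### Codes of colorings -/

/-- The number with base `q` digits `f 0, …, f (D - 1)`, the least significant one first. -/
def digitCode (q D : ℕ) (f : ℕ → ℕ) : ℕ := ∑ i ∈ Finset.range D, q ^ i * f i

theorem digitCode_succ (q D : ℕ) (f : ℕ → ℕ) :
    digitCode q (D + 1) f = digitCode q D f + q ^ D * f D := by
  simp [digitCode, Finset.sum_range_succ]

theorem digitCode_lt {q D : ℕ} {f : ℕ → ℕ} (hf : ∀ i < D, f i < q) : digitCode q D f < q ^ D := by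
  induction D with
  | zero => simp [digitCode]
  | succ D ih =>
    have h1 := ih fun i hi => hf i (by omega)
    have h2 : q ^ D * (f D + 1) ≤ q ^ D * q := Nat.mul_le_mul_left _ (hf D (by omega))
    rw [digitCode_succ, pow_succ]
    rw [mul_add] at h2
    omega

theorem digitCode_div_mod {q D j : ℕ} {f : ℕ → ℕ} (hf : ∀ i < D, f i < q) (hj : j < D) :
    digitCode q D f / q ^ j % q = f j := by
  have hq : 0 < q := by have := hf j hj; omega
  have key : ∀ d, digitCode q (j + 1 + d) f =
      digitCode q j f + q ^ j * (f j + q * ∑ i ∈ Finset.range d, q ^ i * f (j + 1 + i)) := by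
    intro d
    rw [digitCode, Finset.sum_range_add, Finset.sum_range_succ, mul_add, add_assoc, digitCode]
    congr 2
    rw [Finset.mul_sum, Finset.mul_sum]
    refine Finset.sum_congr rfl fun i _ => ?_
    ring
  obtain ⟨d, rfl⟩ := Nat.exists_eq_add_of_lt hj
  rw [show j + d + 1 = j + 1 + d by ring, key d, Nat.add_mul_div_left _ _ (pow_pos hq j),
    Nat.div_eq_of_lt (digitCode_lt fun i hi => hf i (by omega)), Nat.zero_add, Nat.add_mul_mod_self_left,
    Nat.mod_eq_of_lt (hf j hj)]

theorem digitCode_congr {q D : ℕ} {f g : ℕ → ℕ} (h : ∀ i < D, f i = g i) :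
    digitCode q D f = digitCode q D g :=
  Finset.sum_congr rfl fun i hi => by rw [h i (Finset.mem_range.1 hi)]

/-- This strict monotonicity makes increasing order of codes a valid order for filling in the table
of covers. -/
theorem digitCode_lt_digitCode {q D i : ℕ} {f g : ℕ → ℕ} (hq : 0 < q) (h : ∀ i < D, f i ≤ g i)
    (hi : i < D) (hlt : f i < g i) : digitCode q D f < digitCode q D g :=
  Finset.sum_lt_sum (fun i hi => Nat.mul_le_mul_left _ (h i (Finset.mem_range.1 hi)))
    ⟨i, Finset.mem_range.2 hi, Nat.mul_lt_mul_of_pos_left hlt (pow_pos hq i)⟩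

/-! ### Elimination orders -/

/-- An elimination order of a graph on `n` vertices, in which each vertex `v` comes with a list
`slot v 0, …, slot v (D - 1)` (with repetitions) of the elements of a set that consists of `v` and
of earlier vertices, among them all earlier neighbors of `v`. If `v` is not the first vertex, then
all these vertices but `v` are in the list of an earlier vertex `par v`. -/
structure Elimination {V : Type*} (G : SimpleGraph V) (n D : ℕ) where
  rk : V → ℕ
  slot : V → ℕ → V
  par : V → V
  rk_inj : Function.Injective rk
  rk_lt : ∀ v, rk v < n
  exists_slot_self : ∀ v, ∃ i < D, slot v i = v
  rk_slot_le : ∀ v, ∀ i < D, rk (slot v i) ≤ rk v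
  exists_slot_of_adj : ∀ u v, G.Adj u v → rk u < rk v → ∃ i < D, slot v i = u
  rk_par_lt : ∀ w, 0 < rk w → rk (par w) < rk w
  exists_slot_par : ∀ w, 0 < rk w → ∀ i < D, slot w i ≠ w → ∃ j < D, slot (par w) j = slot w i

namespace Elimination

variable {V : Type*} {G : SimpleGraph V} {n D : ℕ} (E : Elimination G n D)

/-- The set of vertices listed for `v`. -/
def bag (v : V) : Set V := {u | ∃ i < D, E.slot v i = u}

theorem self_mem_bag (v : V) : v ∈ E.bag v := E.exists_slot_self v

theorem slot_mem_bag (v : V) {i : ℕ} (hi : i < D) : E.slot v i ∈ E.bag v := ⟨i, hi, rfl⟩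

theorem rk_le_of_mem_bag {u v : V} (h : u ∈ E.bag v) : E.rk u ≤ E.rk v := by
  obtain ⟨i, hi, rfl⟩ := h
  exact E.rk_slot_le v i hi

theorem mem_bag_par {u w : V} (hw : 0 < E.rk w) (h : u ∈ E.bag w) (hu : u ≠ w) :
    u ∈ E.bag (E.par w) := by
  obtain ⟨i, hi, rfl⟩ := h
  exact E.exists_slot_par w hw i hi hu

theorem par_ne {w : V} (hw : 0 < E.rk w) : E.par w ≠ w := fun h => by
  have := E.rk_par_lt w hw
  rw [h] at this
  exact lt_irrefl _ this

/-! ### Maximal cliques inside bags -/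

/-- Some maximal clique with last vertex `v` lies in the support of `φ`. -/
def Covers (v : V) (φ : V → ℕ) : Prop :=
  ∃ K : Set V, Maximal G.IsClique K ∧ v ∈ K ∧ K ⊆ E.bag v ∧ ∀ u ∈ K, φ u ≠ 0

/-- No maximal clique with last vertex `v` is monochromatic. -/
def Good (v : V) (φ : V → ℕ) : Prop :=
  ¬ ∃ K : Set V, Maximal G.IsClique K ∧ v ∈ K ∧ K ⊆ E.bag v ∧ ∀ u ∈ K, φ u = φ v

theorem covers_congr {v : V} {φ ψ : V → ℕ} (h : ∀ u ∈ E.bag v, φ u = ψ u) :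
    E.Covers v φ ↔ E.Covers v ψ := by
  unfold Covers
  refine exists_congr fun K => and_congr_right fun _ => and_congr_right fun _ =>
    and_congr_right fun hK => forall₂_congr fun u hu => by rw [h u (hK hu)]

theorem good_congr {v : V} {φ ψ : V → ℕ} (h : ∀ u ∈ E.bag v, φ u = ψ u) :
    E.Good v φ ↔ E.Good v ψ := by
  unfold Good
  refine not_congr (exists_congr fun K => and_congr_right fun _ => and_congr_right fun _ =>
    and_congr_right fun hK => forall₂_congr fun u hu => ?_)
  rw [h u (hK hu), h v (E.self_mem_bag v)]

/-- With truncated subtraction, `1 - ((a - b) + (b - a))` is 1 if `a = b` and 0 otherwise. The color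
class of `v` thus becomes a support, and one table of supports answers the question for all
colorings. -/
theorem good_iff_not_covers (v : V) (φ : V → ℕ) :
    E.Good v φ ↔ ¬ E.Covers v fun u => 1 - ((φ u - φ v) + (φ v - φ u)) := by
  unfold Good Covers
  refine not_congr (exists_congr fun K => and_congr_right fun _ => and_congr_right fun _ =>
    and_congr_right fun hK => forall₂_congr fun u hu => ?_)
  show φ u = φ v ↔ 1 - ((φ u - φ v) + (φ v - φ u)) ≠ 0
  omega

/-- A monochromatic maximal clique is charged to its vertex of largest rank. The others are earlier
neighbors of that vertex, hence lie in its bag. -/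
theorem isCliqueColoring_iff [Finite V] {α : Type*} (c : α → ℕ) (hc : Function.Injective c)
    (φ : V → α) : IsCliqueColoring G φ ↔ ∀ v, E.Good v fun u => c (φ u) := by
  constructor
  · rintro h v ⟨K, hK, hv, -, hm⟩
    exact h K ⟨v, hv⟩ hK ⟨φ v, fun u hu => hc (hm u hu)⟩
  · rintro h K hne hK ⟨i, hi⟩
    obtain ⟨v, hv, hmax⟩ := Set.exists_max_image K E.rk (Set.toFinite K) hne
    refine h v ⟨K, hK, hv, fun u hu => ?_, fun u hu => by simp only [hi u hu, hi v hv]⟩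
    by_cases huv : u = v
    · exact huv ▸ E.self_mem_bag u
    · exact E.exists_slot_of_adj u v (hK.1 hu hv huv)
        (lt_of_le_of_ne (hmax u hu) fun h => huv (E.rk_inj h))

/-- The support of `φ` in the bag of `v` is a maximal clique that contains `v`. -/
def SupportIsMaximal (v : V) (φ : V → ℕ) : Prop :=
  (φ v ≠ 0 ∧ ∀ i < D, ∀ j < D, φ (E.slot v i) ≠ 0 → φ (E.slot v j) ≠ 0 →
    E.slot v i ≠ E.slot v j → G.Adj (E.slot v i) (E.slot v j)) ∧
  ∀ w, G.Adj v w → ∃ i < D, φ (E.slot v i) ≠ 0 ∧ ¬ G.Adj w (E.slot v i)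

/-- A vertex that extends a clique through `v` is a neighbor of `v`. So maximality in the whole
graph can be tested on the adjacency list of `v`, although the neighbors may lie outside the bag. -/
theorem supportIsMaximal_iff (v : V) (φ : V → ℕ) :
    E.SupportIsMaximal v φ ↔
      Maximal G.IsClique {u | u ∈ E.bag v ∧ φ u ≠ 0} ∧ v ∈ {u | u ∈ E.bag v ∧ φ u ≠ 0} := by
  constructor
  · rintro ⟨⟨h1, h2⟩, h3⟩
    have hv : v ∈ {u | u ∈ E.bag v ∧ φ u ≠ 0} := ⟨E.self_mem_bag v, h1⟩
    refine ⟨⟨?_, ?_⟩, hv⟩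
    · rintro _ ⟨⟨i, hi, rfl⟩, hi'⟩ _ ⟨⟨j, hj, rfl⟩, hj'⟩ hne
      exact h2 i hi j hj hi' hj' hne
    · intro K hK hle w hw
      by_contra hwn
      have hvw : G.Adj v w := hK (hle hv) hw fun h => hwn (h ▸ hv)
      obtain ⟨i, hi, h4, h5⟩ := h3 w hvw
      have hmem : E.slot v i ∈ {u | u ∈ E.bag v ∧ φ u ≠ 0} := ⟨E.slot_mem_bag v hi, h4⟩
      exact h5 (hK hw (hle hmem) fun h => hwn (h ▸ hmem))
  · rintro ⟨hmax, hv⟩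
    refine ⟨⟨hv.2, fun i hi j hj h1 h2 hne =>
      hmax.1 ⟨E.slot_mem_bag v hi, h1⟩ ⟨E.slot_mem_bag v hj, h2⟩ hne⟩, fun w hw => ?_⟩
    by_contra hcon
    push Not at hcon
    have hK : G.IsClique (insert w {u | u ∈ E.bag v ∧ φ u ≠ 0}) := by
      refine SimpleGraph.IsClique.insert hmax.1 ?_
      rintro _ ⟨⟨i, hi, rfl⟩, h1⟩ -
      exact hcon i hi h1
    have hw' := hmax.2 hK (Set.subset_insert _ _) (Set.mem_insert w _)
    obtain ⟨⟨i, hi, rfl⟩, h1⟩ := hw'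
    exact G.loopless.irrefl _ (hcon i hi h1)

/-- A maximal clique inside the support either equals it, or misses one of its vertices and survives
the deletion of that vertex. This recursion replaces the enumeration of all subsets of a color
class. -/
theorem covers_iff [DecidableEq V] (v : V) (φ : V → ℕ) :
    E.Covers v φ ↔ E.SupportIsMaximal v φ ∨
      ∃ i < D, φ (E.slot v i) ≠ 0 ∧ E.Covers v (Function.update φ (E.slot v i) 0) := by
  rw [supportIsMaximal_iff]
  constructor
  · rintro ⟨K, hK, hv, hsub, hφ⟩
    by_cases heq : K = {u | u ∈ E.bag v ∧ φ u ≠ 0}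
    · exact Or.inl (heq ▸ ⟨hK, hv⟩)
    · right
      have hss : K ⊆ {u | u ∈ E.bag v ∧ φ u ≠ 0} := fun u hu => ⟨hsub hu, hφ u hu⟩
      obtain ⟨_, ⟨⟨i, hi, rfl⟩, hi'⟩, hiK⟩ := Set.exists_of_ssubset (hss.ssubset_of_ne heq)
      refine ⟨i, hi, hi', K, hK, hv, hsub, fun u hu => ?_⟩
      rw [Function.update_of_ne fun h : u = E.slot v i => hiK (h ▸ hu)]
      exact hφ u hu
  · rintro (⟨h1, h2⟩ | ⟨i, hi, h0, K, hK, hv, hsub, hφ⟩)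
    · exact ⟨_, h1, h2, fun u hu => hu.1, fun u hu => hu.2⟩
    · refine ⟨K, hK, hv, hsub, fun u hu => ?_⟩
      have := hφ u hu
      by_cases h : u = E.slot v i
      · rwa [h]
      · rwa [Function.update_of_ne h] at this

/-- Each edge is counted at its later end, whose list of `D` slots contains the earlier end. -/
theorem sum_degree_le (E : Elimination G n D) [Fintype V] [DecidableRel G.Adj] :
    ∑ v, G.degree v ≤ 2 * (Fintype.card V * D) := by
  classical
  have key : ∀ v : V, (Finset.univ.filter fun u => G.Adj v u ∧ E.rk u < E.rk v).card ≤ D := by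
    intro v
    refine le_trans (Finset.card_le_card (t := (Finset.range D).image (E.slot v)) ?_)
      (Finset.card_image_le.trans (by simp))
    intro u hu
    simp only [Finset.mem_filter, Finset.mem_univ, true_and] at hu
    obtain ⟨i, hi, h⟩ := E.exists_slot_of_adj u v hu.1.symm hu.2
    exact Finset.mem_image.2 ⟨i, Finset.mem_range.2 hi, h⟩
  have hsplit : ∀ v, G.degree v = (Finset.univ.filter fun u => G.Adj v u ∧ E.rk u < E.rk v).card +
      (Finset.univ.filter fun u => G.Adj v u ∧ E.rk v < E.rk u).card := by
    intro v
    rw [← G.card_neighborFinset_eq_degree, ← Finset.card_union_of_disjoint]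
    · congr 1
      ext u
      simp only [SimpleGraph.mem_neighborFinset, Finset.mem_union, Finset.mem_filter,
        Finset.mem_univ, true_and]
      constructor
      · intro h
        rcases lt_trichotomy (E.rk u) (E.rk v) with h1 | h1 | h1
        · exact Or.inl ⟨h, h1⟩
        · exact absurd (E.rk_inj h1) h.ne'
        · exact Or.inr ⟨h, h1⟩
      · rintro (h | h) <;> exact h.1
    · refine Finset.disjoint_filter.2 fun u _ h1 h2 => ?_
      omega
  have hswap : ∑ v, (Finset.univ.filter fun u => G.Adj v u ∧ E.rk v < E.rk u).card =
      ∑ v, (Finset.univ.filter fun u => G.Adj v u ∧ E.rk u < E.rk v).card := by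
    simp only [Finset.card_filter]
    rw [Finset.sum_comm]
    simp only [G.adj_comm]
  rw [Finset.sum_congr rfl fun v _ => hsplit v, Finset.sum_add_distrib, hswap, two_mul]
  have : ∑ v, (Finset.univ.filter fun u => G.Adj v u ∧ E.rk u < E.rk v).card ≤
      Fintype.card V * D :=
    (Finset.sum_le_card_nsmul _ _ _ fun v _ => key v).trans (by simp)
  omega

/-! ### Feasible colorings of bags -/

/-- The condition that the dynamic program has recorded for `v` after the last `k` vertices have
been eliminated. -/
def Feasible [DecidableEq V] (q : ℕ) : ℕ → V → (V → ℕ) → Prop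
  | 0, v, φ => E.Good v φ
  | k + 1, v, φ => Feasible q k v φ ∧ ∀ w, E.rk w + k + 1 = n → 0 < E.rk w → E.par w = v →
      ∃ c < q, Feasible q k w (Function.update φ w c)

variable [DecidableEq V] (q : ℕ)

/-- Feasibility is a property of the coloring of one bag, and so can be tabulated. The induction
uses that the bag of an eliminated child `w` consists of `w`, which is recolored, and vertices of
the bag of its parent. -/
theorem feasible_congr {k : ℕ} {v : V} {φ ψ : V → ℕ} (h : ∀ u ∈ E.bag v, φ u = ψ u) :
    E.Feasible q k v φ ↔ E.Feasible q k v ψ := by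
  induction k generalizing v φ ψ with
  | zero => exact E.good_congr h
  | succ k ih =>
    refine and_congr (ih h) (forall_congr' fun w => forall_congr' fun _ => forall_congr' fun hw =>
      forall_congr' fun hp => exists_congr fun c => and_congr_right fun _ => ih fun u hu => ?_)
    by_cases huw : u = w
    · subst huw; simp
    · rw [Function.update_of_ne huw, Function.update_of_ne huw]
      exact h u (hp ▸ E.mem_bag_par hw hu huw)

/-- The color that `ψ` itself gives to an eliminated vertex is the witness, since updating with it
changes nothing. -/
theorem feasible_of_good {ψ : V → ℕ} (hψ : ∀ v, ψ v < q) (h : ∀ v, E.Good v ψ) (k : ℕ) (v : V) :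
    E.Feasible q k v ψ := by
  induction k generalizing v with
  | zero => exact h v
  | succ k ih =>
    exact ⟨ih v, fun w _ _ _ => ⟨ψ w, hψ w, by rw [Function.update_eq_self]; exact ih w⟩⟩

/-- The stages after `k` eliminate vertices of rank at most that of `v`, whereas the children of `v`
have larger rank. So these stages no longer touch the table of `v`. -/
theorem feasible_stable {k l : ℕ} {v : V} {φ : V → ℕ} (hk : n ≤ E.rk v + k + 1) (hl : k ≤ l) :
    E.Feasible q l v φ ↔ E.Feasible q k v φ := by
  induction l, hl using Nat.le_induction with
  | base => rfl
  | succ l hl ih =>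
    rw [Feasible, ih, and_iff_left]
    rintro w hw h0 rfl
    have := E.rk_par_lt w h0
    omega

/-- With `n - E.rk w = k + 1`, the last stage counted in the hypothesis is the elimination of `w`
itself. So the condition at the parent provides a color, and stability turns its feasibility at
stage `k` into feasibility at the final stage. -/
theorem exists_feasible {w : V} {φ : V → ℕ} (hw : 0 < E.rk w)
    (h : ∀ v, E.rk v < E.rk w → E.Feasible q (n - E.rk w) v φ) :
    ∃ c < q, E.Feasible q (n - 1) w (Function.update φ w c) := by
  have hlt := E.rk_lt w
  have h1 := h _ (E.rk_par_lt w hw)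
  obtain ⟨k, hk⟩ : ∃ k, n - E.rk w = k + 1 := ⟨n - E.rk w - 1, by omega⟩
  rw [hk] at h1
  obtain ⟨c, hc, h2⟩ := h1.2 w (by omega) hw rfl
  exact ⟨c, hc, (E.feasible_stable q (k := k) (by omega) (by omega)).2 h2⟩

/-- The invariant of the greedy coloring. Earlier vertices are unaffected by the color of `w`,
because their bags contain no vertex of larger rank than their own. -/
theorem feasible_next {w : V} {φ : V → ℕ} {c : ℕ}
    (h : ∀ v, E.rk v < E.rk w → E.Feasible q (n - E.rk w) v φ)
    (hc : E.Feasible q (n - 1) w (Function.update φ w c)) (v : V) (hv : E.rk v < E.rk w + 1) :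
    E.Feasible q (n - (E.rk w + 1)) v (Function.update φ w c) := by
  have hlt := E.rk_lt w
  by_cases hvw : v = w
  · subst hvw
    exact (E.feasible_stable q (by omega) (by omega)).1 hc
  · have hv' : E.rk v < E.rk w :=
      lt_of_le_of_ne (by omega) fun h => hvw (E.rk_inj h)
    have h1 := h v hv'
    rw [show n - E.rk w = n - (E.rk w + 1) + 1 by omega] at h1
    refine (E.feasible_congr q fun u hu => ?_).1 h1.1
    rw [Function.update_of_ne]
    rintro rfl
    have := E.rk_le_of_mem_bag hu
    omega

/-- The bag of the first vertex contains nothing else, so its color in any clique coloring can be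
taken over. -/
theorem exists_feasible_first {w : V} (hw : E.rk w = 0) (φ : V → ℕ) {ψ : V → ℕ}
    (hψ : ∀ v, ψ v < q) (h : ∀ v, E.Good v ψ) :
    ∃ c < q, E.Feasible q (n - 1) w (Function.update φ w c) := by
  refine ⟨ψ w, hψ w, (E.feasible_congr q fun u hu => ?_).1 (E.feasible_of_good q hψ h _ w)⟩
  have h1 := E.rk_le_of_mem_bag hu
  obtain rfl : u = w := E.rk_inj (by omega)
  simp

end Elimination

/-! ### Reading the input -/

namespace RAM

variable {M : Machine}

/-- Read `m` lists from the input, beginning at position `p`. The lengths go to `A` and the elements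
to `B`. -/
def readLists (m : Reg) (A B : Arr) : Cmd :=
  forRange .x (.reg m) (load .e (.reg .p) ;; put A (.reg .x) 0 (.reg .e) ;;
    set .p (.reg .p + 1) ;;
    forRange .j (.reg .e) (load .z (.reg .p) ;; put B (.reg .x) (.reg .j) (.reg .z) ;;
      set .p (.reg .p + 1)))

theorem runs_readLists {m : Reg} {A B : Arr} (hAB : A ≠ B)
    (hm : m ∉ [Reg.x, .e, .j, .z, .p]) {h : Store} {k p : ℕ} {len : ℕ → ℕ} {el : ℕ → ℕ → ℕ}
    (hk : h.reg m = k) (hp : h.reg .p = p) (hkU : k ≤ M.U)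
    (hbase : p + ∑ x ∈ Finset.range k, (len x + 1) ≤ M.base)
    (hlen : ∀ x < k, h.low (p + ∑ x ∈ Finset.range x, (len x + 1)) = len x)
    (hbound : ∀ x < k, ∀ j < len x, el x j ≤ M.U)
    (hel : ∀ x < k, ∀ j < len x,
      h.low (p + ∑ x ∈ Finset.range x, (len x + 1) + 1 + j) = el x j) :
    M.Runs (readLists m A B) h (∑ x ∈ Finset.range k, (len x * 5 + 7) + 2) fun h' =>
      Agree [.x, .e, .j, .z, .p] [A, B] h' h ∧
      h'.reg .p = p + ∑ x ∈ Finset.range k, (len x + 1) ∧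
      ∀ x < k, h'.arr A x 0 = len x ∧ ∀ j < len x, h'.arr B x j = el x j := by
  set pos : ℕ → ℕ := fun x => p + ∑ x ∈ Finset.range x, (len x + 1) with hpos
  have hpos_succ : ∀ x, pos (x + 1) = pos x + 1 + len x := fun x => by
    simp only [hpos, Finset.sum_range_succ]; ring
  have hpos_le : ∀ x ≤ k, pos x ≤ M.base := fun x hx => by
    refine le_trans (Nat.add_le_add_left (Finset.sum_le_sum_of_subset ?_) p) hbase
    exact Finset.range_mono hx
  have hbU := M.base_le
  change ∀ x < k, h.low (pos x) = len x at hlen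
  change ∀ x < k, ∀ j < len x, h.low (pos x + 1 + j) = el x j at hel
  refine (M.runs_forRange (fun x h' => Agree [.x, .e, .j, .z, .p] [A, B] h' h ∧
      h'.reg .p = pos x ∧ ∀ x' < x, h'.arr A x' 0 = len x' ∧ ∀ j < len x', h'.arr B x' j = el x' j)
    k (fun x => len x * 5 + 5) hkU ?_ ?_ ?_ ?_).le (le_refl _)
  · exact ⟨(Agree.refl _ _ _).set (by simp), by simp [hp, hpos], by simp⟩
  · rintro x h' - ⟨h1, -⟩
    rw [Exp.eval_reg, h1.reg m hm, hk]
  · rintro x h' hx ⟨h1, h2, h3⟩ hxr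
    have hle := hpos_le (x + 1) hx
    rw [hpos_succ] at hle
    refine (M.runs_load_seq ?_ (M.runs_put_seq ?_ (M.runs_set_seq ?_ (M.runs_forRange_const
      (fun j h'' => Agree [.x, .e, .j, .z, .p] [A, B] h'' h ∧ h''.reg .e = len x ∧
        h''.reg .x = x ∧ h''.reg .p = pos x + 1 + j ∧
        (∀ x' < x + 1, h''.arr A x' 0 = len x') ∧
        (∀ x' < x, ∀ j < len x', h''.arr B x' j = el x' j) ∧
        ∀ j' < j, h''.arr B x j' = el x j')
      (len x) 3 ?_ ?_ ?_ ?_ ?_)))).le (by omega)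
    · simp [h2]; omega
    · simp [h2, h1.low, hlen x hx]; omega
    · simp [h2]; omega
    · omega
    · refine ⟨(((h1.set).put).set).set, by simp [h2, h1.low, hlen x hx], by simp [hxr],
        by simp [h2], fun x' hx' => ?_, fun x' hx' j hj => ?_, by simp⟩
      · rcases Nat.lt_succ_iff_lt_or_eq.1 hx' with hlt | rfl
        · simp [hxr, hlt.ne, (h3 x' hlt).1]
        · simp [hxr, h2, h1.low, hlen _ hx]
      · simp [hAB.symm, (h3 x' hx').2 j hj]
    · rintro j h'' - ⟨-, h4, -⟩
      simp [h4]
    · rintro j h'' hj ⟨h4, h5, h6, h7, h8, h9, h10⟩ hjr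
      refine (M.runs_load_seq ?_ (M.runs_put_seq ?_ (M.runs_set ?_ ?_))).le (by omega)
      · simp [h7]; omega
      · simp [h7, h4.low, hel x hx j hj, hbound x hx j hj]
      · simp [h7]; omega
      · refine ⟨by simp [hjr], (((h4.set).put).set).set, by simp [h5], by simp [h6],
          by simp [h7]; ring, fun x' hx' => by simp [hAB, h8 x' hx'], fun x' hx' j' hj' => ?_,
          fun j' hj' => ?_⟩
        · simp [h6, hx'.ne, h9 x' hx' j' hj']
        · rcases Nat.lt_succ_iff_lt_or_eq.1 hj' with hlt | rfl
          · simp [hjr, hlt.ne, h10 j' hlt]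
          · simp [h6, hjr, h7, h4.low, hel x hx _ hj]
    · rintro h'' ⟨h4, h5, h6, h7, h8, h9, h10⟩ -
      refine ⟨h6, h4.set, by simp [h7, hpos_succ], fun x' hx' => ?_⟩
      rcases Nat.lt_succ_iff_lt_or_eq.1 hx' with hlt | rfl
      · exact ⟨h8 x' hx', h9 x' hlt⟩
      · exact ⟨h8 _ hx', h10⟩
  · exact fun h' h1 _ => h1

end RAM

namespace RAM

variable {M : Machine}

/-- The arrays `A` and `B` hold the lengths and the elements of the first `k` of the lists `L`. -/
def Holds (h : Store) (A B : Arr) (k : ℕ) (L : ℕ → List ℕ) : Prop :=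
  ∀ x < k, h.arr A x 0 = (L x).length ∧
    ∀ j, ∀ hj : j < (L x).length, h.arr B x j = (L x)[j]

theorem Holds.of_agree {h h' : Store} {A B : Arr} {k : ℕ} {L : ℕ → List ℕ} {R : List Reg}
    {As : List Arr} (H : Holds h A B k L) (hag : Agree R As h' h) (hA : A ∉ As := by decide)
    (hB : B ∉ As := by decide) : Holds h' A B k L := by
  intro x hx
  rw [hag.arr A hA, hag.arr B hB]
  exact H x hx

/-! ### The adjacency matrix -/

/-- Compute the adjacency matrix. -/
def buildAdj : Cmd :=
  forRange .v (.reg .n) (forRange .j (.get .deg (.reg .v) 0)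
    (put .adj (.reg .v) (.get .nb (.reg .v) (.reg .j)) 1))

theorem runs_buildAdj {h : Store} {n : ℕ} {L : ℕ → List ℕ} (hn : h.reg .n = n) (hnU : n ≤ M.U)
    (hL : Holds h .deg .nb n L) (hLU : ∀ v < n, (L v).length ≤ M.U)
    (h0 : ∀ a b, h.arr .adj a b = 0) :
    M.Runs buildAdj h (∑ v ∈ Finset.range n, ((L v).length * 3 + 4) + 2) fun h' =>
      Agree [.v, .j] [.adj] h' h ∧
      ∀ u < n, ∀ v, h'.arr .adj u v = if v ∈ L u then 1 else 0 := by
  have h1U : 1 ≤ M.U := by have := M.le_U; omega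
  refine (M.runs_forRange (fun x h' => Agree [.v, .j] [.adj] h' h ∧
    (∀ u < x, ∀ v, h'.arr .adj u v = if v ∈ L u then 1 else 0) ∧
    (∀ u, x ≤ u → ∀ v, h'.arr .adj u v = 0))
    n (fun v => (L v).length * 3 + 2) hnU ?_ ?_ ?_ ?_).le (le_refl _)
  · exact ⟨(Agree.refl _ _ _).set, by simp, by simp [h0]⟩
  · rintro x h' - ⟨h1, -⟩
    simp [h1.reg, hn]
  · rintro x h' hx ⟨h1, h2, h3⟩ hxr
    refine (M.runs_forRange_const (fun j h'' => Agree [.v, .j] [.adj] h'' h ∧ h''.reg .v = x ∧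
      (∀ u < x, ∀ v, h''.arr .adj u v = if v ∈ L u then 1 else 0) ∧
      (∀ v, h''.arr .adj x v = if v ∈ (L x).take j then 1 else 0) ∧
      (∀ u, x + 1 ≤ u → ∀ v, h''.arr .adj u v = 0)) (L x).length 1 (hLU x hx) ?_ ?_ ?_ ?_).le
      (le_refl _)
    · exact ⟨h1.set, by simp [hxr], by simpa using h2, by simpa using h3 x le_rfl,
        fun u hu => by simpa using h3 u (by omega)⟩
    · rintro j h'' - ⟨h4, h5, -⟩
      simp [h5, ((hL.of_agree h4) x hx).1]
    · rintro j h'' hj ⟨h4, h5, h6, h7, h8⟩ hjr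
      refine M.runs_put (by simpa using h1U) ?_
      have hLj : h''.arr .nb x j = (L x)[j] := ((hL.of_agree h4) x hx).2 j hj
      refine ⟨by simp [hjr], (h4.put).set, by simp [h5], fun u hu v => ?_, fun v => ?_,
        fun u hu v => ?_⟩
      · simp [h5, hu.ne, h6 u hu]
      · simp only [Store.arr_set, Store.arr_put, Exp.eval_reg, h5, Exp.eval_get, hjr, hLj, h7,
          List.take_add_one, List.getElem?_eq_getElem hj]
        simp only [true_and, Exp.eval_one, Option.toList_some, List.mem_append, List.mem_singleton]
        split_ifs <;> tauto
      · have hne : ¬ u = x := by omega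
        simp [h5, hne, h8 u hu]
    · rintro h'' ⟨h4, h5, h6, h7, h8⟩ -
      refine ⟨h5, h4.set, fun u hu v => ?_, h8⟩
      rcases Nat.lt_succ_iff_lt_or_eq.1 hu with hlt | rfl
      · exact h6 u hlt v
      · simpa using h7 v
  · exact fun h' h1 _ => ⟨h1.1, h1.2.1⟩

/-! ### The maximal size of a bag and the number of colorings -/

/-- Compute the maximal size of a bag. -/
def maxBag : Cmd :=
  set .D 0 ;; forRange .x (.reg .N) (set .D (.reg .D + (.get .bsz (.reg .x) 0 - .reg .D)))

theorem runs_maxBag {h : Store} {N : ℕ} {L : ℕ → List ℕ} (hN : h.reg .N = N) (hNU : N ≤ M.U)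
    (hL : Holds h .bsz .bag N L) (hLU : ∀ x < N, (L x).length ≤ M.U) :
    M.Runs maxBag h (N * 3 + 3) fun h' =>
      Agree [.D, .x] [] h' h ∧
      h'.reg .D = (Finset.range N).sup fun x => (L x).length := by
  refine (M.runs_set_seq (by simp) (M.runs_forRange_const (fun x h' => Agree [.D, .x] [] h' h ∧
    h'.reg .D = (Finset.range x).sup fun x => (L x).length) N 1 hNU ?_ ?_ ?_ ?_)).le (le_refl _)
  · exact ⟨((Agree.refl _ _ _).set).set, by simp⟩
  · rintro x h' - ⟨h1, -⟩
    simp [h1.reg, hN]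
  · rintro x h' hx ⟨h1, h2⟩ hxr
    -- With truncated subtraction, `d + (s - d)` is the maximum of `d` and `s`.
    have hsup : (Finset.range (x + 1)).sup (fun x => (L x).length) =
        h'.reg .D + ((L x).length - h'.reg .D) := by
      rw [Finset.range_add_one, Finset.sup_insert, ← h2]
      omega
    have hle : (Finset.range (x + 1)).sup (fun x => (L x).length) ≤ M.U :=
      Finset.sup_le fun y hy => hLU y (by have := Finset.mem_range.1 hy; omega)
    have hLx := ((hL.of_agree h1) x hx).1
    refine M.runs_set ?_ ⟨by simp [hxr], (h1.set).set, ?_⟩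
    · simpa [hxr, hLx, ← hsup] using hle
    · simp [hxr, hLx, hsup]
  · exact fun h' h1 _ => h1

/-- Compute the number of colorings of `D` vertices. -/
def powQ : Cmd :=
  set .Q 1 ;; forRange .i (.reg .D) (set .Q (.reg .Q * .reg .q))

theorem runs_powQ {h : Store} {q D : ℕ} (hq : h.reg .q = q) (hD : h.reg .D = D) (hq0 : 0 < q)
    (hDU : D ≤ M.U) (hU : q ^ D ≤ M.U) :
    M.Runs powQ h (D * 3 + 3) fun h' => Agree [.Q, .i] [] h' h ∧ h'.reg .Q = q ^ D := by
  have h1U : 1 ≤ M.U := by have := M.le_U; omega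
  refine (M.runs_set_seq (by simpa using h1U) (M.runs_forRange_const
    (fun x h' => Agree [.Q, .i] [] h' h ∧ h'.reg .Q = q ^ x) D 1 hDU ?_ ?_ ?_ ?_)).le (le_refl _)
  · exact ⟨((Agree.refl _ _ _).set).set, by simp⟩
  · rintro x h' - ⟨h1, -⟩
    simp [h1.reg, hD]
  · rintro x h' hx ⟨h1, h2⟩ hxr
    refine M.runs_set ?_ ⟨by simp [hxr], (h1.set).set, ?_⟩
    · rw [Exp.eval_mul, Exp.eval_reg, Exp.eval_reg, h2, h1.reg .q (by simp), hq, ← pow_succ]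
      exact (Nat.pow_le_pow_right hq0 hx).trans hU
    · simp [h2, h1.reg, hq, pow_succ]
  · exact fun h' h1 _ => h1

/-! ### Breadth-first search in the tree -/

/-- List the nodes of the tree in the order of a breadth-first search from node `0`. -/
def search : Cmd :=
  put .seen 0 0 1 ;; set .cnt 1 ;; forRange .a (.reg .N) (set .x (.get .queue (.reg .a) 0) ;;
    forRange .j (.get .tdeg (.reg .x) 0) (set .y (.get .tnb (.reg .x) (.reg .j)) ;;
      put .queue (.reg .cnt) 0 (.reg .y) ;;
      set .cnt (.reg .cnt + (1 - .get .seen (.reg .y) 0)) ;;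
      put .seen (.reg .y) 0 1))

/-- The nodes `queue 0, …, queue (t - 1)` have been seen. -/
structure SearchInv (N : ℕ) (L : ℕ → List ℕ) (queue seen : ℕ → ℕ) (t : ℕ) : Prop where
  pos : 0 < t
  first : queue 0 = 0
  lt : ∀ i < t, queue i < N
  seen_iff : ∀ v, seen v ≠ 0 ↔ ∃ i < t, queue i = v
  inj : ∀ i < t, ∀ j < t, queue i = queue j → i = j
  prev : ∀ i < t, 0 < i → ∃ p < i, queue i ∈ L (queue p)

theorem SearchInv.le {N : ℕ} {L : ℕ → List ℕ} {queue seen : ℕ → ℕ} {t : ℕ}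
    (H : SearchInv N L queue seen t) : t ≤ N := by
  have := Finset.card_le_card_of_injOn (s := Finset.range t) (t := Finset.range N) queue
    (fun i hi => by simpa using H.lt i (by simpa using hi))
    (fun i hi j hj h => H.inj i (by simpa using hi) j (by simpa using hj) h)
  simpa using this

theorem SearchInv.ge {N : ℕ} {L : ℕ → List ℕ} {queue seen : ℕ → ℕ} {t : ℕ}
    (H : SearchInv N L queue seen t) (h : ∀ x < N, seen x ≠ 0) : N ≤ t := by
  have : (Finset.range N) ⊆ (Finset.range t).image queue := fun x hx => by
    obtain ⟨i, hi, rfl⟩ := (H.seen_iff x).1 (h x (by simpa using hx))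
    exact Finset.mem_image_of_mem _ (by simpa using hi)
  simpa using (Finset.card_le_card this).trans Finset.card_image_le

/-- The node `y` is written behind the queue in any case, but the queue grows only if `y` is new. If
it is not, the entry lies outside the valid range and is harmless. -/
theorem SearchInv.step {N : ℕ} {L : ℕ → List ℕ} {queue seen : ℕ → ℕ} {t y p : ℕ}
    (H : SearchInv N L queue seen t) (hy : y < N) (hp : p < t) (hyp : y ∈ L (queue p)) :
    SearchInv N L (Function.update queue t y) (Function.update seen y 1) (t + (1 - seen y)) := by
  have hq : ∀ i < t, Function.update queue t y i = queue i := fun i hi =>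
    Function.update_of_ne hi.ne _ _
  by_cases hs : seen y = 0
  · have hny : ∀ i < t, queue i ≠ y := fun i hi h => (H.seen_iff y).2 ⟨i, hi, h⟩ hs
    have hlt : ∀ {i}, i < t + (1 - seen y) → i < t ∨ i = t := fun {i} hi => by omega
    refine ⟨by omega, by rw [hq 0 H.pos, H.first], fun i hi => ?_, fun v => ?_,
      fun i hi j hj h => ?_, fun i hi h0 => ?_⟩
    · rcases hlt hi with h | rfl
      · rw [hq i h]; exact H.lt i h
      · simpa using hy
    · by_cases hv : v = y
      · subst hv
        simp only [Function.update_self, ne_eq, one_ne_zero, not_false_eq_true, true_iff]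
        exact ⟨t, by omega, by simp⟩
      · rw [Function.update_of_ne hv, H.seen_iff]
        constructor
        · rintro ⟨i, hi, rfl⟩
          exact ⟨i, by omega, hq i hi⟩
        · rintro ⟨i, hi, rfl⟩
          rcases hlt hi with h | rfl
          · exact ⟨i, h, (hq i h).symm⟩
          · simp at hv
    · rcases hlt hi with hi | rfl <;> rcases hlt hj with hj | rfl
      · rw [hq i hi, hq j hj] at h
        exact H.inj i hi j hj h
      · rw [hq i hi, Function.update_self] at h
        exact absurd h (hny i hi)
      · rw [hq j hj, Function.update_self] at h
        exact absurd h.symm (hny j hj)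
      · rfl
    · rcases hlt hi with hi | rfl
      · obtain ⟨p, hp, h⟩ := H.prev i hi h0
        exact ⟨p, hp, by rwa [hq i hi, hq p (hp.trans hi)]⟩
      · exact ⟨p, hp, by rwa [Function.update_self, hq p hp]⟩
  · have ht : t + (1 - seen y) = t := by omega
    rw [ht]
    have hs' : ∀ v, Function.update seen y 1 v ≠ 0 ↔ seen v ≠ 0 := fun v => by
      by_cases hv : v = y
      · subst hv; simp [hs]
      · rw [Function.update_of_ne hv]
    refine ⟨H.pos, by rw [hq 0 H.pos, H.first], fun i hi => by rw [hq i hi]; exact H.lt i hi,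
      fun v => ?_, fun i hi j hj h => ?_, fun i hi h0 => ?_⟩
    · rw [hs', H.seen_iff]
      exact exists_congr fun i => and_congr_right fun hi => by rw [hq i hi]
    · rw [hq i hi, hq j hj] at h
      exact H.inj i hi j hj h
    · obtain ⟨p, hp, h⟩ := H.prev i hi h0
      exact ⟨p, hp, by rwa [hq i hi, hq p (hp.trans hi)]⟩

theorem runs_search {h : Store} {N : ℕ} {L : ℕ → List ℕ} (hN : h.reg .N = N) (hNU : N < M.U)
    (hN0 : 0 < N) (hL : Holds h .tdeg .tnb N L) (hLU : ∀ x < N, (L x).length ≤ M.U)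
    (hLN : ∀ x < N, ∀ y ∈ L x, y < N)
    (hconn : ∀ S : ℕ → Prop, S 0 → (∀ x < N, S x → ∀ y ∈ L x, S y) → ∀ x < N, S x)
    (h0 : ∀ a b, h.arr .queue a b = 0) (h0' : ∀ a b, h.arr .seen a b = 0) :
    M.Runs search h (∑ x ∈ Finset.range N, ((L x).length * 6 + 3) + 2 * N + 4) fun h' =>
      Agree [.a, .x, .j, .y, .cnt] [.queue, .seen] h' h ∧
      (∀ i < N, h'.arr .queue i 0 < N) ∧
      (∀ i < N, ∀ j < N, h'.arr .queue i 0 = h'.arr .queue j 0 → i = j) ∧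
      ∀ i < N, 0 < i → ∃ p < i, h'.arr .queue i 0 ∈ L (h'.arr .queue p 0) := by
  have h1U : 1 ≤ M.U := by have := M.le_U; omega
  -- Once all queued nodes have been processed, the seen nodes are closed under adjacency, hence
  -- comprise the whole tree. This shows that the queue does not run dry before round `N`, and that
  -- it is complete at the end.
  have full : ∀ {a : ℕ} {queue seen : ℕ → ℕ} {t : ℕ}, SearchInv N L queue seen t →
      (∀ i < a, i < t → ∀ y ∈ L (queue i), seen y ≠ 0) → t ≤ a → N ≤ t := by
    intro a queue seen t H h1 h2
    refine H.ge (hconn _ ((H.seen_iff 0).2 ⟨0, H.pos, H.first⟩) fun x hx hs y hy => ?_)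
    obtain ⟨i, hi, rfl⟩ := (H.seen_iff x).1 hs
    exact h1 i (by omega) hi y hy
  refine (M.runs_put_seq (by simpa using h1U) (M.runs_set_seq (by simpa using h1U)
    (M.runs_forRange_amortized (fun a h' => Agree [.a, .x, .j, .y, .cnt] [.queue, .seen] h' h ∧
      SearchInv N L (fun i => h'.arr .queue i 0) (fun i => h'.arr .seen i 0) (h'.reg .cnt) ∧
      ∀ i < a, i < h'.reg .cnt → ∀ y ∈ L (h'.arr .queue i 0), h'.arr .seen y 0 ≠ 0)
      N (∑ x ∈ Finset.range N, ((L x).length * 6 + 3))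
      (fun a h' => ∑ i ∈ Finset.range a, ((L (h'.arr .queue i 0)).length * 6 + 3))
      hNU.le ?_ ?_ ?_ ?_))).le ?_
  · refine ⟨(((Agree.refl _ _ _).put).set).set, ?_, by simp⟩
    refine ⟨by simp, by simp [h0], ?_, ?_, ?_, ?_⟩
    · simp [h0, hN0]
    · intro v
      simp [h0, h0', eq_comm]
    · simp
    · simp
  · rintro a h' - ⟨h1, -⟩
    simp [h1.reg, hN]
  · rintro a h' ha ⟨h1, h2, h3⟩ har
    have hat : a < h'.reg .cnt := by
      by_contra hcon
      have := full h2 h3 (by omega)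
      omega
    set x := h'.arr .queue a 0 with hx
    have hxN : x < N := h2.lt a hat
    refine ⟨(L x).length * 6 + 3, (M.runs_set_seq ?_ (M.runs_forRange_const
      (fun j h'' => Agree [.a, .x, .j, .y, .cnt] [.queue, .seen] h'' h ∧
        h''.reg .a = a ∧ h''.reg .x = x ∧ a < h''.reg .cnt ∧
        SearchInv N L (fun i => h''.arr .queue i 0) (fun i => h''.arr .seen i 0) (h''.reg .cnt) ∧
        (∀ i ≤ a, h''.arr .queue i 0 = h'.arr .queue i 0) ∧
        (∀ i < a, ∀ y ∈ L (h''.arr .queue i 0), h''.arr .seen y 0 ≠ 0) ∧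
        ∀ y ∈ (L x).take j, h''.arr .seen y 0 ≠ 0)
      (L x).length 4 (hLU x hxN) ?_ ?_ ?_ ?_)).le (by omega)⟩
    · simp [har, ← hx]; omega
    · refine ⟨(h1.set).set, by simp [har], by simp [har, ← hx], by simpa using hat,
        by simpa using h2, by simp, fun i hi => ?_, by simp⟩
      simpa using h3 i hi (by omega)
    · rintro j h'' - ⟨h4, h5, h6, -⟩
      simp [h6, ((hL.of_agree h4) x hxN).1]
    · rintro j h'' hj ⟨h4, h5, h6, h7, h8, h9, h10, h11⟩ hjr
      have hy : h''.arr .tnb x j = (L x)[j] := ((hL.of_agree h4) x hxN).2 j hj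
      set y := (L x)[j] with hydef
      have hymem : y ∈ L x := List.getElem_mem hj
      have hyN : y < N := hLN x hxN y hymem
      have hstep := h8.step (p := a) hyN h7 (by
        simpa only [h9 a le_rfl, ← hx] using hymem)
      have hle := hstep.le
      have hqe : ∀ i, (if i = h''.reg .cnt then y else h''.arr .queue i 0) =
          Function.update (fun i => h''.arr .queue i 0) (h''.reg .cnt) y i := fun i => by
        simp [Function.update_apply]
      have hse : ∀ i, (if i = y then 1 else h''.arr .seen i 0) =
          Function.update (fun i => h''.arr .seen i 0) y 1 i := fun i => by
        simp [Function.update_apply]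
      refine (M.runs_set_seq ?_ (M.runs_put_seq ?_ (M.runs_set_seq ?_ (M.runs_put ?_ ?_)))).le
        (by omega)
      · simp [h6, hjr, hy]; omega
      · simp [h6, hjr, hy]; omega
      · simp [h6, hjr, hy]; omega
      · simpa using h1U
      · refine ⟨by simp [hjr], (((((h4.set).put).set).put)).set, by simp [h5], by simp [h6],
          by simp; omega, ?_, fun i hi => ?_, fun i hi z hz => ?_, fun z hz => ?_⟩
        · simpa [h6, hjr, hy, hqe, hse] using hstep
        · have hne : ¬ i = h''.reg .cnt := by omega
          simp [h6, hjr, hy, hne, h9 i hi]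
        · have hne : ¬ i = h''.reg .cnt := by omega
          simp only [Store.arr_set, Store.arr_put, Store.reg_set, Store.reg_put, Exp.eval_reg,
            Exp.eval_get, Exp.eval_zero, Exp.eval_one, h6, hjr, hy, hne, reduceCtorEq, true_and,
            false_and, if_false, if_true, and_true] at hz ⊢
          split_ifs
          · exact one_ne_zero
          · exact h10 i hi z hz
        · rw [List.take_add_one, List.getElem?_eq_getElem hj] at hz
          simp only [Option.toList_some, List.mem_append, List.mem_singleton] at hz
          simp only [Store.arr_set, Store.arr_put, Store.reg_set, Store.reg_put, Exp.eval_reg,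
            Exp.eval_get, Exp.eval_zero, Exp.eval_one, h6, hjr, hy, reduceCtorEq, true_and,
            false_and, if_false, if_true, and_true]
          split_ifs with hzy
          · exact one_ne_zero
          · exact h11 z (hz.resolve_right hzy)
    · rintro h'' ⟨h4, h5, h6, h7, h8, h9, h10, h11⟩ -
      refine ⟨h5, ⟨h4.set, by simpa using h8, fun i hi _ y hy => ?_⟩, ?_⟩
      · rcases Nat.lt_succ_iff_lt_or_eq.1 hi with hlt | rfl
        · exact h10 i hlt y hy
        · rw [Store.arr_set, h9 i le_rfl, ← hx] at hy
          exact h11 y (by simpa using hy)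
      · rw [Finset.sum_range_succ, Store.arr_set, h9 a le_rfl, ← hx]
        refine Nat.add_le_add_right (le_of_eq (Finset.sum_congr rfl fun i hi => ?_)) _
        rw [h9 i (Finset.mem_range.1 hi).le]
  · rintro h' ⟨h1, h2, h3⟩ -
    have hle := h2.le
    have hge := full h2 h3 hle
    obtain hcnt : h'.reg .cnt = N := by omega
    rw [hcnt] at h2
    refine ⟨?_, h1, h2.lt, h2.inj, h2.prev⟩
    -- The queue has no repetitions, so the rounds together pay for each adjacency list of the tree
    -- at most once.
    rw [← Finset.sum_image (f := fun x => (L x).length * 6 + 3) (g := fun i => h'.arr .queue i 0)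
      (s := Finset.range N) fun i hi j hj h => h2.inj i (by simpa using hi) j (by simpa using hj) h]
    refine Finset.sum_le_sum_of_subset fun x hx => ?_
    obtain ⟨i, hi, rfl⟩ := Finset.mem_image.1 hx
    exact Finset.mem_range.2 (h2.lt i (Finset.mem_range.1 hi))
  · omega

end RAM

/-! ### Numbering the vertices -/

namespace RAM

variable {M : Machine}

/-- The vertex `u` has been numbered before `v`. -/
def Before (num : ℕ → ℕ) (u v : ℕ) : Prop := num u ≠ 0 ∧ num u < num v

/-- The data recorded for the vertex `v`, which has been numbered when the node `a` was visited. -/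
structure Recorded (D : ℕ) (B : ℕ → List ℕ) (num slot : ℕ → ℕ) (par v a : ℕ) : Prop where
  mem : v ∈ B a
  first : ∀ a' < a, v ∉ B a'
  before : ∀ u, Before num u v → ∃ a' ≤ a, u ∈ B a'
  slot_mem : ∀ i < D, slot i = v ∨ slot i ∈ B a ∧ Before num (slot i) v
  exists_self : ∃ i < D, slot i = v
  exists_slot : ∀ u ∈ B a, Before num u v → ∃ i < D, slot i = u
  par_spec : (par ∈ B a ∧ Before num par v ∧ ∀ u ∈ B a, Before num u v → num u ≤ num par) ∨
    ((∀ u ∈ B a, ¬ Before num u v) ∧ (2 ≤ num v → num par = 1))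

/-- The state of the numbering after the nodes before `a` and `j` vertices in the bag of `a` have
been visited. -/
structure NumInv (n D : ℕ) (B : ℕ → List ℕ) (a j : ℕ) (num ord : ℕ → ℕ) (slot : ℕ → ℕ → ℕ)
    (par : ℕ → ℕ) (cnt : ℕ) : Prop where
  num_le : ∀ v, num v ≠ 0 → num v ≤ cnt ∧ v < n
  num_ord : ∀ i < cnt, num (ord i) = i + 1
  ord_num : ∀ v, num v ≠ 0 → ord (num v - 1) = v
  num_iff : ∀ v, num v ≠ 0 ↔ (∃ a' < a, v ∈ B a') ∨ v ∈ (B a).take j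
  recorded : ∀ v, num v ≠ 0 → ∃ a' ≤ a, Recorded D B num (slot v) (par v) v a'

section NumInv

variable {n D : ℕ} {B : ℕ → List ℕ} {a j : ℕ} {num ord : ℕ → ℕ} {slot : ℕ → ℕ → ℕ} {par : ℕ → ℕ}
  {cnt : ℕ}

theorem NumInv.cnt_le (H : NumInv n D B a j num ord slot par cnt) : cnt ≤ n := by
  have := Finset.card_le_card_of_injOn (s := Finset.range cnt) (t := Finset.range n) ord
    (fun i hi => by
      have hi' : i < cnt := by simpa using hi
      simpa using (H.num_le (ord i) (by rw [H.num_ord i hi']; omega)).2)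
    (fun i hi j hj h => by
      have h1 := H.num_ord i (by simpa using hi)
      have h2 := H.num_ord j (by simpa using hj)
      rw [h] at h1
      omega)
  simpa using this

theorem NumInv.next (H : NumInv n D B a (B a).length num ord slot par cnt) :
    NumInv n D B (a + 1) 0 num ord slot par cnt := by
  refine ⟨H.num_le, H.num_ord, H.ord_num, fun v => ?_, fun v hv => ?_⟩
  · rw [H.num_iff]
    simp only [List.take_length, List.take_zero, List.not_mem_nil, or_false]
    constructor
    · rintro (⟨a', h, h'⟩ | h)
      · exact ⟨a', by omega, h'⟩
      · exact ⟨a, by omega, h⟩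
    · rintro ⟨a', h, h'⟩
      rcases Nat.lt_succ_iff_lt_or_eq.1 h with h | rfl
      · exact Or.inl ⟨a', h, h'⟩
      · exact Or.inr h'
  · obtain ⟨a', h, h'⟩ := H.recorded v hv
    exact ⟨a', by omega, h'⟩

theorem NumInv.skip (H : NumInv n D B a j num ord slot par cnt) (hj : j < (B a).length)
    (hv : num (B a)[j] ≠ 0) : NumInv n D B a (j + 1) num ord slot par cnt := by
  refine ⟨H.num_le, H.num_ord, H.ord_num, fun v => ?_, H.recorded⟩
  rw [List.take_add_one, List.getElem?_eq_getElem hj]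
  simp only [Option.toList_some, List.mem_append, List.mem_singleton]
  rw [← or_assoc, ← H.num_iff, iff_self_or]
  rintro rfl
  exact hv

/-- The new number exceeds all earlier ones. So the relation `Before` towards old vertices does not
change, and a vertex comes before the new one iff it already has a number. -/
theorem NumInv.record (H : NumInv n D B a j num ord slot par cnt) (hj : j < (B a).length)
    (hB : ∀ v ∈ B a, v < n) (hD : (B a).length ≤ D) {v p : ℕ} (hvj : (B a)[j] = v)
    (hv : num v = 0) {s : ℕ → ℕ}
    (hs : ∀ i < D, ∀ hi : i < (B a).length, num (B a)[i] ≠ 0 → s i = (B a)[i])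
    (hs' : ∀ i < D, (∀ hi : i < (B a).length, num (B a)[i] = 0) → s i = v)
    (hp : (p ∈ B a ∧ num p ≠ 0 ∧ ∀ u ∈ B a, num u ≤ num p) ∨
      ((∀ u ∈ B a, num u = 0) ∧ p = ord 0)) :
    NumInv n D B a (j + 1) (Function.update num v (cnt + 1)) (Function.update ord cnt v)
      (Function.update slot v s) (Function.update par v p) (cnt + 1) := by
  have hvB : v ∈ B a := hvj ▸ List.getElem_mem hj
  have hne : ∀ u, num u ≠ 0 → u ≠ v := fun u hu h => hu (h ▸ hv)
  have hnum : ∀ u, u ≠ v → Function.update num v (cnt + 1) u = num u := fun u hu =>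
    Function.update_of_ne hu _ _
  have hold : ∀ w, num w ≠ 0 → ∀ u, Before (Function.update num v (cnt + 1)) u w ↔ Before num u w := by
    intro w hw u
    unfold Before
    rw [hnum w (hne w hw)]
    by_cases hu : u = v
    · subst hu
      have := (H.num_le w hw).1
      simp only [Function.update_self, hv]
      omega
    · rw [hnum u hu]
  have hnew : ∀ u, Before (Function.update num v (cnt + 1)) u v ↔ num u ≠ 0 := by
    intro u
    unfold Before
    rw [Function.update_self]
    by_cases hu : u = v
    · subst hu; simp [hv]
    · rw [hnum u hu]
      refine ⟨fun h => h.1, fun h => ⟨h, ?_⟩⟩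
      have := (H.num_le u h).1
      omega
  refine ⟨fun w hw => ?_, fun i hi => ?_, fun w hw => ?_, fun w => ?_, fun w hw => ?_⟩
  · by_cases hwv : w = v
    · subst hwv; exact ⟨by simp, hB _ hvB⟩
    · rw [hnum w hwv] at hw ⊢
      have := H.num_le w hw
      exact ⟨by omega, this.2⟩
  · rcases Nat.lt_succ_iff_lt_or_eq.1 hi with hlt | rfl
    · rw [Function.update_of_ne hlt.ne, hnum, H.num_ord i hlt]
      exact hne _ (by rw [H.num_ord i hlt]; omega)
    · simp
  · by_cases hwv : w = v
    · subst hwv; simp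
    · rw [hnum w hwv] at hw ⊢
      have := (H.num_le w hw).1
      rw [Function.update_of_ne (by omega), H.ord_num w hw]
  · rw [List.take_add_one, List.getElem?_eq_getElem hj, hvj]
    simp only [Option.toList_some, List.mem_append, List.mem_singleton]
    rw [← or_assoc, ← H.num_iff]
    by_cases hwv : w = v
    · subst hwv; simp
    · rw [hnum w hwv]; simp [hwv]
  · by_cases hwv : w = v
    · subst hwv
      simp only [Function.update_self]
      refine ⟨a, le_rfl, hvB, fun a' ha' h => ?_, fun u hu => ?_, fun i hi => ?_, ?_,
        fun u hu hu' => ?_, ?_⟩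
      · exact (H.num_iff w).2 (Or.inl ⟨a', ha', h⟩) hv
      · rw [hnew] at hu
        rcases (H.num_iff u).1 hu with ⟨a', h, h'⟩ | h
        · exact ⟨a', h.le, h'⟩
        · exact ⟨a, le_rfl, List.mem_of_mem_take h⟩
      · by_cases hcase : ∀ hi : i < (B a).length, num (B a)[i] = 0
        · exact Or.inl (hs' i hi hcase)
        · push Not at hcase
          obtain ⟨hi', h'⟩ := hcase
          rw [hs i hi hi' h', hnew]
          exact Or.inr ⟨List.getElem_mem hi', h'⟩
      · exact ⟨j, by omega, hs' j (by omega) fun _ => by rw [hvj, hv]⟩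
      · rw [hnew] at hu'
        obtain ⟨i, hi, rfl⟩ := List.mem_iff_getElem.1 hu
        exact ⟨i, by omega, hs i (by omega) hi hu'⟩
      · rcases hp with ⟨h1, h2, h3⟩ | ⟨h1, rfl⟩
        · refine Or.inl ⟨h1, (hnew _).2 h2, fun u hu hu' => ?_⟩
          rw [hnew] at hu'
          rw [hnum u (hne u hu'), hnum p (hne p h2)]
          exact h3 u hu
        -- Without earlier vertices in the bag, the first vertex serves as parent. When the first
        -- vertex itself is recorded, `ord 0` has no meaning yet, but nothing is claimed about its
        -- parent.
        · refine Or.inr ⟨fun u hu hu' => (hnew u).1 hu' (h1 u hu), fun h2 => ?_⟩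
          rw [Function.update_self] at h2
          have := H.num_ord 0 (by omega)
          rw [hnum _ (hne _ (by omega)), this]
    · rw [hnum w hwv] at hw
      obtain ⟨a', ha', R⟩ := H.recorded w hw
      have hb := hold w hw
      rw [Function.update_of_ne hwv, Function.update_of_ne hwv]
      refine ⟨a', ha', R.mem, R.first, fun u hu => R.before u ((hb u).1 hu), fun i hi => ?_,
        R.exists_self, fun u hu hu' => R.exists_slot u hu ((hb u).1 hu'), ?_⟩
      · rw [hb]; exact R.slot_mem i hi
      · rcases R.par_spec with ⟨h1, h2, h3⟩ | ⟨h1, h2⟩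
        · refine Or.inl ⟨h1, (hb _).2 h2, fun u hu hu' => ?_⟩
          rw [hb] at hu'
          rw [hnum u (hne u hu'.1), hnum _ (hne _ h2.1)]
          exact h3 u hu hu'
        · refine Or.inr ⟨fun u hu hu' => h1 u hu ((hb u).1 hu'), fun h => ?_⟩
          rw [hnum w hwv] at h
          have := h2 h
          rw [hnum _ (hne _ (by omega)), this]

end NumInv

/-- Number the vertex `v`, found in the bag of the node `x`. -/
def recordVertex : Cmd :=
  set .best 0 ;; put .par (.reg .v) 0 (.get .ord 0 0) ;;
  forRange .i (.reg .D) (set .u (.get .bag (.reg .x) (.reg .i)) ;;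
    ifz ((.get .bsz (.reg .x) 0 - .reg .i) * .get .num (.reg .u) 0)
      (put .slot (.reg .v) (.reg .i) (.reg .u) ;;
        ifz (.get .num (.reg .u) 0 - .reg .best)
          (set .best (.get .num (.reg .u) 0) ;; put .par (.reg .v) 0 (.reg .u)) skip)
      (put .slot (.reg .v) (.reg .i) (.reg .v))) ;;
  put .ord (.reg .cnt) 0 (.reg .v) ;; set .cnt (.reg .cnt + 1) ;;
  put .num (.reg .v) 0 (.reg .cnt)

/-- Number the vertices in the order in which they are found in the bags. -/
def number : Cmd :=
  set .cnt 0 ;; forRange .a (.reg .N) (set .x (.get .queue (.reg .a) 0) ;;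
    forRange .j (.get .bsz (.reg .x) 0) (set .v (.get .bag (.reg .x) (.reg .j)) ;;
      ifz (1 - .get .num (.reg .v) 0) recordVertex skip))

/-- The condition `NumInv` for the arrays in the memory. -/
def StoreNumInv (n D : ℕ) (B : ℕ → List ℕ) (a j : ℕ) (h : Store) : Prop :=
  NumInv n D B a j (fun v => h.arr .num v 0) (fun i => h.arr .ord i 0) (h.arr .slot)
    (fun v => h.arr .par v 0) (h.reg .cnt)

theorem runs_recordVertex {h : Store} {n N D x a j v : ℕ} {B : ℕ → List ℕ} {L : ℕ → List ℕ}
    (hD : h.reg .D = D) (hDU : D ≤ M.U) (hnU : n ≤ M.U) (hL : Holds h .bsz .bag N L) (hxN : x < N)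
    (hx : h.reg .x = x) (hv : h.reg .v = v) (hBa : B a = L x)
    (H : StoreNumInv n D B a j h) (hj : j < (B a).length) (hB : ∀ v ∈ B a, v < n)
    (hlen : (B a).length ≤ D) (hvj : (B a)[j] = v) (hnum : h.arr .num v 0 = 0) :
    M.Runs recordVertex h (D * 8 + 7) fun h' =>
      Agree [.best, .i, .u, .z, .cnt] [.par, .slot, .ord, .num] h' h ∧
      StoreNumInv n D B a (j + 1) h' := by
  have hvB : v ∈ B a := hvj ▸ List.getElem_mem hj
  have hvU : v ≤ M.U := (hB v hvB).le.trans hnU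
  refine M.runs_of_le fun hr hA => ?_
  refine (M.runs_set_seq (by simp) (M.runs_put_seq (by simpa using hA _ _ _) (M.runs_seq (l := 3)
    (M.runs_forRange_const (fun i h' =>
      Agree [.best, .i, .u, .z] [.par, .slot] h' h ∧
      (∀ v' ≠ v, h'.arr .slot v' = h.arr .slot v' ∧ h'.arr .par v' = h.arr .par v') ∧
      (∀ i' < i, ∀ hi : i' < (B a).length, h.arr .num (B a)[i'] 0 ≠ 0 →
        h'.arr .slot v i' = (B a)[i']) ∧
      (∀ i' < i, (∀ hi : i' < (B a).length, h.arr .num (B a)[i'] 0 = 0) →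
        h'.arr .slot v i' = v) ∧
      (∀ i' < i, ∀ hi : i' < (B a).length, h.arr .num (B a)[i'] 0 ≤ h'.reg .best) ∧
      ((h'.reg .best = 0 ∧ h'.arr .par v 0 = h.arr .ord 0 0) ∨ (h'.reg .best ≠ 0 ∧
        h'.arr .par v 0 ∈ B a ∧ h.arr .num (h'.arr .par v 0) 0 = h'.reg .best)))
      D 6 hDU ?_ ?_ ?_ (fun h' hI _ => hI)) ?_))).le ?_
  · refine ⟨(((Agree.refl _ _ _).set).put).set, fun v' hv' => ?_, by simp, by simp, by simp, ?_⟩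
    · constructor <;> funext b <;> simp [hv, hv']
    · simp [hv]
  · rintro i h' - ⟨h1, -⟩
    simp [h1.reg, hD]
  · rintro i h' hi ⟨h1, h2, h3, h4, h5, h6⟩ hir
    have hbs := ((hL.of_agree h1) x hxN).1
    have hbag := ((hL.of_agree h1) x hxN).2
    have hxr : h'.reg .x = x := by simp [h1.reg, hx]
    have hvr : h'.reg .v = v := by simp [h1.reg, hv]
    have hnumr : h'.arr .num = h.arr .num := h1.arr .num (by simp)
    rw [← hBa] at hbs
    simp only [← hBa] at hbag
    refine M.runs_of_le fun hr' hA' => ?_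
    refine (M.runs_set_seq (by simpa using hA' _ _ _) (M.runs_ifz (fun hne => ?_) fun he => ?_)).le
      (le_refl 6) (k := 6)
    · simp only [Exp.eval_mul, Exp.eval_sub, Exp.eval_get, Exp.eval_reg, Store.reg_set,
        Store.arr_set, reduceCtorEq, if_false, if_true, Exp.eval_zero, hxr, hir, hbs,
        hnumr] at hne
      -- Past the end of the list, the truncated difference in the test is 0, so whatever the memory
      -- holds there is ignored and the slot is padded with `v`.
      have hlt : i < (B a).length := by
        by_contra hcon
        exact hne (by rw [Nat.sub_eq_zero_of_le (by omega), Nat.zero_mul])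
      rw [hbag i hlt] at hne
      have hne' : h.arr .num (B a)[i] 0 ≠ 0 := fun h => hne (by rw [h, Nat.mul_zero])
      set u := (B a)[i] with hu
      have huU : u ≤ M.U := (hB u (List.getElem_mem hlt)).le.trans hnU
      refine M.runs_put_seq (l := 3) (by simpa [hxr, hir, hbag i hlt] using huU)
        (M.runs_ifz (k := 2) (fun hgt => ?_) fun hle => ?_)
      · simp [hxr, hir, hbag i hlt, ← hu, hnumr] at hgt
        refine (M.runs_set_seq (by simpa using hA' _ _ _)
          (M.runs_put (by simpa [hxr, hir, hbag i hlt] using huU) ?_))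
        refine ⟨by simp [hir], ((((h1.set).put).set).put).set, fun v' hv' => ?_,
          fun i' hi' hi'' hn => ?_, fun i' hi' hi'' => ?_, fun i' hi' hi'' => ?_, Or.inr ?_⟩
        · constructor <;> funext b <;> simp [hvr, hv', h2 v' hv']
        · rcases Nat.lt_succ_iff_lt_or_eq.1 hi' with hlt' | rfl
          · simp [hvr, hir, hlt'.ne, h3 i' hlt' hi'' hn]
          · simp [hvr, hir, hxr, hbag _ hlt, ← hu]
        · rcases Nat.lt_succ_iff_lt_or_eq.1 hi' with hlt' | rfl
          · simp [hvr, hir, hlt'.ne, h4 i' hlt' hi'']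
          · exact absurd (hi'' hlt) hne'
        · rcases Nat.lt_succ_iff_lt_or_eq.1 hi' with hlt' | rfl
          · have := h5 i' hlt' hi''
            simp [hxr, hir, hbag i hlt, ← hu, hnumr]
            omega
          · simp [hxr, hir, hbag _ hlt, ← hu, hnumr]
        · simp [hvr, hxr, hir, hbag i hlt, ← hu, hnumr, hne']
          exact List.getElem_mem hlt
      · simp [hxr, hir, hbag i hlt, ← hu, hnumr] at hle
        refine (M.runs_skip ?_).le (by omega)
        refine ⟨by simp [hir], (((h1.set).put).set).set, fun v' hv' => ?_,
          fun i' hi' hi'' hn => ?_, fun i' hi' hi'' => ?_, fun i' hi' hi'' => ?_, ?_⟩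
        · constructor
          · funext b
            simp [hvr, hv', h2 v' hv']
          · simpa [Store.arr_put_of_ne] using (h2 v' hv').2
        · rcases Nat.lt_succ_iff_lt_or_eq.1 hi' with hlt' | rfl
          · simp [hvr, hir, hlt'.ne, h3 i' hlt' hi'' hn]
          · simp [hvr, hir, hxr, hbag _ hlt, ← hu]
        · rcases Nat.lt_succ_iff_lt_or_eq.1 hi' with hlt' | rfl
          · simp [hvr, hir, hlt'.ne, h4 i' hlt' hi'']
          · exact absurd (hi'' hlt) hne'
        · rcases Nat.lt_succ_iff_lt_or_eq.1 hi' with hlt' | rfl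
          · simpa using h5 i' hlt' hi''
          · simp [← hu]
            omega
        · simpa using h6
    · simp only [Exp.eval_mul, Exp.eval_sub, Exp.eval_get, Exp.eval_reg, Store.reg_set,
        Store.arr_set, reduceCtorEq, if_false, if_true, Exp.eval_zero, hxr, hir, hbs,
        hnumr] at he
      have hz : ∀ hi : i < (B a).length, h.arr .num (B a)[i] 0 = 0 := fun hlt => by
        rw [hbag i hlt] at he
        rcases Nat.mul_eq_zero.1 he with h | h
        · omega
        · exact h
      refine (M.runs_put (by simpa [hvr] using hvU) ?_).le (by omega)
      refine ⟨by simp [hir], ((h1.set).put).set, fun v' hv' => ?_,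
        fun i' hi' hi'' hn => ?_, fun i' hi' hi'' => ?_, fun i' hi' hi'' => ?_, ?_⟩
      · constructor
        · funext b
          simp [hvr, hv', h2 v' hv']
        · simpa [Store.arr_put_of_ne] using (h2 v' hv').2
      · rcases Nat.lt_succ_iff_lt_or_eq.1 hi' with hlt' | rfl
        · simp [hvr, hir, hlt'.ne, h3 i' hlt' hi'' hn]
        · exact absurd (hz hi'') hn
      · rcases Nat.lt_succ_iff_lt_or_eq.1 hi' with hlt' | rfl
        · simp [hvr, hir, hlt'.ne, h4 i' hlt' hi'']
        · simp [hvr, hir]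
      · rcases Nat.lt_succ_iff_lt_or_eq.1 hi' with hlt' | rfl
        · simpa using h5 i' hlt' hi''
        · simp [hz hi'']
      · simpa using h6
  · rintro h' ⟨h1, h2, h3, h4, h5, h6⟩
    have hvr : h'.reg .v = v := by simp [h1.reg, hv]
    have hcr : h'.reg .cnt = h.reg .cnt := by simp [h1.reg]
    have hrec := NumInv.record H hj hB hlen hvj hnum (p := h'.arr .par v 0) (s := h'.arr .slot v)
      h3 h4 ?_
    · have hcU := hrec.cnt_le.trans hnU
      refine (M.runs_put_seq (by simpa [hvr] using hvU) (M.runs_set_seq ?_ (M.runs_put ?_ ?_)))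
      · simpa [hcr] using hcU
      · simpa [hcr] using hcU
      · refine ⟨(((h1.trans (Agree.refl [.best, .i, .u, .z, .cnt] [.par, .slot, .ord, .num] h)).put).set).put,
        ?_⟩
        unfold StoreNumInv
        convert hrec using 1
        · funext w
          by_cases hw : w = v <;> simp [hvr, hcr, hw, h1.arr]
        · funext w
          by_cases hw : w = h.reg .cnt <;>
            simp [hvr, hcr, hw, h1.arr]
        · funext w
          by_cases hw : w = v
          · subst hw
            simp [Store.arr_put_of_ne]
          · simp [Store.arr_put_of_ne, hw, (h2 w hw).1]
        · funext w
          by_cases hw : w = v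
          · subst hw
            simp
          · simp [hw, (h2 w hw).2]
        · simp [hcr]
    · rcases h6 with ⟨h6, h7⟩ | ⟨h6, h7, h8⟩
      · refine Or.inr ⟨fun u hu => ?_, h7⟩
        obtain ⟨i, hi, rfl⟩ := List.mem_iff_getElem.1 hu
        have := h5 i (by omega) hi
        rw [h6] at this
        exact Nat.le_zero.1 this
      · refine Or.inl ⟨h7, ?_, fun u hu => ?_⟩
        · simp only [h8]; exact h6
        · obtain ⟨i, hi, rfl⟩ := List.mem_iff_getElem.1 hu
          have := h5 i (by omega) hi
          simp only [h8]
          exact this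
  · omega

theorem runs_number {h : Store} {n N D : ℕ} {L : ℕ → List ℕ} (hN : h.reg .N = N)
    (hD : h.reg .D = D) (hDU : D ≤ M.U) (hnU : n ≤ M.U) (hNU : N ≤ M.U)
    (hL : Holds h .bsz .bag N L) (hLn : ∀ x < N, ∀ v ∈ L x, v < n)
    (hLD : ∀ x < N, (L x).length ≤ D) (hq : ∀ a < N, h.arr .queue a 0 < N)
    (h0 : ∀ a b, h.arr .num a b = 0) :
    M.Runs number h (N * (D * (D * 8 + 11) + 5) + 3) fun h' =>
      Agree [.best, .i, .u, .z, .cnt, .a, .x, .j, .v] [.par, .slot, .ord, .num] h' h ∧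
      StoreNumInv n D (fun a => L (h.arr .queue a 0)) N 0 h' := by
  set B : ℕ → List ℕ := fun a => L (h.arr .queue a 0) with hBdef
  refine (M.runs_set_seq (by simp) (M.runs_forRange_const (fun a h' =>
    Agree [.best, .i, .u, .z, .cnt, .a, .x, .j, .v] [.par, .slot, .ord, .num] h' h ∧
    StoreNumInv n D B a 0 h') N (D * (D * 8 + 11) + 3) hNU ?_ ?_ ?_ ?_)).le ?_
  · refine ⟨((Agree.refl _ _ _).set).set, ?_⟩
    refine ⟨fun v hv => ?_, fun i hi => ?_, fun v hv => ?_, fun v => ?_, fun v hv => ?_⟩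
    · simp [h0] at hv
    · simp at hi
    · simp [h0] at hv
    · simp [h0]
    · simp [h0] at hv
  · rintro a h' - ⟨h1, -⟩
    simp [h1.reg, hN]
  · rintro a h' ha ⟨h1, h2⟩ har
    set x := h.arr .queue a 0 with hx
    have hxN : x < N := hq a ha
    have hBa : B a = L x := rfl
    have hqr : h'.arr .queue a 0 = x := by rw [h1.arr .queue (by simp)]
    refine (M.runs_set_seq ?_ (M.runs_forRange_const (fun j h'' =>
      Agree [.best, .i, .u, .z, .cnt, .a, .x, .j, .v] [.par, .slot, .ord, .num] h'' h ∧
      h''.reg .a = a ∧ h''.reg .x = x ∧ StoreNumInv n D B a j h'') (L x).length (D * 8 + 9)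
      ((hLD x hxN).trans hDU) ?_ ?_ ?_ ?_)).le ?_
    · simp [har, hqr]; omega
    · exact ⟨(h1.set).set, by simp [har], by simp [har, hqr], h2⟩
    · rintro j h'' - ⟨h3, -, h4, -⟩
      simp [h4, ((hL.of_agree h3) x hxN).1]
    · rintro j h'' hj ⟨h3, h4, h5, h6⟩ hjr
      have hvj : h''.arr .bag x j = (L x)[j] := ((hL.of_agree h3) x hxN).2 j hj
      set v := (L x)[j] with hv
      have hvU : v ≤ M.U := (hLn x hxN v (List.getElem_mem hj)).le.trans hnU
      refine (M.runs_set_seq (l := D * 8 + 8) (by simpa [h5, hjr, hvj] using hvU)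
        (M.runs_ifz (k := D * 8 + 7) (fun hne => ?_) fun he => ?_))
      · simp [h5, hjr, hvj] at hne
        refine (runs_recordVertex (x := x) (v := v) (N := N) (L := L) (a := a) (j := j) (B := B)
          ?_ hDU hnU (hL.of_agree (h3.set (r := .v))) hxN ?_ ?_ hBa h6 hj (hLn x hxN)
          (hLD x hxN) hv.symm ?_).mono (fun h3' hp => ?_) le_rfl
        · simp [h3.reg, hD]
        · simp [h5]
        · simp [h5, hjr, hvj]
        · simp only [Store.arr_set]
          omega
        · obtain ⟨h7, h8⟩ := hp
          refine ⟨by simp [h7.reg, hjr], ((h7.trans (h3.set))).set, by simp [h7.reg, h4],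
            by simp [h7.reg, h5], h8⟩
      · simp [h5, hjr, hvj] at he
        refine (M.runs_skip ?_).le (by omega)
        refine ⟨by simp [hjr], ((h3.set).set).set, by simp [h4], by simp [h5], ?_⟩
        exact NumInv.skip h6 hj (by
          have : h''.arr .num v 0 ≠ 0 := by omega
          exact this)
    · rintro h'' ⟨h3, h4, h5, h6⟩ -
      exact ⟨h4, h3.set, NumInv.next h6⟩
    · have := hLD x hxN
      have : (L x).length * (D * 8 + 9 + 2) ≤ D * (D * 8 + 11) := Nat.mul_le_mul_right _ this
      omega
  · exact fun h' hI _ => hI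
  · exact le_refl _

end RAM

/-! ### Elimination orders from tree decompositions -/

/-- If the nodes of a tree are listed such that each node but the first has an earlier neighbor
`τ p`, then a connected set of nodes that contains `τ m` and an earlier node contains the earlier
neighbors of `τ m`. -/
theorem SimpleGraph.IsAcyclic.mem_of_connected_of_earlier {ι : Type*} {T : SimpleGraph ι}
    (hT : T.IsAcyclic) {τ : ℕ → ι} {N : ℕ} (hinj : ∀ i < N, ∀ j < N, τ i = τ j → i = j)
    (hprev : ∀ i < N, 0 < i → ∃ p < i, T.Adj (τ i) (τ p)) {C : Set ι}
    (hC : (T.induce C).Connected) {m l p : ℕ} (hm : m < N) (hl : l < m) (hp : p < m)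
    (hmC : τ m ∈ C) (hlC : τ l ∈ C) (hadj : T.Adj (τ m) (τ p)) : τ p ∈ C := by
  classical
  -- Repeatedly passing to an earlier neighbor leads to `τ 0` without reaching the index `m`.
  have hwalk : ∀ i < m, ∃ w : T.Walk (τ i) (τ 0), ∀ x ∈ w.support, ∃ k < m, τ k = x := by
    intro i
    induction i using Nat.strong_induction_on with
    | _ i ih =>
      intro hi
      rcases Nat.eq_zero_or_pos i with rfl | h0
      · exact ⟨.nil, by simpa using ⟨0, hi, rfl⟩⟩
      · obtain ⟨k, hk, hadj⟩ := hprev i (hi.trans hm) h0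
        obtain ⟨w, hw⟩ := ih k hk (hk.trans hi)
        refine ⟨.cons hadj w, fun x hx => ?_⟩
        rw [SimpleGraph.Walk.support_cons, List.mem_cons] at hx
        rcases hx with rfl | hx
        · exact ⟨i, hi, rfl⟩
        · exact hw x hx
  obtain ⟨w₁, h₁⟩ := hwalk p hp
  obtain ⟨w₂, h₂⟩ := hwalk l hl
  have hsupp : ∀ x ∈ (w₁.append w₂.reverse).bypass.support, ∃ k < m, τ k = x := by
    intro x hx
    have hx' := SimpleGraph.Walk.support_bypass_subset_support _ hx
    rw [SimpleGraph.Walk.mem_support_append_iff, SimpleGraph.Walk.support_reverse,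
      List.mem_reverse] at hx'
    exact hx'.elim (h₁ x) (h₂ x)
  -- The two walks to `τ 0` join `τ p` to `τ l` and avoid `τ m`, so prepending `τ m` yields a path
  -- from `τ m` to `τ l` whose second vertex is `τ p`.
  have hpath : (SimpleGraph.Walk.cons hadj (w₁.append w₂.reverse).bypass).IsPath := by
    rw [SimpleGraph.Walk.cons_isPath_iff]
    refine ⟨SimpleGraph.Walk.bypass_isPath _, fun h => ?_⟩
    obtain ⟨k, hk, he⟩ := hsupp _ h
    have := hinj k (hk.trans hm) m hm he
    omega
  obtain ⟨w₃⟩ := hC.preconnected ⟨τ m, hmC⟩ ⟨τ l, hlC⟩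
  have hlift : ∀ {x y : C}, (T.induce C).Walk x y →
      ∃ w : T.Walk (x : ι) (y : ι), ∀ z ∈ w.support, z ∈ C := by
    intro x y w
    induction w with
    | nil => exact ⟨.nil, fun z hz => by simp at hz; exact hz ▸ Subtype.property _⟩
    | cons hxy w ih =>
      obtain ⟨w', hw'⟩ := ih
      refine ⟨.cons (SimpleGraph.induce_adj.1 hxy) w', fun z hz => ?_⟩
      rw [SimpleGraph.Walk.support_cons, List.mem_cons] at hz
      rcases hz with rfl | hz
      · exact Subtype.property _
      · exact hw' z hz
  obtain ⟨w₄, hw₄⟩ := hlift w₃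
  have h₄ : ∀ x ∈ w₄.bypass.support, x ∈ C := fun x hx =>
    hw₄ x (SimpleGraph.Walk.support_bypass_subset_support _ hx)
  -- Paths in a forest are unique, so the path through `τ p` is the one that runs inside `C`.
  have heq := (hT.subsingleton_path _ _).elim ⟨_, hpath⟩ ⟨_, w₄.bypass_isPath⟩
  have heq' : SimpleGraph.Walk.cons hadj (w₁.append w₂.reverse).bypass = w₄.bypass :=
    congrArg Subtype.val heq
  refine h₄ _ ?_
  rw [← heq', SimpleGraph.Walk.support_cons]
  exact List.mem_cons_of_mem _ (SimpleGraph.Walk.start_mem_support _)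

namespace RAM

/-- The bag of `v` in the elimination order is cut out of the bag of the node `top v` at which `v`
was numbered, and the parent of `w` is the latest earlier vertex at `top w`. -/
theorem exists_elimination {n N K : ℕ} {G : SimpleGraph (Fin n)} {T : SimpleGraph (Fin N)}
    (D : TreeDecomposition G T) {τ : ℕ → Fin N}
    (hinj : ∀ i < N, ∀ j < N, τ i = τ j → i = j)
    (hprev : ∀ i < N, 0 < i → ∃ p < i, T.Adj (τ i) (τ p)) {B : ℕ → List ℕ}
    (hB : ∀ a < N, ∀ v, v ∈ B a ↔ ∃ h : v < n, (⟨v, h⟩ : Fin n) ∈ D.bag (τ a))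
    {num ord : ℕ → ℕ} {slot : ℕ → ℕ → ℕ} {par : ℕ → ℕ} {cnt : ℕ}
    (H : NumInv n K B N 0 num ord slot par cnt) :
    ∃ E : Elimination G n K, (∀ v : Fin n, ∀ i < K, slot v i = E.slot v i) ∧
      (∀ w : Fin n, 0 < E.rk w → par w = E.par w) ∧ ∀ v : Fin n, ord (E.rk v) = v := by
  have hB' : ∀ a < N, ∀ v : Fin n, (v : ℕ) ∈ B a ↔ v ∈ D.bag (τ a) := fun a ha v => by
    rw [hB a ha]; exact ⟨fun ⟨_, h⟩ => h, fun h => ⟨v.2, h⟩⟩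
  have hsurj : ∀ x : Fin N, ∃ a < N, τ a = x := by
    have : Function.Injective fun a : Fin N => τ a := fun i j h =>
      Fin.ext (hinj i i.2 j j.2 h)
    intro x
    obtain ⟨a, ha⟩ := (Finite.injective_iff_surjective.1 this) x
    exact ⟨a, a.2, ha⟩
  have hcover : ∀ v : Fin n, ∃ a < N, (v : ℕ) ∈ B a := fun v => by
    obtain ⟨x, hx⟩ := D.vertex_mem v
    obtain ⟨a, ha, rfl⟩ := hsurj x
    exact ⟨a, ha, (hB' a ha v).2 hx⟩
  have hnum : ∀ v : Fin n, num v ≠ 0 := fun v => by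
    obtain ⟨a, ha, h⟩ := hcover v
    exact (H.num_iff v).2 (Or.inl ⟨a, ha, h⟩)
  -- The invariant only bounds the recording node by `N`. That it is the first node containing `v`
  -- makes the bound strict.
  have hrec : ∀ v : Fin n, ∃ a < N, Recorded K B num (slot v) (par v) v a := fun v => by
    obtain ⟨a, -, h⟩ := H.recorded v (hnum v)
    obtain ⟨a', ha', h'⟩ := hcover v
    refine ⟨a, lt_of_le_of_lt ?_ ha', h⟩
    by_contra hcon
    exact h.first a' (by omega) h'
  choose top htop R using hrec
  have hbef : ∀ u v : Fin n, Before num u v ↔ num u - 1 < num v - 1 := fun u v => by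
    have := hnum u
    have := hnum v
    unfold Before
    omega
  have hninj : ∀ u v : Fin n, num u = num v → u = v := fun u v h => by
    have h1 := H.ord_num u (hnum u)
    have h2 := H.ord_num v (hnum v)
    rw [h, h2] at h1
    exact Fin.ext h1.symm
  -- If `u` and `v` share a node after `top v`, then both also occur at nodes before it. By
  -- connectedness both occur at its earlier neighbor, and the descent ends at `top v`.
  have hcommon : ∀ u v : Fin n, Before num u v → ∀ a < N, (u : ℕ) ∈ B a → (v : ℕ) ∈ B a →
      (u : ℕ) ∈ B (top v) := by
    intro u v huv a ha
    induction a using Nat.strong_induction_on with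
    | _ a ih =>
      intro hu hv
      have hle : top v ≤ a := by
        by_contra hcon
        exact (R v).first a (by omega) hv
      rcases hle.eq_or_lt with rfl | hlt
      · exact hu
      · obtain ⟨a', ha', hu'⟩ := (R v).before u huv
        obtain ⟨p, hp, hadj⟩ := hprev a ha (by omega)
        have key : ∀ w : Fin n, ∀ l < a, (w : ℕ) ∈ B l → (w : ℕ) ∈ B a → (w : ℕ) ∈ B p := by
          intro w l hl h1 h2
          rw [hB' _ (by omega)] at h1 h2 ⊢
          exact D.isTree.isAcyclic.mem_of_connected_of_earlier hinj hprev (D.connected w) ha hl hp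
            h2 h1 hadj
        exact ih p hp (by omega) (key u a' (by omega) hu' hu) (key v (top v) hlt (R v).mem hv)
  have hlt : ∀ a < N, ∀ v ∈ B a, v < n := fun a ha v hv => ((hB a ha v).1 hv).1
  have hslot : ∀ v : Fin n, ∀ i < K, slot v i < n := fun v i hi => by
    rcases (R v).slot_mem i hi with h | h
    · rw [h]; exact v.2
    · exact hlt _ (htop v) _ h.1
  have hle : ∀ v : Fin n, ∀ i < K, num (slot v i) ≤ num v := fun v i hi => by
    rcases (R v).slot_mem i hi with h | h
    · rw [h]
    · exact h.2.2.le
  have hpar : ∀ w : Fin n, 0 < num w - 1 → par w < n ∧ Before num (par w) w := fun w hw => by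
    rcases (R w).par_spec with ⟨h1, h2, -⟩ | ⟨-, h⟩
    · exact ⟨hlt _ (htop w) _ h1, h2⟩
    · have h1 := h (by omega)
      exact ⟨(H.num_le (par w) (by omega)).2, by unfold Before; omega⟩
  let E : Elimination G n K :=
    -- Numbers start at 1, since 0 marks an unnumbered vertex. The defaults for slots from `K` on
    -- and for the parent of the first vertex are never used.
    { rk := fun v => num v - 1
      slot := fun v i => if h : i < K then ⟨slot v i, hslot v i h⟩ else v
      par := fun w => if h : 0 < num w - 1 then ⟨par w, (hpar w h).1⟩ else w
      rk_inj := fun u v h => hninj u v (by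
        have := hnum u; have := hnum v; have h : num u - 1 = num v - 1 := h; omega)
      rk_lt := fun v => by
        have := (H.num_le v (hnum v)).1
        have := H.cnt_le
        have := hnum v
        omega
      exists_slot_self := fun v => by
        obtain ⟨i, hi, h⟩ := (R v).exists_self
        exact ⟨i, hi, by simp only [hi, dif_pos]; exact Fin.ext h⟩
      rk_slot_le := fun v i hi => by
        simp only [hi, dif_pos]
        have := hle v i hi
        omega
      exists_slot_of_adj := fun u v huv h => by
        obtain ⟨x, hx1, hx2⟩ := D.edge_mem u v huv
        obtain ⟨a, ha, rfl⟩ := hsurj x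
        have hb := (hbef u v).2 h
        have hmem := hcommon u v hb a ha ((hB' a ha u).2 hx1) ((hB' a ha v).2 hx2)
        obtain ⟨i, hi, h⟩ := (R v).exists_slot u hmem hb
        exact ⟨i, hi, by simp only [hi, dif_pos]; exact Fin.ext h⟩
      rk_par_lt := fun w hw => by
        simp only [hw, dif_pos]
        have h1 := (hpar w hw).2.1
        have h2 := (hpar w hw).2.2
        omega
      exists_slot_par := fun w hw i hi hne => by
        simp only [hw, hi, dif_pos] at hne ⊢
        set u : Fin n := ⟨slot w i, hslot w i hi⟩ with hu
        have hub : slot w i ∈ B (top w) ∧ Before num (slot w i) w := by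
          rcases (R w).slot_mem i hi with h | h
          · exact absurd (Fin.ext h) hne
          · exact h
        rcases (R w).par_spec with ⟨h1, h2, h3⟩ | ⟨h, -⟩
        · set p : Fin n := ⟨par w, (hpar w hw).1⟩ with hp
          have hup : num u ≤ num p := h3 _ hub.1 hub.2
          -- Every listed `u` other than the parent `p` comes before `p` and shares the node `top w`
          -- with it. Hence it occurs at `top p` and is listed for `p`.
          rcases hup.eq_or_lt with heq | hlt'
          · obtain ⟨j, hj, h⟩ := (R p).exists_self
            rw [hninj u p heq]
            exact ⟨j, hj, by simp only [hj, dif_pos]; exact Fin.ext h⟩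
          · have hb : Before num u p := ⟨hnum u, hlt'⟩
            obtain ⟨j, hj, h⟩ := (R p).exists_slot u (hcommon u p hb (top w) (htop w) hub.1 h1) hb
            exact ⟨j, hj, by simp only [hj, dif_pos]; exact Fin.ext h⟩
        · exact absurd hub.2 (h _ hub.1) }
  refine ⟨E, fun v i hi => ?_, fun w hw => ?_, fun v => H.ord_num v (hnum v)⟩
  · simp [E, hi]
  · have hw' : 0 < num w - 1 := hw
    simp only [E, hw', dif_pos]

end RAM

/-! ### Subroutines of the dynamic program -/

namespace RAM

variable {M : Machine}

open Classical in
/-- The truth value of a proposition as a number. -/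
noncomputable def ind (P : Prop) : ℕ := if P then 1 else 0

theorem ind_true {P : Prop} (h : P) : ind P = 1 := if_pos h

theorem ind_false {P : Prop} (h : ¬ P) : ind P = 0 := if_neg h

theorem ind_congr {P R : Prop} (h : P ↔ R) : ind P = ind R := by rw [propext h]

theorem ind_le (P : Prop) : ind P ≤ 1 := by
  unfold ind
  split_ifs <;> simp

theorem ind_ne_zero {P : Prop} : ind P ≠ 0 ↔ P := by
  by_cases h : P
  · rw [ind_true h]; simpa using h
  · rw [ind_false h]; simpa using h

theorem one_sub_ind (P : Prop) : 1 - ind P = ind (¬ P) := by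
  by_cases h : P
  · rw [ind_true h, ind_false (not_not.2 h)]
  · rw [ind_false h, ind_true h]

theorem one_sub (t : ℕ) : 1 - t = ind (t = 0) := by
  by_cases h : t = 0
  · rw [ind_true h, h]
  · rw [ind_false h]; omega

theorem ind_mul_ind (P R : Prop) : ind P * ind R = ind (P ∧ R) := by
  unfold ind
  split_ifs <;> tauto

section

variable {n D : ℕ} {G : SimpleGraph (Fin n)}

/-- The code of the coloring `φ` of the bag of `v`. -/
def code (E : Elimination G n D) (q : ℕ) (v : Fin n) (φ : Fin n → ℕ) : ℕ :=
  digitCode q D fun i => φ (E.slot v i)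

/-- The current coloring. -/
def colOf (n : ℕ) (h : Store) (u : Fin n) : ℕ := h.arr .col u 0

theorem colOf_put (h : Store) (w : Fin n) (c : ℕ) :
    colOf n (h.put .col w 0 c) = Function.update (colOf n h) w c := by
  funext u
  by_cases hu : u = w
  · subst hu; simp [colOf]
  · have : (u : ℕ) ≠ w := fun h => hu (Fin.ext h)
    simp [colOf, hu, this]

theorem code_lt {E : Elimination G n D} {q : ℕ} {v : Fin n} {φ : Fin n → ℕ} (h : ∀ u, φ u < q) :
    code E q v φ < q ^ D := digitCode_lt fun _ _ => h _

theorem code_congr {E : Elimination G n D} {q : ℕ} {v : Fin n} {φ ψ : Fin n → ℕ}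
    (h : ∀ u ∈ E.bag v, φ u = ψ u) : code E q v φ = code E q v ψ :=
  digitCode_congr fun _ hi => h _ (E.slot_mem_bag v hi)

theorem code_update_lt {E : Elimination G n D} {q : ℕ} (hq : 0 < q) {v : Fin n} {φ : Fin n → ℕ}
    {i : ℕ} (hi : i < D) (hφ : φ (E.slot v i) ≠ 0) :
    code E q v (Function.update φ (E.slot v i) 0) < code E q v φ := by
  refine digitCode_lt_digitCode hq (fun j _ => ?_) hi ?_
  · by_cases h : E.slot v j = E.slot v i
    · simp [h]
    · rw [Function.update_of_ne h]
  · rw [Function.update_self]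
    omega

/-- The registers and arrays that describe the graph and the elimination order. -/
structure Env (M : Machine) (E : Elimination G n D) (q : ℕ) (L : ℕ → List ℕ) (h : Store) :
    Prop where
  reg_n : h.reg .n = n
  reg_q : h.reg .q = q
  reg_D : h.reg .D = D
  reg_Q : h.reg .Q = q ^ D
  n_le : n ≤ M.U
  q_le : q ≤ M.U
  D_le : D ≤ M.U
  Q_le : q ^ D ≤ M.U
  two_le : 2 ≤ q
  slot : ∀ v : Fin n, ∀ i < D, h.arr .slot v i = E.slot v i
  adj : ∀ u v : Fin n, h.arr .adj u v = ind (G.Adj u v)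
  holds : Holds h .deg .nb n L
  mem_iff : ∀ v : Fin n, ∀ w, w ∈ L v ↔ ∃ h : w < n, G.Adj v ⟨w, h⟩
  length_le : ∀ v < n, (L v).length ≤ M.U

theorem Env.of_agree {E : Elimination G n D} {q : ℕ} {L : ℕ → List ℕ} {h h' : Store}
    (H : Env M E q L h) {R : List Reg} {As : List Arr} (hag : Agree R As h' h)
    (h1 : ∀ r ∈ [Reg.n, .q, .D, .Q], r ∉ R := by decide)
    (h2 : ∀ A ∈ [Arr.slot, .adj, .deg, .nb], A ∉ As := by decide) : Env M E q L h' where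
  reg_n := (hag.reg _ (h1 _ (by simp))).trans H.reg_n
  reg_q := (hag.reg _ (h1 _ (by simp))).trans H.reg_q
  reg_D := (hag.reg _ (h1 _ (by simp))).trans H.reg_D
  reg_Q := (hag.reg _ (h1 _ (by simp))).trans H.reg_Q
  n_le := H.n_le
  q_le := H.q_le
  D_le := H.D_le
  Q_le := H.Q_le
  two_le := H.two_le
  slot v i hi := by rw [hag.arr _ (h2 _ (by simp))]; exact H.slot v i hi
  adj u v := by rw [hag.arr _ (h2 _ (by simp))]; exact H.adj u v
  holds := H.holds.of_agree hag (h2 _ (by simp)) (h2 _ (by simp))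
  mem_iff := H.mem_iff
  length_le := H.length_le

variable {E : Elimination G n D} {q : ℕ} {L : ℕ → List ℕ} {h : Store}

/-- The color of the vertex in the slot `i` of `v`. -/
def slotColor (v i : Reg) : Exp := .get .col (.get .slot (.reg v) (.reg i)) 0

/-- Write the coloring with code `y` of the bag of `v` into the array of colors. -/
def decode : Cmd :=
  set .z (.reg .y) ;; forRange .i (.reg .D)
    (put .col (.get .slot (.reg .v) (.reg .i)) 0 (.reg .z - .reg .z / .reg .q * .reg .q) ;;
      set .z (.reg .z / .reg .q))

/-- Slots may repeat a vertex, and then later digits overwrite earlier ones. For the code of an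
actual coloring these digits agree. Other codes yield some colors below `q`, and nothing is claimed
about their table entries. -/
theorem runs_decode (H : Env M E q L h) {v : Fin n} {y : ℕ} (hv : h.reg .v = v)
    (hy : h.reg .y = y) (hyU : y ≤ M.U) (hcol : ∀ u, colOf n h u < q) :
    M.Runs decode h (D * 4 + 3) fun h' => Agree [.z, .i] [.col] h' h ∧
      (∀ u, colOf n h' u < q) ∧
      ∀ φ : Fin n → ℕ, (∀ u, φ u < q) → code E q v φ = y → ∀ u ∈ E.bag v, colOf n h' u = φ u := by
  have hq := H.two_le
  refine (M.runs_set_seq (by simpa [hy] using hyU) (M.runs_forRange_const (fun i h' =>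
    Agree [.z, .i] [.col] h' h ∧ h'.reg .z = y / q ^ i ∧ (∀ u, colOf n h' u < q) ∧
    ∀ φ : Fin n → ℕ, (∀ u, φ u < q) → code E q v φ = y → ∀ j < i,
      colOf n h' (E.slot v j) = φ (E.slot v j)) D 2 H.D_le ?_ ?_ ?_ ?_)).le (le_refl _)
  · exact ⟨((Agree.refl _ _ _).set).set, by simp [hy], hcol, by simp⟩
  · rintro i h' - ⟨h1, -⟩
    simp [(H.of_agree h1).reg_D]
  · rintro i h' hi ⟨h1, h2, h3, h4⟩ hir
    have H' := H.of_agree h1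
    have hvr : h'.reg .v = v := by simp [h1.reg, hv]
    -- The machine has no remainder operation; a digit is extracted by division and subtraction.
    have hmod : y / q ^ i - y / q ^ i / q * q = y / q ^ i % q := by
      rw [Nat.mul_comm, Nat.mod_eq_sub]
    have hlt : y / q ^ i % q < q := Nat.mod_lt _ (by omega)
    have hqU := H.q_le
    refine M.runs_put_seq (l := 1) ?_ (M.runs_set ?_ ?_)
    · simp [h2, H'.reg_q, hmod]; omega
    · simp [h2, H'.reg_q]
      exact ((Nat.div_le_self _ _).trans (Nat.div_le_self _ _)).trans hyU
    · have hc : colOf n (h'.put .col (E.slot v i) 0 (y / q ^ i % q)) =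
          Function.update (colOf n h') (E.slot v i) (y / q ^ i % q) := colOf_put _ _ _
      refine ⟨by simp [hir], ((h1.put).set).set, by simp [h2, H'.reg_q, Nat.div_div_eq_div_mul, pow_succ],
        fun u => ?_, fun φ hφ hcode j hj => ?_⟩
      · simp only [Exp.eval_get, Exp.eval_reg, hvr, hir, H'.slot v i hi, Exp.eval_sub, Exp.eval_mul,
          Exp.eval_div, H'.reg_q, h2, hmod, Exp.eval_zero]
        change colOf n (h'.put .col (E.slot v i) 0 (y / q ^ i % q)) u < q
        rw [hc]
        by_cases hu : u = E.slot v i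
        · rw [hu, Function.update_self]; exact hlt
        · rw [Function.update_of_ne hu]; exact h3 u
      · simp only [Exp.eval_get, Exp.eval_reg, hvr, hir, H'.slot v i hi, Exp.eval_sub, Exp.eval_mul,
          Exp.eval_div, H'.reg_q, h2, hmod, Exp.eval_zero]
        change colOf n (h'.put .col (E.slot v i) 0 (y / q ^ i % q)) _ = _
        have hyi : y / q ^ i % q = φ (E.slot v i) := by
          rw [← hcode]
          exact digitCode_div_mod (f := fun i => φ (E.slot v i)) (fun i _ => hφ _) hi
        rw [hc, hyi]
        by_cases hu : E.slot v j = E.slot v i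
        · rw [hu, Function.update_self]
        · rw [Function.update_of_ne hu]
          refine h4 φ hφ hcode j (lt_of_le_of_ne (by omega) ?_)
          rintro rfl
          exact hu rfl
  · rintro h' ⟨h1, h2, h3, h4⟩ -
    refine ⟨h1, h3, fun φ hφ hcode u hu => ?_⟩
    obtain ⟨j, hj, rfl⟩ := hu
    exact h4 φ hφ hcode j hj

/-- Compute the code of the list of the values of the expression `e` for `i = 0, …, D - 1`. -/
def encode (e : Exp) : Cmd :=
  set .x 0 ;; set .pw 1 ;; forRange .i (.reg .D)
    (set .x (.reg .x + .reg .pw * e) ;; set .pw (.reg .pw * .reg .q))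

theorem runs_encode (H : Env M E q L h) {e : Exp} {f : ℕ → ℕ}
    (he : ∀ i < D, ∀ h', Agree [.x, .pw, .i] [] h' h → h'.reg .i = i → e.eval h' = f i)
    (hf : ∀ i < D, f i < q) (hs : (.reg .x + .reg .pw * e : Exp).safe = true) :
    M.Runs (encode e) h (D * 4 + 4) fun h' => Agree [.x, .pw, .i] [] h' h ∧
      h'.reg .x = digitCode q D f := by
  have hq := H.two_le
  have h1U : 1 ≤ M.U := by have := M.le_U; omega
  have hle : ∀ i ≤ D, q ^ i ≤ M.U := fun i hi =>
    (Nat.pow_le_pow_right (by omega) hi).trans H.Q_le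
  refine (M.runs_set_seq (by simp) (M.runs_set_seq (by simpa using h1U) (M.runs_forRange_const
    (fun i h' => Agree [.x, .pw, .i] [] h' h ∧ h'.reg .x = digitCode q i f ∧ h'.reg .pw = q ^ i)
    D 2 H.D_le ?_ ?_ ?_ ?_))).le (le_refl _)
  · exact ⟨(((Agree.refl _ _ _).set).set).set, by simp [digitCode], by simp⟩
  · rintro i h' - ⟨h1, -⟩
    simp [(H.of_agree h1).reg_D]
  · rintro i h' hi ⟨h1, h2, h3⟩ hir
    have H' := H.of_agree h1
    have hx : h'.reg .x + h'.reg .pw * e.eval h' = digitCode q (i + 1) f := by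
      rw [h2, h3, he i hi h' h1 hir, digitCode_succ]
    refine M.runs_set_seq (l := 1) ?_ (M.runs_set ?_ ?_) hs
    · simp only [Exp.eval_add, Exp.eval_mul, Exp.eval_reg, hx]
      exact (digitCode_lt fun j hj => hf j (by omega)).le.trans (hle (i + 1) hi)
    · simp [h3, H'.reg_q, ← pow_succ, hle (i + 1) hi]
    · refine ⟨by simp [hir], ((h1.set).set).set, ?_, by simp [h3, H'.reg_q, pow_succ]⟩
      simpa using hx
  · rintro h' ⟨h1, h2, -⟩ -
    exact ⟨h1, h2⟩

theorem runs_encode_slotColor (H : Env M E q L h) {w : Fin n} (hw : h.reg .w = w)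
    (hcol : ∀ u, colOf n h u < q) :
    M.Runs (encode (slotColor .w .i)) h (D * 4 + 4) fun h' => Agree [.x, .pw, .i] [] h' h ∧
      h'.reg .x = code E q w (colOf n h) := by
  refine runs_encode H (fun i hi h' hag hir => ?_) (fun i _ => hcol _) rfl
  have H' := H.of_agree hag
  simp [slotColor, hag.reg, hw, hir, H'.slot w i hi, hag.arr .col, colOf]

/-- Decide whether the support of the coloring in the bag of `v` is a maximal clique. -/
def checkMaximal : Cmd :=
  set .ok (1 - (1 - .get .col (.reg .v) 0)) ;;
  forRange .a (.reg .D) (forRange .b (.reg .D)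
    (set .ok (.reg .ok * (1 - slotColor .v .a * slotColor .v .b *
      (.get .slot (.reg .v) (.reg .b) - .get .slot (.reg .v) (.reg .a)) *
      (1 - .get .adj (.get .slot (.reg .v) (.reg .a)) (.get .slot (.reg .v) (.reg .b))))))) ;;
  forRange .e (.get .deg (.reg .v) 0) (set .u (.get .nb (.reg .v) (.reg .e)) ;; set .dom 1 ;;
    forRange .a (.reg .D) (set .dom (.reg .dom * (1 - slotColor .v .a *
      (1 - .get .adj (.reg .u) (.get .slot (.reg .v) (.reg .a)))))) ;;
    set .ok (.reg .ok * (1 - .reg .dom)))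

/-- Truth values are the numbers 0 and 1: products express conjunction, and `1 - x` negation, so
each test is a single assignment without branching. -/
theorem runs_checkMaximal (H : Env M E q L h) {v : Fin n} (hv : h.reg .v = v) :
    M.Runs checkMaximal h (D * (D * 3 + 4) + (L v).length * (D * 3 + 8) + 5) fun h' =>
      Agree [.ok, .a, .b, .e, .u, .dom] [] h' h ∧
      h'.reg .ok = ind (E.SupportIsMaximal v (colOf n h)) := by
  have h1U : 1 ≤ M.U := by have := M.le_U; omega
  have hiU : ∀ P, ind P ≤ M.U := fun P => (ind_le P).trans h1U
  set φ := colOf n h with hφ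
  -- The truncated difference of two vertices is nonzero only in one order. Checking that order
  -- suffices because adjacency is symmetric.
  set P : ℕ → ℕ → Prop := fun i j => φ (E.slot v i) ≠ 0 → φ (E.slot v j) ≠ 0 →
    E.slot v i < E.slot v j → G.Adj (E.slot v i) (E.slot v j) with hP
  set S : ℕ → Fin n → Prop := fun i w => φ (E.slot v i) ≠ 0 → G.Adj w (E.slot v i) with hS
  have hcolr : ∀ {R : List Reg} {h' : Store}, Agree R [] h' h → ∀ u : Fin n,
      h'.arr .col u 0 = φ u := fun hag u => by rw [hag.arr .col (by simp)]; rfl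
  refine (M.runs_set_seq (l := D * (D * 3 + 4) + (L v).length * (D * 3 + 8) + 4) ?_
    ((M.runs_seq (M.runs_forRange_const (fun a h' =>
      Agree [.ok, .a, .b] [] h' h ∧ h'.reg .ok = ind (φ v ≠ 0 ∧ ∀ i < a, ∀ j < D, P i j))
    D (D * 3 + 2) H.D_le ?_ ?_ ?_ fun h' hI _ => hI) fun h' hI => M.runs_forRange_const (fun e h' =>
      Agree [.ok, .a, .b, .e, .u, .dom] [] h' h ∧
      h'.reg .ok = ind ((φ v ≠ 0 ∧ ∀ i < D, ∀ j < D, P i j) ∧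
        ∀ w ∈ (L v).take e, ∀ hw : w < n, ∃ i < D, ¬ S i ⟨w, hw⟩))
      (L v).length (D * 3 + 6) (H.length_le v v.2) ?_ ?_ ?_ ?_).le ?_))
  · simp; omega
  · refine ⟨((Agree.refl _ _ _).set).set, ?_⟩
    simp only [Store.reg_set, reduceCtorEq, if_false, if_true, Exp.eval_sub, Exp.eval_one,
      Exp.eval_get, Exp.eval_reg, hv, Exp.eval_zero]
    rw [one_sub (h.arr .col v 0), one_sub_ind]
    exact ind_congr (by simp [hφ, colOf])
  · rintro a h' - ⟨h1, -⟩
    simp [(H.of_agree h1).reg_D]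
  · rintro a h' ha ⟨h1, h2⟩ har
    refine M.runs_forRange_const (fun b h'' => Agree [.ok, .a, .b] [] h'' h ∧ h''.reg .a = a ∧
      h''.reg .ok = ind ((φ v ≠ 0 ∧ ∀ i < a, ∀ j < D, P i j) ∧ ∀ j < b, P a j)) D 1 H.D_le
      ?_ ?_ ?_ ?_
    · exact ⟨h1.set, by simp [har], by simpa using h2⟩
    · rintro b h'' - ⟨h3, -⟩
      simp [(H.of_agree h3).reg_D]
    · rintro b h'' hb ⟨h3, h4, h5⟩ hbr
      have H' := H.of_agree h3
      have hvr : h''.reg .v = v := by simp [h3.reg, hv]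
      have key : (Exp.reg .ok * (1 - slotColor .v .a * slotColor .v .b *
          (.get .slot (.reg .v) (.reg .b) - .get .slot (.reg .v) (.reg .a)) *
          (1 - .get .adj (.get .slot (.reg .v) (.reg .a)) (.get .slot (.reg .v) (.reg .b))) : Exp)).eval
          h'' = ind ((φ v ≠ 0 ∧ ∀ i < a, ∀ j < D, P i j) ∧ ∀ j < b + 1, P a j) := by
        simp only [Exp.eval_mul, Exp.eval_sub, Exp.eval_one, Exp.eval_reg, Exp.eval_get, slotColor,
          Exp.eval_zero, hvr, h4, hbr, h5, H'.slot v a ha, H'.slot v b hb, hcolr h3, H'.adj,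
          one_sub_ind]
        rw [one_sub, ind_mul_ind]
        refine ind_congr ?_
        rw [and_assoc]
        refine and_congr_right fun _ => ?_
        rw [Nat.forall_lt_succ_right]
        refine and_congr_right fun _ => ?_
        simp only [hP, Nat.mul_eq_zero, Nat.sub_eq_zero_iff_le, Fin.lt_def]
        rw [← not_iff_not]
        push Not
        rw [ind_ne_zero, and_assoc, and_assoc]
      refine M.runs_set (by rw [key]; exact hiU _) ⟨by simp [hbr], (h3.set).set, by simp [h4], ?_⟩
      rw [key]
      simp
    · rintro h'' ⟨h3, h4, h5⟩ -
      refine ⟨h4, h3.set, ?_⟩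
      simp only [Store.reg_set, reduceCtorEq, if_false, h5]
      refine ind_congr ?_
      rw [and_assoc, Nat.forall_lt_succ_right]
  · refine ⟨(hI.1.trans (Agree.refl _ _ _)).set, ?_⟩
    simp only [Store.reg_set, reduceCtorEq, if_false, hI.2]
    exact ind_congr (by simp)
  · rintro e h' - ⟨h1, -⟩
    have hvr : h'.reg .v = v := by simp [h1.reg, hv]
    simp [hvr, ((H.of_agree h1).holds v v.2).1]
  · rintro e h' he ⟨h1, h2⟩ her
    have H' := H.of_agree h1
    have hvr : h'.reg .v = v := by simp [h1.reg, hv]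
    have hnb := (H'.holds v v.2).2 e he
    obtain ⟨hun, huadj⟩ := (H.mem_iff v _).1 (List.getElem_mem he)
    set u : Fin n := ⟨(L v)[e], hun⟩ with hu
    have hnb' : h'.arr .nb v e = u := hnb
    have huU : (u : ℕ) ≤ M.U := u.2.le.trans H.n_le
    refine (M.runs_set_seq (l := D * 3 + 4) (by simpa [hvr, her, hnb'] using huU)
      (M.runs_set_seq (l := D * 3 + 3) (by simpa using h1U) (M.runs_seq (l := 1)
      (M.runs_forRange_const (fun a h'' => Agree [.ok, .a, .b, .e, .u, .dom] [] h'' h ∧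
        h''.reg .e = e ∧ h''.reg .u = u ∧ h''.reg .ok = h'.reg .ok ∧
        h''.reg .dom = ind (∀ i < a, S i u)) D 1 H.D_le ?_ ?_ ?_ fun h'' hI _ => hI) ?_))).le
        (by omega)
    · refine ⟨((h1.set).set).set, by simp [her], by simp [hvr, her, hnb'], by simp, ?_⟩
      simp only [Store.reg_set, reduceCtorEq, if_false, if_true, Exp.eval_one]
      rw [ind_true (by simp)]
    · rintro a h'' - ⟨h3, -⟩
      simp [(H.of_agree h3).reg_D]
    · rintro a h'' ha ⟨h3, h4, h5, h6, h7⟩ har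
      have H'' := H.of_agree h3
      have hvr' : h''.reg .v = v := by simp [h3.reg, hv]
      have key : (Exp.reg .dom * (1 - slotColor .v .a *
          (1 - .get .adj (.reg .u) (.get .slot (.reg .v) (.reg .a)))) : Exp).eval h'' =
          ind (∀ i < a + 1, S i u) := by
        simp only [Exp.eval_mul, Exp.eval_sub, Exp.eval_one, Exp.eval_reg, Exp.eval_get, slotColor,
          Exp.eval_zero, hvr', har, h5, h7, H''.slot v a ha, hcolr h3, H''.adj, one_sub_ind]
        rw [one_sub, ind_mul_ind]
        refine ind_congr ?_
        rw [Nat.forall_lt_succ_right]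
        refine and_congr_right fun _ => ?_
        simp only [hS]
        rw [← not_iff_not]
        push Not
        rw [Nat.mul_ne_zero_iff, ind_ne_zero]
      refine M.runs_set (by rw [key]; exact hiU _) ⟨by simp [har], (h3.set).set, by simp [h4],
        by simp [h5], by simp [h6], ?_⟩
      rw [key]
      simp
    · rintro h'' ⟨h3, h4, h5, h6, h7⟩
      have key : (Exp.reg .ok * (1 - .reg .dom) : Exp).eval h'' =
          ind ((φ v ≠ 0 ∧ ∀ i < D, ∀ j < D, P i j) ∧
            ∀ w ∈ (L v).take (e + 1), ∀ hw : w < n, ∃ i < D, ¬ S i ⟨w, hw⟩) := by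
        simp only [Exp.eval_mul, Exp.eval_sub, Exp.eval_one, Exp.eval_reg, h6, h7, h2, one_sub_ind,
          ind_mul_ind]
        refine ind_congr ?_
        rw [and_assoc]
        refine and_congr_right fun _ => ?_
        rw [List.take_add_one, List.getElem?_eq_getElem he]
        simp only [Option.toList_some, List.mem_append, List.mem_singleton, or_imp, forall_and,
          forall_eq]
        refine and_congr_right fun _ => ?_
        push Not
        exact ⟨fun h _ => h, fun h => h hun⟩
      refine M.runs_set (by rw [key]; exact hiU _) ⟨by simp [h4], (h3.set).set, ?_⟩
      rw [key]
      simp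
  · rintro h' ⟨h1, h2⟩ -
    refine ⟨h1, ?_⟩
    rw [h2]
    refine ind_congr ?_
    unfold Elimination.SupportIsMaximal
    refine and_congr (and_congr_right fun _ => ?_) ?_
    · constructor
      · intro h i hi j hj h1 h2 hne
        rcases lt_or_gt_of_ne hne with hlt | hgt
        · exact h i hi j hj h1 h2 hlt
        · exact (h j hj i hi h2 h1 hgt).symm
      · intro h i hi j hj h1 h2 hlt
        exact h i hi j hj h1 h2 hlt.ne
    · simp only [List.take_length, hS]
      constructor
      · intro h w hw
        obtain ⟨i, hi, h'⟩ := h w ((H.mem_iff v w).2 ⟨w.2, hw⟩) w.2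
        push Not at h'
        exact ⟨i, hi, h'⟩
      · intro h w hw hwn
        obtain ⟨_, hw'⟩ := (H.mem_iff v w).1 hw
        obtain ⟨i, hi, h'⟩ := h _ hw'
        refine ⟨i, hi, ?_⟩
        push Not
        exact h'
  · refine le_of_eq ?_
    ring

end

end RAM

/-! ### The tables of the dynamic program -/

namespace RAM

variable {M : Machine} {n D : ℕ} {G : SimpleGraph (Fin n)} {E : Elimination G n D} {q : ℕ}
  {L : ℕ → List ℕ} {h : Store}

/-- Compute one entry of the table of colorings whose support contains a maximal clique. -/
def coverEntry : Cmd :=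
  decode ;; checkMaximal ;;
  forRange .a (.reg .D) (set .u (.get .slot (.reg .v) (.reg .a)) ;;
    set .old (.get .col (.reg .u) 0) ;; put .col (.reg .u) 0 0 ;;
    encode (slotColor .w .i) ;;
    set .ok (1 - (1 - .reg .ok) * (1 - .reg .old * .get .hh (.reg .v) (.reg .x))) ;;
    put .col (.reg .u) 0 (.reg .old)) ;;
  put .hh (.reg .v) (.reg .y) (.reg .ok)

/-- One step of the recursion `Elimination.covers_iff`: each color in the bag is temporarily set to
0, the entry of the resulting code is looked up, and the color is restored. -/
theorem runs_coverEntry (H : Env M E q L h) {v : Fin n} {y : ℕ} (hv : h.reg .v = v)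
    (hw : h.reg .w = v) (hy : h.reg .y = y) (hyU : y ≤ M.U) (hcol : ∀ u, colOf n h u < q)
    (hh : ∀ φ : Fin n → ℕ, (∀ u, φ u < q) → code E q v φ < y →
      h.arr .hh v (code E q v φ) = ind (E.Covers v φ)) :
    M.Runs coverEntry h (D * (D * 7 + 19) + (L v).length * (D * 3 + 8) + 11) fun h' =>
      Agree [.z, .i, .ok, .a, .b, .e, .u, .dom, .old, .x, .pw] [.col, .hh] h' h ∧
      (∀ u, colOf n h' u < q) ∧
      (∀ u b : ℕ, (u ≠ v ∨ b ≠ y) → h'.arr .hh u b = h.arr .hh u b) ∧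
      ∀ φ : Fin n → ℕ, (∀ u, φ u < q) → code E q v φ = y → h'.arr .hh v y = ind (E.Covers v φ) := by
  have hq := H.two_le
  have h1U : 1 ≤ M.U := by have := M.le_U; omega
  have hiU : ∀ P, ind P ≤ M.U := fun P => (ind_le P).trans h1U
  refine (M.runs_seq (runs_decode H hv hy hyU hcol) fun h₁ hp₁ =>
    M.runs_seq (runs_checkMaximal (H.of_agree hp₁.1) (v := v) ?_) fun h₂ hp₂ =>
    M.runs_seq (l := 1) (M.runs_forRange_const (fun a h' =>
      Agree [.z, .i, .ok, .a, .b, .e, .u, .dom, .old, .x, .pw] [.col] h' h ∧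
      colOf n h' = colOf n h₁ ∧
      h'.reg .ok = ind (E.SupportIsMaximal v (colOf n h₁) ∨ ∃ i < a,
        colOf n h₁ (E.slot v i) * h.arr .hh v
          (code E q v (Function.update (colOf n h₁) (E.slot v i) 0)) ≠ 0))
      D (D * 4 + 9) H.D_le ?_ ?_ ?_ fun h' hI _ => hI) ?_).le ?_
  · rw [hp₁.1.reg .v (by simp), hv]
  · obtain ⟨h1, h2, h3⟩ := hp₁
    obtain ⟨h4, h5⟩ := hp₂
    refine ⟨((h4.trans (h1.trans (Agree.refl _ _ _)))).set, ?_, ?_⟩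
    · funext u
      simp [colOf, h4.arr .col]
    · simp [h5]
  · rintro a h' - ⟨h1, -⟩
    simp [(H.of_agree h1).reg_D]
  · obtain ⟨-, hcol₁, -⟩ := hp₁
    rintro a h' ha ⟨h1, h2, h3⟩ har
    have H' := H.of_agree h1
    have hvr : h'.reg .v = v := by simp [h1.reg, hv]
    have hwr : h'.reg .w = v := by simp [h1.reg, hw]
    set φ := colOf n h₁ with hφ
    set u := E.slot v a with hu
    have hslot : h'.arr .slot v a = u := H'.slot v a ha
    have huU : (u : ℕ) ≤ M.U := u.2.le.trans H.n_le
    have hcu : h'.arr .col u 0 = φ u := congrFun h2 u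
    have hφU : ∀ u, φ u ≤ M.U := fun u => (hcol₁ u).le.trans H.q_le
    refine (M.runs_set_seq (l := D * 4 + 8) (by simpa [hvr, har, hslot] using huU)
      (M.runs_set_seq (by simpa [hvr, har, hslot, hcu] using hφU u) (M.runs_put_seq (by simp)
      (M.runs_seq (l := 2) (runs_encode_slotColor (w := v)
        (H.of_agree (((h1.set (r := .u)).set (r := .old)).put (A := .col))) ?_ ?_) ?_))))
    · simp [hwr]
    · intro w
      simp only [Exp.eval_get, Exp.eval_reg, hvr, har, hslot, Exp.eval_zero, Store.reg_set,
        reduceCtorEq, if_true, if_false]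
      rw [colOf_put]
      change Function.update (colOf n h') u 0 w < q
      rw [h2]
      by_cases hwu : w = u
      · rw [hwu, Function.update_self]; omega
      · rw [Function.update_of_ne hwu]; exact hcol₁ w
    · simp only [Exp.eval_get, Exp.eval_reg, hvr, har, hslot, Exp.eval_zero, Store.reg_set,
        Store.arr_set, reduceCtorEq, if_true, if_false, hcu]
      rw [colOf_put]
      change ∀ h'', Agree _ _ h'' _ ∧ _ = code E q v (Function.update (colOf n h') u 0) → _
      rw [h2]
      rintro h'' ⟨h6, h7⟩
      have hvr' : h''.reg .v = v := by simp [h6.reg, hvr]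
      have hur' : h''.reg .u = u := by simp [h6.reg]
      have holdr' : h''.reg .old = φ u := by simp [h6.reg]
      have hokr' : h''.reg .ok = h'.reg .ok := by simp [h6.reg]
      have har' : h''.reg .a = a := by simp [h6.reg, har]
      have hhr' : h''.arr .hh = h.arr .hh := by
        rw [h6.arr .hh (by simp), Store.arr_put_of_ne _ _ _ _ (by decide), Store.arr_set,
          Store.arr_set, h1.arr .hh (by simp)]
      have key : (1 - (1 - .reg .ok) * (1 - .reg .old * .get .hh (.reg .v) (.reg .x)) : Exp).eval h''
          = ind (E.SupportIsMaximal v φ ∨ ∃ i < a + 1,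
        φ (E.slot v i) * h.arr .hh v (code E q v (Function.update φ (E.slot v i) 0)) ≠ 0) := by
        simp only [Exp.eval_mul, Exp.eval_sub, Exp.eval_one, Exp.eval_reg, Exp.eval_get, hokr',
          holdr', hhr', hvr', h7, h3, one_sub_ind]
        rw [one_sub (φ u * _), ind_mul_ind, one_sub_ind]
        refine ind_congr ?_
        rw [not_and_or, not_not, or_assoc]
        refine or_congr Iff.rfl ?_
        rw [Nat.exists_lt_succ_right]
      refine M.runs_set_seq (l := 1) (by rw [key]; exact hiU _) (M.runs_put ?_ ?_)
      · simpa [holdr'] using hφU u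
      · have h8 : Agree [.z, .i, .ok, .a, .b, .e, .u, .dom, .old, .x, .pw] [.col] h'' h :=
          h6.trans (((h1.set).set).put)
        refine ⟨by simp [har'], ((h8.set).put).set, ?_, ?_⟩
        · simp only [Exp.eval_reg, Store.reg_set, reduceCtorEq, if_false, hur', Exp.eval_zero,
            holdr']
          change colOf n ((h''.set .ok _).put .col u 0 (φ u)) = φ
          rw [colOf_put]
          funext w
          by_cases hwu : w = u
          · rw [hwu, Function.update_self]
          · rw [Function.update_of_ne hwu]
            have hwu' : (w : ℕ) ≠ u := fun h => hwu (Fin.ext h)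
            change h''.arr .col w 0 = φ w
            rw [h6.arr .col (by simp)]
            simp only [Store.arr_put, hwu', false_and, and_false, if_false]
            exact congrFun h2 w
        · simp only [Store.reg_set, Store.reg_put, if_true]
          exact key
  · obtain ⟨h1, hcol₁, h2⟩ := hp₁
    rintro h' ⟨h3, h4, h5⟩
    have hvr : h'.reg .v = v := by simp [h3.reg, hv]
    have hyr : h'.reg .y = y := by simp [h3.reg, hy]
    have h6 : Agree [.z, .i, .ok, .a, .b, .e, .u, .dom, .old, .x, .pw] [.col, .hh] h' h :=
      h3.trans (Agree.refl _ _ _)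
    refine M.runs_put (by simp only [Exp.eval_reg, h5]; exact hiU _) ⟨h6.put, fun u => ?_,
      fun u b hub => ?_, fun φ hφ hcode => ?_⟩
    · have : colOf n h' u < q := by rw [h4]; exact hcol₁ u
      simpa [colOf] using this
    · simp only [Store.arr_put, Exp.eval_reg, hvr, hyr, true_and]
      rw [if_neg (by tauto), h3.arr .hh (by simp)]
    · simp only [Store.arr_put, Exp.eval_reg, hvr, hyr, true_and, if_true, h5]
      have hag := h2 φ hφ hcode
      rw [E.covers_congr (ψ := colOf n h₁) fun u hu => (hag u hu).symm, E.covers_iff v]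
      refine ind_congr (or_congr Iff.rfl (exists_congr fun i => and_congr_right fun hi => ?_))
      rw [Nat.mul_ne_zero_iff]
      -- If the deleted color was 0 already, the lookup hits the entry under construction, but the
      -- factor 0 cancels it. Otherwise the code has dropped below `y`, where the table is correct.
      refine and_congr_right fun hne => ?_
      have hbd : ∀ w, Function.update (colOf n h₁) (E.slot v i) 0 w < q := fun w => by
        by_cases hwu : w = E.slot v i
        · rw [hwu, Function.update_self]; omega
        · rw [Function.update_of_ne hwu]; exact hcol₁ w
      have hlt := code_update_lt (E := E) (q := q) (by omega) hi hne
      rw [code_congr hag, hcode] at hlt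
      rw [hh _ hbd hlt, ind_ne_zero]
  · refine le_of_eq ?_
    ring

/-- Compute one entry of the table of colorings with a monochromatic maximal clique. -/
def badEntry : Cmd :=
  decode ;; set .c (.get .col (.reg .v) 0) ;;
  encode (1 - ((slotColor .w .i - .reg .c) + (.reg .c - slotColor .w .i))) ;;
  put .bad (.reg .v) (.reg .y) (.get .hh (.reg .v) (.reg .x))

theorem runs_badEntry (H : Env M E q L h) {v : Fin n} {y : ℕ} (hv : h.reg .v = v)
    (hw : h.reg .w = v) (hy : h.reg .y = y) (hyU : y ≤ M.U) (hcol : ∀ u, colOf n h u < q)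
    (hh : ∀ φ : Fin n → ℕ, (∀ u, φ u < q) → h.arr .hh v (code E q v φ) = ind (E.Covers v φ)) :
    M.Runs badEntry h (D * 8 + 9) fun h' =>
      Agree [.z, .i, .c, .x, .pw] [.col, .bad] h' h ∧
      (∀ u, colOf n h' u < q) ∧
      (∀ u b : ℕ, (u ≠ v ∨ b ≠ y) → h'.arr .bad u b = h.arr .bad u b) ∧
      ∀ φ : Fin n → ℕ, (∀ u, φ u < q) → code E q v φ = y →
        h'.arr .bad v y = ind (¬ E.Good v φ) := by
  have hq := H.two_le
  refine (M.runs_seq (l := D * 4 + 6) (runs_decode H hv hy hyU hcol) ?_).le (by omega)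
  rintro h₁ ⟨h1, hcol₁, h2⟩
  set φ := colOf n h₁ with hφ
  have hvr₁ : h₁.reg .v = v := by simp [h1.reg, hv]
  have hwr₁ : h₁.reg .w = v := by simp [h1.reg, hw]
  have hcv : h₁.arr .col v 0 = φ v := rfl
  set ψ : Fin n → ℕ := fun u => 1 - ((φ u - φ v) + (φ v - φ u)) with hψ
  -- Indicator functions are legitimate colorings because `q` is at least 2, so their codes index
  -- the same table.
  have hψq : ∀ u, ψ u < q := fun u => by simp only [hψ]; omega
  have hag₂ : Agree [.z, .i, .c] [.col] (h₁.set .c (φ v)) h :=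
    (h1.trans (Agree.refl _ _ _)).set
  refine M.runs_set_seq (by simpa [hvr₁, hcv] using (hcol₁ v).le.trans H.q_le) ?_
  simp only [Exp.eval_get, Exp.eval_reg, hvr₁, Exp.eval_zero, hcv]
  refine M.runs_seq (l := 1) (runs_encode (H.of_agree hag₂)
    (f := fun i => ψ (E.slot v i)) ?_ (fun i _ => hψq _) rfl) ?_
  · intro i hi h' hag hir
    have H' := (H.of_agree hag₂).of_agree hag
    have hwr : h'.reg .w = v := by simp [hag.reg, hwr₁]
    have hcr : h'.reg .c = φ v := by simp [hag.reg]
    have hcs : h'.arr .col (E.slot v i) 0 = φ (E.slot v i) := by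
      rw [hag.arr .col (by simp)]; rfl
    simp [slotColor, hwr, hir, H'.slot v i hi, hcs, hcr, hψ]
  · rintro h' ⟨h3, h4⟩
    have h5 : Agree [.z, .i, .c, .x, .pw] [.col, .bad] h' h := h3.trans (hag₂.trans (Agree.refl _ _ _))
    have hvr : h'.reg .v = v := by simp [h5.reg, hv]
    have hyr : h'.reg .y = y := by simp [h5.reg, hy]
    have hhr : h'.arr .hh v (h'.reg .x) = ind (E.Covers v ψ) := by
      rw [h4, h5.arr .hh (by simp)]
      exact hh ψ hψq
    have h1U : 1 ≤ M.U := by have := M.le_U; omega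
    refine M.runs_put ?_ ⟨h5.put, fun u => ?_, fun u b hub => ?_, fun χ hχ hcode => ?_⟩
    · simp only [Exp.eval_get, Exp.eval_reg, hvr, hhr]
      exact (ind_le _).trans h1U
    · have : colOf n h' u = φ u := by
        simp only [colOf]
        rw [h3.arr .col (by simp)]; rfl
      have h6 : colOf n h' u < q := this ▸ hcol₁ u
      simpa [colOf] using h6
    · simp only [Store.arr_put, Exp.eval_reg, hvr, hyr, true_and]
      rw [if_neg (by tauto), h3.arr .bad (by simp), hag₂.arr .bad (by simp)]
    · simp only [Store.arr_put, Exp.eval_reg, Exp.eval_get, hvr, hyr, true_and, if_true, hhr]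
      refine ind_congr ?_
      rw [← E.good_congr (h2 χ hχ hcode), E.good_iff_not_covers, not_not]

/-- Compute the tables for all vertices. -/
def buildTables : Cmd :=
  forRange .v (.reg .n) (set .w (.reg .v) ;; forRange .y (.reg .Q) coverEntry ;;
    forRange .y (.reg .Q) badEntry)

theorem runs_buildTables (H : Env M E q L h) (hcol : ∀ u, colOf n h u < q) :
    M.Runs buildTables h (∑ v ∈ Finset.range n, (q ^ D * (D * (D * 7 + 27) +
        (L v).length * (D * 3 + 8) + 24) + 7) + 2) fun h' =>
      Agree [.z, .i, .ok, .a, .b, .e, .u, .dom, .old, .x, .pw, .c, .y, .w, .v] [.col, .hh, .bad]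
        h' h ∧
      (∀ u, colOf n h' u < q) ∧
      ∀ v : Fin n, ∀ φ : Fin n → ℕ, (∀ u, φ u < q) →
        h'.arr .bad v (code E q v φ) = ind (¬ E.Good v φ) := by
  refine (M.runs_forRange (fun k h' =>
    Agree [.z, .i, .ok, .a, .b, .e, .u, .dom, .old, .x, .pw, .c, .y, .w, .v] [.col, .hh, .bad]
      h' h ∧ (∀ u, colOf n h' u < q) ∧
    ∀ v : Fin n, (v : ℕ) < k → ∀ φ : Fin n → ℕ, (∀ u, φ u < q) →
      h'.arr .bad v (code E q v φ) = ind (¬ E.Good v φ)) n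
    (fun v => q ^ D * (D * (D * 7 + 27) + (L v).length * (D * 3 + 8) + 24) + 5) H.n_le
    ?_ ?_ ?_ ?_).le (le_refl _)
  · exact ⟨(Agree.refl _ _ _).set, hcol, fun v hv => absurd hv (Nat.not_lt_zero _)⟩
  · rintro k h' - ⟨h1, -⟩
    simp [(H.of_agree h1).reg_n]
  · rintro k h' hk ⟨h1, h2, h3⟩ hkr
    set v : Fin n := ⟨k, hk⟩ with hv
    have hvk : (v : ℕ) = k := rfl
    refine (M.runs_set_seq (by simpa [hkr] using hk.le.trans H.n_le) (M.runs_seq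
      (M.runs_forRange_const (fun y h'' =>
        Agree [.z, .i, .ok, .a, .b, .e, .u, .dom, .old, .x, .pw, .y] [.col, .hh] h''
          (h'.set .w k) ∧
        (∀ u, colOf n h'' u < q) ∧
        ∀ φ : Fin n → ℕ, (∀ u, φ u < q) → code E q v φ < y →
          h''.arr .hh v (code E q v φ) = ind (E.Covers v φ)) (q ^ D)
        (D * (D * 7 + 19) + (L v).length * (D * 3 + 8) + 11) H.Q_le ?_ ?_ ?_ fun h'' hI _ => hI)
      fun h₁ hp => M.runs_forRange_const (fun y h'' =>
        Agree [.z, .i, .c, .x, .pw, .y] [.col, .bad] h'' h₁ ∧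
        (∀ u, colOf n h'' u < q) ∧ (∀ u ≠ k, h''.arr .bad u = h₁.arr .bad u) ∧
        ∀ φ : Fin n → ℕ, (∀ u, φ u < q) → code E q v φ < y →
          h''.arr .bad v (code E q v φ) = ind (¬ E.Good v φ)) (q ^ D)
        (D * 8 + 9) H.Q_le ?_ ?_ ?_ ?_)).le ?_
    · simp only [Exp.eval_reg, hkr]
      exact ⟨(Agree.refl _ _ _).set, h2, fun φ hφ hlt => absurd hlt (Nat.not_lt_zero _)⟩
    · rintro y h'' - ⟨h4, -⟩
      simp [((H.of_agree (h1.set (r := .w) (v := k))).of_agree h4).reg_Q]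
    · rintro y h'' hy ⟨h4, h5, h6⟩ hyr
      have H' := ((H.of_agree (h1.set (r := .w) (v := k))).of_agree h4)
      refine (runs_coverEntry H' (v := v) (y := y) ?_ ?_ hyr (hy.le.trans H.Q_le) h5 h6).mono
        (fun h₂ hp => ?_) le_rfl
      · simp [h4.reg, hkr, hvk]
      · simp [h4.reg, hvk]
      · obtain ⟨h7, h8, h9, h10⟩ := hp
        refine ⟨by simp [h7.reg, hyr], (h7.trans h4).set, h8, fun φ hφ hlt => ?_⟩
        rcases Nat.lt_succ_iff_lt_or_eq.1 hlt with hlt | heq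
        · simp only [Store.arr_set]
          rw [h9 _ _ (Or.inr hlt.ne), h6 φ hφ hlt]
        · simp only [Store.arr_set]
          rw [heq, h10 φ hφ heq]
    · obtain ⟨h4, h5, h6⟩ := hp
      exact ⟨(Agree.refl _ _ _).set, h5, fun _ _ => rfl, fun φ hφ hlt => absurd hlt (Nat.not_lt_zero _)⟩
    · obtain ⟨h4, h5, h6⟩ := hp
      rintro y h'' - ⟨h7, -⟩
      simp [(((H.of_agree (h1.set (r := .w) (v := k))).of_agree h4).of_agree h7).reg_Q]
    · obtain ⟨h4, h5, h6⟩ := hp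
      rintro y h'' hy ⟨h7, h8, h9, h10⟩ hyr
      have H' := (((H.of_agree (h1.set (r := .w) (v := k))).of_agree h4).of_agree h7)
      refine (runs_badEntry H' (v := v) (y := y) ?_ ?_ hyr (hy.le.trans H.Q_le) h8
        fun φ hφ => ?_).mono (fun h₂ hp => ?_) le_rfl
      · simp [h7.reg, h4.reg, hkr, hvk]
      · simp [h7.reg, h4.reg, hvk]
      · rw [h7.arr .hh (by simp)]
        exact h6 φ hφ (code_lt hφ)
      · obtain ⟨h11, h12, h13, h14⟩ := hp
        refine ⟨by simp [h11.reg, hyr], (h11.trans h7).set, h12, fun u hu => ?_,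
          fun φ hφ hlt => ?_⟩
        · funext b
          simp only [Store.arr_set]
          rw [h13 u b (Or.inl hu), h9 u hu]
        · simp only [Store.arr_set]
          rcases Nat.lt_succ_iff_lt_or_eq.1 hlt with hlt | heq
          · rw [h13 _ _ (Or.inr hlt.ne), h10 φ hφ hlt]
          · rw [heq, h14 φ hφ heq]
    · obtain ⟨h4, h5, h6⟩ := hp
      rintro h'' ⟨h7, h8, h9, h10⟩ -
      refine ⟨by simp [h7.reg, h4.reg, hkr], (h7.trans (h4.trans (h1.set))).set, h8,
        fun w hw φ hφ => ?_⟩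
      rcases Nat.lt_succ_iff_lt_or_eq.1 hw with hlt | heq
      · simp only [Store.arr_set]
        rw [h9 w hlt.ne, h4.arr .bad (by simp), Store.arr_set, h3 w hlt φ hφ]
      · obtain rfl : w = v := Fin.ext heq
        exact h10 φ hφ (code_lt hφ)
    · refine le_of_eq ?_
      simp only [hv]
      ring
  · rintro h' ⟨h1, h2, h3⟩ -
    exact ⟨h1, h2, fun v => h3 v v.2⟩

end RAM

namespace RAM

variable {M : Machine} {n D : ℕ} {G : SimpleGraph (Fin n)} {E : Elimination G n D} {q : ℕ}
  {L : ℕ → List ℕ} {h : Store}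

/-! ### Elimination of the vertices -/

/-- The table of bad colorings records the conditions after the elimination of `k` vertices. -/
def BadTable (E : Elimination G n D) (q k : ℕ) (h : Store) : Prop :=
  ∀ v : Fin n, ∀ φ : Fin n → ℕ, (∀ u, φ u < q) →
    h.arr .bad v (code E q v φ) = ind (¬ E.Feasible q k v φ)

theorem exists_rk_eq (E : Elimination G n D) {r : ℕ} (hr : r < n) : ∃ v, E.rk v = r := by
  have hinj : Function.Injective fun v : Fin n => (⟨E.rk v, E.rk_lt v⟩ : Fin n) := fun u v huv =>
    E.rk_inj (congrArg Fin.val huv)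
  obtain ⟨v, hv⟩ := Finite.injective_iff_surjective.1 hinj ⟨r, hr⟩
  exact ⟨v, congrArg Fin.val hv⟩

theorem update_lt {φ : Fin n → ℕ} {w : Fin n} {c : ℕ} (hφ : ∀ u, φ u < q) (hc : c < q) (u : Fin n) :
    Function.update φ w c u < q := by
  by_cases hu : u = w
  · rwa [hu, Function.update_self]
  · rw [Function.update_of_ne hu]; exact hφ u

/-- Restrict the colorings of the bag of `v` with code `y` to those that extend to `w`. -/
def restrictEntry : Cmd :=
  decode ;; set .found 0 ;;
  forRange .c (.reg .q) (put .col (.reg .w) 0 (.reg .c) ;; encode (slotColor .w .i) ;;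
    set .found (1 - (1 - .reg .found) * .get .bad (.reg .w) (.reg .x))) ;;
  put .bad (.reg .v) (.reg .y) (1 - (1 - .get .bad (.reg .v) (.reg .y)) * .reg .found)

/-- After decoding, the colors in the bag of `v` together with the trial color of `w` determine the
coloring of the bag of `w`. Writing in place is safe: lookups for `w` use its own row, which differs
from that of `v`. -/
theorem runs_restrictEntry (H : Env M E q L h) {v w : Fin n} {y k : ℕ} (hv : h.reg .v = v)
    (hw : h.reg .w = w) (hy : h.reg .y = y) (hyU : y ≤ M.U) (hcol : ∀ u, colOf n h u < q)
    (hrk : 0 < E.rk w) (hpar : E.par w = v)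
    (hbadw : ∀ φ : Fin n → ℕ, (∀ u, φ u < q) →
      h.arr .bad w (code E q w φ) = ind (¬ E.Feasible q k w φ)) :
    M.Runs restrictEntry h (D * 4 + q * (D * 4 + 8) + 7) fun h' =>
      Agree [.z, .i, .found, .c, .x, .pw] [.col, .bad] h' h ∧
      (∀ u, colOf n h' u < q) ∧
      (∀ u b : ℕ, (u ≠ v ∨ b ≠ y) → h'.arr .bad u b = h.arr .bad u b) ∧
      ∀ φ : Fin n → ℕ, (∀ u, φ u < q) → code E q v φ = y →
        h.arr .bad v y = ind (¬ E.Feasible q k v φ) →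
        h'.arr .bad v y = ind (¬ (E.Feasible q k v φ ∧
          ∃ c < q, E.Feasible q k w (Function.update φ w c))) := by
  have h1U : 1 ≤ M.U := by have := M.le_U; omega
  have hiU : ∀ P, ind P ≤ M.U := fun P => (ind_le P).trans h1U
  have hvw : v ≠ w := hpar ▸ E.par_ne hrk
  refine (M.runs_seq (l := q * (D * 4 + 8) + 4) (runs_decode H hv hy hyU hcol) ?_).le (by omega)
  rintro h₁ ⟨h1, hcol₁, h2⟩
  set φ := colOf n h₁ with hφ
  have hbad₁ : h₁.arr .bad = h.arr .bad := h1.arr .bad (by simp)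
  refine M.runs_set_seq (by simp) (M.runs_seq (l := 1) (M.runs_forRange_const (fun c h' =>
    Agree [.z, .i, .found, .c, .x, .pw] [.col] h' h ∧ (∀ u, colOf n h' u < q) ∧
    (∀ c, Function.update (colOf n h') w c = Function.update φ w c) ∧
    h'.reg .found = ind (∃ c' < c, E.Feasible q k w (Function.update φ w c')))
    q (D * 4 + 6) H.q_le ?_ ?_ ?_ fun h' hI _ => hI) ?_)
  · refine ⟨((h1.trans (Agree.refl _ _ _)).set).set, hcol₁, fun _ => rfl, ?_⟩
    rw [ind_false (by simp)]
    simp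
  · rintro c h' - ⟨h3, -⟩
    simp [(H.of_agree h3).reg_q]
  · rintro c h' hc ⟨h3, h4, h5, h6⟩ hcr
    have hwr : h'.reg .w = w := by simp [h3.reg, hw]
    have hcU : c ≤ M.U := hc.le.trans H.q_le
    have hcolp : colOf n (h'.put .col w 0 c) = Function.update φ w c := by
      rw [colOf_put, h5]
    have hlt := update_lt hcol₁ hc (w := w)
    refine M.runs_put_seq (by simpa [hcr] using hcU) ?_
    simp only [Exp.eval_reg, hwr, hcr, Exp.eval_zero]
    have h3' : Agree [.z, .i, .found, .c, .x, .pw] [.col] (h'.put .col w 0 c) h := h3.put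
    refine M.runs_seq (l := 1) (runs_encode_slotColor (w := w) (H.of_agree h3')
      (by simpa using hwr) (by rw [hcolp]; exact hlt)) ?_
    rw [hcolp]
    rintro h'' ⟨h7, h8⟩
    have hwr' : h''.reg .w = w := by simp [h7.reg, hwr]
    have hbad : h''.arr .bad w (h''.reg .x) =
        ind (¬ E.Feasible q k w (Function.update φ w c)) := by
      rw [h8, h7.arr .bad (by simp), h3'.arr .bad (by simp)]
      exact hbadw _ hlt
    have hcol'' : colOf n h'' = Function.update φ w c := by
      rw [← hcolp]
      funext u
      simp only [colOf]
      rw [h7.arr .col (by simp)]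
    have key : (1 - (1 - .reg .found) * .get .bad (.reg .w) (.reg .x) : Exp).eval h'' =
        ind (∃ c' < c + 1, E.Feasible q k w (Function.update φ w c')) := by
      have hf : h''.reg .found = h'.reg .found := by simp [h7.reg]
      simp only [Exp.eval_sub, Exp.eval_mul, Exp.eval_one, Exp.eval_reg, Exp.eval_get, hf, h6, hwr',
        hbad, one_sub_ind, ind_mul_ind]
      refine ind_congr ?_
      rw [Nat.exists_lt_succ_right, not_and_or, not_not, not_not]
    refine M.runs_set (by rw [key]; exact hiU _) ⟨by simp [h7.reg, hcr],
      (((h7.trans h3').set).set), ?_, ?_, ?_⟩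
    · intro u
      change colOf n h'' u < q
      rw [hcol'']
      exact hlt u
    · intro c'
      change Function.update (colOf n h'') w c' = _
      rw [hcol'', Function.update_idem]
    · simp only [Store.reg_set, reduceCtorEq, if_false, if_true]
      exact key
  · rintro h' ⟨h3, h4, h5, h6⟩
    have hvr : h'.reg .v = v := by simp [h3.reg, hv]
    have hyr : h'.reg .y = y := by simp [h3.reg, hy]
    have hbr : h'.arr .bad = h.arr .bad := h3.arr .bad (by simp)
    have h3' : Agree [.z, .i, .found, .c, .x, .pw] [.col, .bad] h' h :=
      h3.trans (Agree.refl _ _ _)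
    refine M.runs_put ?_ ⟨h3'.put, fun u => ?_, fun u b hub => ?_, fun χ hχ hcode hbadv => ?_⟩
    · simp only [Exp.eval_sub, Exp.eval_one]
      omega
    · simpa [colOf] using h4 u
    · simp only [Store.arr_put, Exp.eval_reg, hvr, hyr, true_and]
      rw [if_neg (by tauto), hbr]
    · simp only [Store.arr_put, Exp.eval_reg, hvr, hyr, true_and, if_true, Exp.eval_sub,
        Exp.eval_mul, Exp.eval_one, Exp.eval_get, hbr, hbadv, h6, one_sub_ind, ind_mul_ind]
      refine ind_congr (not_congr (and_congr not_not (exists_congr fun c =>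
        and_congr_right fun _ => E.feasible_congr q fun u hu => ?_)))
      by_cases huw : u = w
      · rw [huw, Function.update_self, Function.update_self]
      · rw [Function.update_of_ne huw, Function.update_of_ne huw]
        exact h2 χ hχ hcode u (hpar ▸ E.mem_bag_par hrk hu huw)

/-- Eliminate all vertices but the first one. -/
def eliminate : Cmd :=
  forRange .r (.reg .n - 1) (set .w (.get .ord (.reg .n - 1 - .reg .r) 0) ;;
    set .v (.get .par (.reg .w) 0) ;; forRange .y (.reg .Q) restrictEntry)

theorem runs_eliminate (H : Env M E q L h) (hcol : ∀ u, colOf n h u < q)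
    (hord : ∀ v : Fin n, h.arr .ord (E.rk v) 0 = v)
    (hpar : ∀ w : Fin n, 0 < E.rk w → h.arr .par w 0 = E.par w) (hbad : BadTable E q 0 h) :
    M.Runs eliminate h ((n - 1) * (q ^ D * (D * 4 + q * (D * 4 + 8) + 9) + 6) + 2) fun h' =>
      Agree [.r, .w, .v, .y, .z, .i, .found, .c, .x, .pw] [.col, .bad] h' h ∧
      (∀ u, colOf n h' u < q) ∧ BadTable E q (n - 1) h' := by
  have hnU := H.n_le
  refine (M.runs_forRange_const (fun k h' =>
    Agree [.r, .w, .v, .y, .z, .i, .found, .c, .x, .pw] [.col, .bad] h' h ∧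
    (∀ u, colOf n h' u < q) ∧ BadTable E q k h') (n - 1)
    (q ^ D * (D * 4 + q * (D * 4 + 8) + 9) + 4) (by omega) ?_ ?_ ?_ ?_).le (le_refl _)
  · exact ⟨(Agree.refl _ _ _).set, hcol, hbad⟩
  · rintro k h' - ⟨h1, -⟩
    simp [(H.of_agree h1).reg_n]
  · rintro k h' hk ⟨h1, h2, h3⟩ hkr
    obtain ⟨w, hw⟩ := exists_rk_eq E (r := n - 1 - k) (by omega)
    have hw0 : 0 < E.rk w := by omega
    set v := E.par w with hv
    have hvw : v ≠ w := E.par_ne hw0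
    have hwU : (w : ℕ) ≤ M.U := w.2.le.trans hnU
    have hvU : (v : ℕ) ≤ M.U := v.2.le.trans hnU
    have hordr : h'.arr .ord (n - 1 - k) 0 = w := by
      rw [h1.arr .ord (by simp), ← hw]; exact hord w
    have hparr : h'.arr .par w 0 = v := by
      rw [h1.arr .par (by simp)]; exact hpar w hw0
    -- Ranks are distinct, so this stage concerns the single vertex `w` and changes only the row of
    -- its parent.
    have hstep : ∀ u : Fin n, ∀ φ : Fin n → ℕ, E.Feasible q (k + 1) u φ ↔ E.Feasible q k u φ ∧
        (u = v → ∃ c < q, E.Feasible q k w (Function.update φ w c)) := by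
      intro u φ
      rw [Elimination.Feasible]
      refine and_congr_right fun _ => ⟨fun h hu => h w (by omega) hw0 hu.symm, ?_⟩
      intro h w' hw' _ hp
      have hww : w' = w := E.rk_inj (by clear h; omega)
      rw [hww] at hp ⊢
      exact h hp.symm
    refine (M.runs_set_seq (by simpa [(H.of_agree h1).reg_n, hkr, hordr] using hwU) ?_)
    simp only [Exp.eval_get, Exp.eval_sub, Exp.eval_reg, Exp.eval_one, (H.of_agree h1).reg_n, hkr,
      hordr, Exp.eval_zero]
    refine (M.runs_set_seq (by simpa [hparr] using hvU) ?_)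
    simp only [Exp.eval_get, Exp.eval_reg, Store.reg_set, if_true, Store.arr_set, Exp.eval_zero,
      hparr]
    have h4 : Agree [.r, .w, .v, .y, .z, .i, .found, .c, .x, .pw] [.col, .bad]
      ((h'.set .w w).set .v v) h := (h1.set).set
    refine M.runs_forRange_const (fun y h'' =>
      Agree [.z, .i, .found, .c, .x, .pw, .y] [.col, .bad] h'' ((h'.set .w w).set .v v) ∧
      (∀ u, colOf n h'' u < q) ∧
      (∀ u : ℕ, u ≠ v → h''.arr .bad u = h'.arr .bad u) ∧
      (∀ φ : Fin n → ℕ, (∀ u, φ u < q) → code E q v φ < y →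
        h''.arr .bad v (code E q v φ) = ind (¬ E.Feasible q (k + 1) v φ)) ∧
      (∀ b, y ≤ b → h''.arr .bad v b = h'.arr .bad v b))
      (q ^ D) (D * 4 + q * (D * 4 + 8) + 7) H.Q_le ?_ ?_ ?_ ?_
    · exact ⟨(Agree.refl _ _ _).set, h2, fun _ _ => rfl,
        fun φ hφ hlt => absurd hlt (Nat.not_lt_zero _), fun _ _ => rfl⟩
    · rintro y h'' - ⟨h5, -⟩
      simp [((H.of_agree h4).of_agree h5).reg_Q]
    · rintro y h'' hy ⟨h5, h6, h7, h8, h9⟩ hyr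
      have hwv' : (w : ℕ) ≠ v := fun h => hvw (Fin.ext h.symm)
      refine (runs_restrictEntry ((H.of_agree h4).of_agree h5) (v := v) (w := w) (k := k) (y := y)
        (by simp [h5.reg]) (by simp [h5.reg]) hyr (hy.le.trans H.Q_le) h6 hw0 rfl
        fun φ hφ => ?_).mono (fun h₂ hp => ?_) le_rfl
      · rw [h7 w hwv']
        exact h3 w φ hφ
      · obtain ⟨h10, h11, h12, h13⟩ := hp
        refine ⟨by simp [h10.reg, hyr], (h10.trans h5).set, h11, fun u hu => ?_,
          fun φ hφ hlt => ?_, fun b hb => ?_⟩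
        · funext b
          simp only [Store.arr_set]
          rw [h12 u b (Or.inl hu), h7 u hu]
        · simp only [Store.arr_set]
          rcases Nat.lt_succ_iff_lt_or_eq.1 hlt with hlt | heq
          · rw [h12 _ _ (Or.inr hlt.ne), h8 φ hφ hlt]
          · rw [heq, h13 φ hφ heq (by rw [h9 y le_rfl, ← heq]; exact h3 v φ hφ)]
            refine ind_congr (not_congr ?_)
            rw [hstep v φ]
            simp
        · simp only [Store.arr_set]
          rw [h12 _ _ (Or.inr (by omega)), h9 b (by omega)]
    · rintro h'' ⟨h5, h6, h7, h8, h9⟩ -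
      refine ⟨by simp [h5.reg, hkr], (h5.trans h4).set, h6, fun u φ hφ => ?_⟩
      simp only [Store.arr_set]
      by_cases huv : u = v
      · rw [huv, h8 φ hφ (code_lt hφ)]
      · rw [h7 u fun h => huv (Fin.ext h), h3 u φ hφ]
        refine ind_congr (not_congr ?_)
        rw [hstep u φ]
        simp [huv]
  · exact fun h' hI _ => hI

/-! ### Construction of the coloring -/

/-- Color the vertices in the elimination order. -/
def extract : Cmd :=
  set .flag 1 ;; forRange .r (.reg .n) (set .w (.get .ord (.reg .r) 0) ;; set .found 0 ;;
    set .best 0 ;;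
    forRange .c (.reg .q) (put .col (.reg .w) 0 (.reg .c) ;; encode (slotColor .w .i) ;;
      set .best (.reg .best * .get .bad (.reg .w) (.reg .x) +
        .reg .c * (1 - .get .bad (.reg .w) (.reg .x))) ;;
      set .found (1 - (1 - .reg .found) * .get .bad (.reg .w) (.reg .x))) ;;
    put .col (.reg .w) 0 (.reg .best) ;; set .flag (.reg .flag * .reg .found))

/-- As long as the flag is 1, all colored vertices satisfy the conditions of the stages still to be
undone. Once it is 0 it remains so, and the remaining colors only have to stay below `q`. -/
theorem runs_extract (H : Env M E q L h) (hcol : ∀ u, colOf n h u < q)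
    (hord : ∀ v : Fin n, h.arr .ord (E.rk v) 0 = v) (hbad : BadTable E q (n - 1) h) :
    M.Runs extract h (n * (q * (D * 4 + 9) + 9) + 3) fun h' =>
      Agree [.flag, .r, .w, .found, .best, .c, .x, .pw, .i] [.col] h' h ∧
      (∀ u, colOf n h' u < q) ∧
      ((h'.reg .flag = 1 ∧ ∀ v, E.Good v (colOf n h')) ∨
        (h'.reg .flag = 0 ∧ ¬ ∃ ψ : Fin n → ℕ, (∀ v, ψ v < q) ∧ ∀ v, E.Good v ψ)) := by
  have hnU := H.n_le
  have hq := H.two_le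
  have h1U : 1 ≤ M.U := by have := M.le_U; omega
  have hiU : ∀ P, ind P ≤ M.U := fun P => (ind_le P).trans h1U
  refine (M.runs_set_seq (by simpa using h1U) (M.runs_forRange_const (fun k h' =>
    Agree [.flag, .r, .w, .found, .best, .c, .x, .pw, .i] [.col] h' h ∧
      (∀ u, colOf n h' u < q) ∧
      ((h'.reg .flag = 1 ∧ ∀ v, E.rk v < k → E.Feasible q (n - k) v (colOf n h')) ∨
        (h'.reg .flag = 0 ∧ ¬ ∃ ψ : Fin n → ℕ, (∀ v, ψ v < q) ∧ ∀ v, E.Good v ψ)))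
    n (q * (D * 4 + 9) + 7) hnU ?_ ?_ ?_ ?_)).le (le_refl _)
  · exact ⟨((Agree.refl _ _ _).set).set, hcol,
      Or.inl ⟨by simp, fun v hv => absurd hv (Nat.not_lt_zero _)⟩⟩
  · rintro k h' - ⟨h1, -⟩
    simp [(H.of_agree h1).reg_n]
  · rintro k h' hk ⟨h1, h2, h3⟩ hkr
    obtain ⟨w, hw⟩ := exists_rk_eq E hk
    have hwU : (w : ℕ) ≤ M.U := w.2.le.trans hnU
    set φ := colOf n h' with hφ
    set F : ℕ → Prop := fun c => E.Feasible q (n - 1) w (Function.update φ w c) with hF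
    have hordr : h'.arr .ord k 0 = w := by
      rw [h1.arr .ord (by simp), ← hw]; exact hord w
    refine M.runs_set_seq (by simpa [hkr, hordr] using hwU) ?_
    simp only [Exp.eval_get, Exp.eval_reg, hkr, hordr, Exp.eval_zero]
    refine M.runs_set_seq (by simp) (M.runs_set_seq (by simp) (M.runs_seq (l := 2)
      (M.runs_forRange_const (fun c h'' =>
        Agree [.flag, .r, .w, .found, .best, .c, .x, .pw, .i] [.col] h'' h ∧
        h''.reg .w = w ∧ h''.reg .r = k ∧ h''.reg .flag = h'.reg .flag ∧
        (∀ u, colOf n h'' u < q) ∧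
        (∀ c, Function.update (colOf n h'') w c = Function.update φ w c) ∧
        h''.reg .found = ind (∃ c' < c, F c') ∧ h''.reg .best < q ∧
        ((∃ c' < c, F c') → F (h''.reg .best)))
        q (D * 4 + 7) H.q_le ?_ ?_ ?_ fun h' hI _ => hI) ?_))
    · refine ⟨(((h1.set).set).set).set, by simp, by simp [hkr], by simp, h2, fun _ => rfl, ?_, ?_,
        by simp⟩
      · rw [ind_false (by simp)]
        simp
      · simp; omega
    · rintro c h'' - ⟨h4, -⟩
      simp [(H.of_agree h4).reg_q]
    · rintro c h'' hc ⟨h4, h5, h6, h7, h8, h9, h10, h11, h12⟩ hcr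
      have hcU : c ≤ M.U := hc.le.trans H.q_le
      have hcolp : colOf n (h''.put .col w 0 c) = Function.update φ w c := by
        rw [colOf_put, h9]
      have hlt := update_lt h2 hc (w := w)
      refine M.runs_put_seq (by simpa [hcr] using hcU) ?_
      simp only [Exp.eval_reg, h5, hcr, Exp.eval_zero]
      have h4' : Agree [.flag, .r, .w, .found, .best, .c, .x, .pw, .i] [.col]
        (h''.put .col w 0 c) h := h4.put
      refine M.runs_seq (l := 2) (runs_encode_slotColor (w := w) (H.of_agree h4')
        (by simpa using h5) (by rw [hcolp]; exact hlt)) ?_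
      rw [hcolp]
      rintro h₃ ⟨h13, h14⟩
      have hwr : h₃.reg .w = w := by simp [h13.reg, h5]
      have hcr' : h₃.reg .c = c := by simp [h13.reg, hcr]
      have hbr : h₃.reg .best = h''.reg .best := by simp [h13.reg]
      have hfr : h₃.reg .found = h''.reg .found := by simp [h13.reg]
      have hbadr : h₃.arr .bad w (h₃.reg .x) = ind (¬ F c) := by
        rw [h14, h13.arr .bad (by simp), h4'.arr .bad (by simp)]
        exact hbad w _ hlt
      have hcol₃ : colOf n h₃ = Function.update φ w c := by
        rw [← hcolp]
        funext u
        simp only [colOf]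
        rw [h13.arr .col (by simp)]
      -- One of the two factors is 1 and the other 0: the sum is `c` if `c` is feasible, and the
      -- previous choice otherwise.
      set b' := (Exp.reg .best * .get .bad (.reg .w) (.reg .x) +
        .reg .c * (1 - .get .bad (.reg .w) (.reg .x)) : Exp).eval h₃ with hb'
      have hbest : (F c → b' = c) ∧ (¬ F c → b' = h''.reg .best) := by
        simp only [hb', Exp.eval_add, Exp.eval_mul, Exp.eval_sub, Exp.eval_one, Exp.eval_reg,
          Exp.eval_get, hwr, hbadr, hcr', hbr, one_sub_ind]
        constructor
        · intro hFc
          rw [ind_false (not_not.2 hFc), ind_true (not_not.2 hFc)]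
          omega
        · intro hFc
          rw [ind_true hFc, ind_false (not_not.2 hFc)]
          omega
      have hbq : b' < q := by
        by_cases hFc : F c
        · rw [hbest.1 hFc]; exact hc
        · rw [hbest.2 hFc]; exact h11
      have key : (1 - (1 - .reg .found) * .get .bad (.reg .w) (.reg .x) : Exp).eval
          (h₃.set .best b') = ind (∃ c' < c + 1, F c') := by
        simp only [Exp.eval_sub, Exp.eval_mul, Exp.eval_one, Exp.eval_reg, Exp.eval_get,
          Store.reg_set, reduceCtorEq, if_false, Store.arr_set, hfr, h10, hwr,
          hbadr, one_sub_ind, ind_mul_ind]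
        refine ind_congr ?_
        rw [Nat.exists_lt_succ_right, not_and_or, not_not, not_not]
      refine M.runs_set_seq (l := 1) (hbq.le.trans H.q_le) (M.runs_set ?_ ?_)
      · rw [← hb', key]; exact hiU _
      · rw [← hb', key]
        refine ⟨by simp [h13.reg, hcr], (((h13.trans h4').set).set).set, by simp [h13.reg, h5],
          by simp [h13.reg, h6], by simp [h13.reg, h7], ?_, ?_, by simp, by simpa using hbq, ?_⟩
        · intro u
          change colOf n h₃ u < q
          rw [hcol₃]
          exact hlt u
        · intro c'
          change Function.update (colOf n h₃) w c' = _
          rw [hcol₃, Function.update_idem]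
        · simp only [Store.reg_set, reduceCtorEq, if_false, if_true]
          rintro ⟨c', hc', hFc'⟩
          by_cases hFc : F c
          · rw [hbest.1 hFc]; exact hFc
          · rw [hbest.2 hFc]
            refine h12 ⟨c', lt_of_le_of_ne (by omega) ?_, hFc'⟩
            rintro rfl
            exact hFc hFc'
    · rintro h'' ⟨h4, h5, h6, h7, h8, h9, h10, h11, h12⟩
      set b := h''.reg .best with hb
      have hcolp : colOf n (h''.put .col w 0 b) = Function.update φ w b := by
        rw [colOf_put, h9]
      refine M.runs_put_seq (by simpa using h11.le.trans H.q_le) ?_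
      simp only [Exp.eval_reg, h5, Exp.eval_zero, ← hb]
      have hflag : (Exp.reg .flag * .reg .found : Exp).eval (h''.put .col w 0 b) =
          h'.reg .flag * ind (∃ c < q, F c) := by
        simp [h7, h10]
      refine M.runs_set ?_ ?_
      · rw [hflag]
        have h13 := ind_le (∃ c < q, F c)
        have h14 : h'.reg .flag ≤ 1 := by rcases h3 with h | h <;> omega
        exact (Nat.mul_le_mul h14 h13).trans h1U
      · rw [hflag]
        have hcolf : ∀ a c : ℕ, colOf n (((h''.put .col w 0 b).set .flag a).set .r c) =
            Function.update φ w b := fun _ _ => hcolp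
        refine ⟨by simp [h6], ((h4.put).set).set, fun u => ?_, ?_⟩
        · rw [hcolf]
          exact update_lt h2 h11 u
        · rw [hcolf]
          rcases h3 with ⟨h13, h14⟩ | ⟨h13, h14⟩
          · by_cases hex : ∃ c < q, F c
            · left
              refine ⟨by simp [h13, ind_true hex], ?_⟩
              have := E.feasible_next q (w := w) (φ := φ) (c := b) (by rw [hw]; exact h14) (h12 hex)
              rwa [hw] at this
            · right
              refine ⟨by simp [ind_false hex], ?_⟩
              rintro ⟨ψ, hψ, hgood⟩
              -- Failure is genuine only at the first vertex, where a good coloring would provide a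
              -- color. At a later vertex the table of the parent already does.
              rcases Nat.eq_zero_or_pos k with h0 | hpos
              · exact hex (E.exists_feasible_first q (by omega) φ hψ hgood)
              · exact hex (E.exists_feasible q (by omega) (by rw [hw]; exact h14))
          · exact Or.inr ⟨by simp [h13], h14⟩
  · rintro h' ⟨h1, h2, h3⟩ -
    refine ⟨h1, h2, h3.imp (fun h => ⟨h.1, fun v => ?_⟩) id⟩
    have := h.2 v (E.rk_lt v)
    rwa [Nat.sub_self] at this

/-- Write the output. -/
def output : Cmd :=
  putLow 0 (.reg .flag) ;; forRange .v (.reg .n) (putLow (.reg .v + 1) (.get .col (.reg .v) 0))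

theorem runs_output (hn : h.reg .n = n) (hnU : n ≤ M.U) (hnb : n < M.base) :
    M.Runs output h (n * 3 + 3) fun h' =>
      h'.low 0 = h.reg .flag ∧ ∀ v : Fin n, h'.low (v + 1) = colOf n h v := by
  refine M.runs_of_le fun hr hA => ?_
  refine (M.runs_seq (M.runs_putLow (a := 0) (e := .reg .flag)
    (Q := fun h' => h' = h.putLow 0 (h.reg .flag)) (by simp; omega) (hr _) rfl) ?_ (l := n * 3 + 2)).le (by omega)
  rintro _ rfl
  refine M.runs_forRange_const (fun k h' => h'.reg .n = n ∧ h'.arr = h.arr ∧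
    h'.low 0 = h.reg .flag ∧ ∀ v : Fin n, (v : ℕ) < k → h'.low (v + 1) = colOf n h v) n 1 hnU
    ?_ ?_ ?_ ?_
  · exact ⟨by simp [hn], rfl, by simp, fun v hv => absurd hv (Nat.not_lt_zero _)⟩
  · rintro k h' - ⟨h1, -⟩
    simp [h1]
  · rintro k h' hk ⟨h1, h2, h3, h4⟩ hkr
    refine M.runs_putLow (by simp [hkr]; omega) ?_ ⟨by simp [hkr], by simp [h1], by simp [h2],
      by simp [h3], fun v hv => ?_⟩
    · simp only [Exp.eval_get, h2]; exact hA _ _ _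
    · rcases Nat.lt_succ_iff_lt_or_eq.1 hv with hlt | rfl
      · simp [hkr, hlt.ne, h4 v hlt]
      · simp [hkr, h2, colOf]
  · rintro h' ⟨h1, h2, h3, h4⟩ -
    exact ⟨h3, fun v => h4 v v.2⟩

end RAM

/-! ### Reading the input and preparing the elimination -/

namespace RAM

/-- A sequence of lists as a sequence of words. -/
def blocks (k : ℕ) (L : ℕ → List ℕ) : List ℕ :=
  (List.range k).flatMap fun x => (L x).length :: L x

theorem blocks_succ (k : ℕ) (L : ℕ → List ℕ) :
    blocks (k + 1) L = blocks k L ++ ((L k).length :: L k) := by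
  simp [blocks, List.range_succ]

theorem length_blocks (k : ℕ) (L : ℕ → List ℕ) :
    (blocks k L).length = ∑ x ∈ Finset.range k, ((L x).length + 1) := by
  induction k with
  | zero => rfl
  | succ k ih => rw [blocks_succ, List.length_append, ih, Finset.sum_range_succ, List.length_cons]

theorem getD_blocks {k x j : ℕ} {L : ℕ → List ℕ} (hx : x < k) (hj : j ≤ (L x).length)
    (pre post : List ℕ) :
    (pre ++ (blocks k L ++ post)).getD (pre.length + ((blocks x L).length + j)) 0 =
      ((L x).length :: L x).getD j 0 := by
  induction k generalizing post with
  | zero => omega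
  | succ k ih =>
    rw [blocks_succ, List.append_assoc]
    rcases Nat.lt_succ_iff_lt_or_eq.1 hx with hlt | rfl
    · exact ih hlt _
    · rw [List.getD_append_right _ _ _ _ (by omega), List.getD_append_right _ _ _ _ (by omega),
        List.getD_append _ _ _ _ (by simp only [List.length_cons]; omega)]
      congr 1
      omega

/-- A finite sequence of lists of elements of `Fin m` as an infinite sequence of lists of
numbers. -/
def extend {k m : ℕ} (L : Fin k → List (Fin m)) (x : ℕ) : List ℕ :=
  if hx : x < k then (L ⟨x, hx⟩).map Fin.val else []

theorem extend_coe {k m : ℕ} (L : Fin k → List (Fin m)) (x : Fin k) :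
    extend L x = (L x).map Fin.val := by simp [extend]

theorem encodeLists_eq {k m : ℕ} (L : Fin k → List (Fin m)) :
    encodeLists L = blocks k (extend L) := by
  unfold encodeLists blocks
  rw [List.ofFn_eq_map, ← List.map_coe_finRange_eq_range, List.flatMap_map, List.flatMap_map]
  exact List.flatMap_congr fun x _ => by rw [extend_coe, List.length_map]

section ListsFamily

variable {k m : ℕ} {L : Fin k → List (Fin m)} {S : Fin k → Set (Fin m)}

theorem mem_extend (H : ListsFamily L S) {x : Fin k} {w : ℕ} :
    w ∈ extend L x ↔ ∃ h : w < m, (⟨w, h⟩ : Fin m) ∈ S x := by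
  rw [extend_coe, List.mem_map]
  constructor
  · rintro ⟨a, ha, rfl⟩
    exact ⟨a.2, ((H x).2 a).1 ha⟩
  · rintro ⟨h, hw⟩
    exact ⟨_, ((H x).2 _).2 hw, rfl⟩

theorem lt_of_mem_extend {x w : ℕ} (h : w ∈ extend L x) : w < m := by
  unfold extend at h
  split_ifs at h
  · obtain ⟨a, -, rfl⟩ := List.mem_map.1 h
    exact a.2
  · simp at h

theorem length_extend (H : ListsFamily L S) {x : Fin k} {s : Finset (Fin m)}
    (hs : (s : Set (Fin m)) = S x) : (extend L x).length = s.card := by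
  rw [extend_coe, List.length_map, ← List.toFinset_card_of_nodup (H x).1]
  congr 1
  ext a
  rw [List.mem_toFinset, (H x).2, ← hs, Finset.mem_coe]

theorem length_extend_le (H : ListsFamily L S) (x : ℕ) : (extend L x).length ≤ m := by
  unfold extend
  split_ifs with hx
  · rw [List.length_map]
    exact (H _).1.length_le_card.trans (by simp)
  · simp

end ListsFamily

variable {M : Machine}

/-- Reading lists at a known position of the input. -/
theorem runs_readLists_blocks {m : Reg} {A B : Arr} (hAB : A ≠ B)
    (hm : m ∉ [Reg.x, .e, .j, .z, .p]) {h : Store} {k : ℕ} {pre post : List ℕ} {L : ℕ → List ℕ}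
    (hk : h.reg m = k) (hp : h.reg .p = pre.length) (hkU : k ≤ M.U)
    (hlow : h.low = fun i => (pre ++ (blocks k L ++ post)).getD i 0)
    (hbase : (pre ++ blocks k L).length ≤ M.base)
    (hbound : ∀ x < k, ∀ y ∈ L x, y ≤ M.U) :
    M.Runs (readLists m A B) h (∑ x ∈ Finset.range k, ((L x).length * 5 + 7) + 2) fun h' =>
      Agree [.x, .e, .j, .z, .p] [A, B] h' h ∧
      h'.reg .p = (pre ++ blocks k L).length ∧ Holds h' A B k L := by
  refine (runs_readLists (M := M) hAB hm (len := fun x => (L x).length)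
    (el := fun x j => (L x).getD j 0) hk hp hkU ?_ ?_ ?_ ?_).mono ?_ le_rfl
  · rwa [List.length_append, length_blocks] at hbase
  · intro x hx
    have := getD_blocks (L := L) hx (j := 0) (Nat.zero_le _) pre post
    rw [length_blocks, Nat.add_zero] at this
    simpa [hlow] using this
  · intro x hx j hj
    rw [List.getD_eq_getElem _ _ hj]
    exact hbound x hx _ (List.getElem_mem hj)
  · intro x hx j hj
    have := getD_blocks (L := L) hx (j := j + 1) hj pre post
    rw [length_blocks, List.getD_cons_succ] at this
    rw [hlow, ← this]
    congr 1
    omega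
  · rintro h' ⟨h1, h2, h3⟩
    refine ⟨h1, by rw [h2, List.length_append, length_blocks], fun x hx => ⟨(h3 x hx).1, ?_⟩⟩
    intro j hj
    rw [(h3 x hx).2 j hj, List.getD_eq_getElem _ _ hj]

/-- Read the input, and compute an elimination of the graph from the tree decomposition. -/
def prepare : Cmd :=
  load .n 0 ;; load .N 1 ;; set .p (1 + 1) ;; readLists .n .deg .nb ;; readLists .N .tdeg .tnb ;;
    readLists .N .bsz .bag ;; buildAdj ;; maxBag ;; powQ ;; search ;; number

/-- The time units needed by `prepare`. -/
def prepareCost (n N K : ℕ) (A B L : ℕ → List ℕ) : ℕ :=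
  (∑ x ∈ Finset.range n, ((A x).length * 5 + 7) + 2) +
  ((∑ x ∈ Finset.range N, ((B x).length * 5 + 7) + 2) +
  ((∑ x ∈ Finset.range N, ((L x).length * 5 + 7) + 2) +
  ((∑ v ∈ Finset.range n, ((A v).length * 3 + 4) + 2) +
  ((N * 3 + 3) + ((K * 3 + 3) +
  ((∑ x ∈ Finset.range N, ((B x).length * 6 + 3) + 2 * N + 4) +
  (N * (K * (K * 8 + 11) + 5) + 3))))))) + 1 + 1 + 1

theorem _root_.SimpleGraph.Connected.forall_of_closed {V : Type*} {T : SimpleGraph V}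
    (hT : T.Connected) {S : V → Prop} {a : V} (ha : S a) (h : ∀ x, S x → ∀ y, T.Adj x y → S y)
    (x : V) : S x := by
  obtain ⟨p⟩ := hT.preconnected a x
  induction p with
  | nil => exact ha
  | cons hadj _ ih => exact ih (h _ ha _ hadj)

theorem runs_prepare {n N K q : ℕ} {G : SimpleGraph (Fin n)} {T : SimpleGraph (Fin N)}
    (D : TreeDecomposition G T) {A : Fin n → List (Fin n)} {B : Fin N → List (Fin N)}
    {L : Fin N → List (Fin n)} (hA : ListsFamily A G.neighborSet)
    (hB : ListsFamily B T.neighborSet) (hL : ListsFamily L fun x => (D.bag x : Set (Fin n)))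
    (hq : 2 ≤ q) (hK : (Finset.range N).sup (fun x => (extend L x).length) = K)
    (hnU : n ≤ M.U) (hNU : N < M.U) (hqU : q ≤ M.U) (hQU : q ^ K ≤ M.U) {input : List ℕ}
    (hinput : input = n :: N :: (encodeLists A ++ encodeLists B ++ encodeLists L))
    (hbase : input.length ≤ M.base) {h : Store} (hlow : h.low = fun i => input.getD i 0)
    (hreg : h.reg .q = q) (harr : ∀ X a b, h.arr X a b = 0) :
    M.Runs prepare h (prepareCost n N K (extend A) (extend B) (extend L)) fun h' =>
      ∃ E : Elimination G n K, Env M E q (extend A) h' ∧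
        (∀ v : Fin n, h'.arr .ord (E.rk v) 0 = v) ∧
        (∀ w : Fin n, 0 < E.rk w → h'.arr .par w 0 = E.par w) ∧
        ∀ u, colOf n h' u = 0 := by
  have : Nonempty (Fin N) := D.isTree.connected.nonempty
  have hN0 : 0 < N := Fin.pos_iff_nonempty.2 inferInstance
  have hKU : K ≤ M.U := (Nat.lt_pow_self (by omega)).le.trans hQU
  have hLK : ∀ x < N, (extend L x).length ≤ K := fun x hx =>
    hK ▸ Finset.le_sup (f := fun x => (extend L x).length) (Finset.mem_range.2 hx)
  have hAU : ∀ x, (extend A x).length ≤ M.U := fun x => (length_extend_le hA x).trans hnU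
  have hBU : ∀ x, (extend B x).length ≤ M.U := fun x => (length_extend_le hB x).trans hNU.le
  have hLU : ∀ x, (extend L x).length ≤ M.U := fun x => (length_extend_le hL x).trans hnU
  rw [encodeLists_eq, encodeLists_eq, encodeLists_eq] at hinput
  have hlen : input.length = 2 + (blocks n (extend A)).length + (blocks N (extend B)).length +
      (blocks N (extend L)).length := by
    rw [hinput]; simp only [List.length_cons, List.length_append]; omega
  have hlow0 : h.low 0 = n := by rw [hlow, hinput]; rfl
  have hlow1 : h.low 1 = N := by rw [hlow, hinput]; rfl
  refine M.runs_load_seq (by simp; omega) ?_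
  refine M.runs_load_seq (by simp; omega) ?_
  refine M.runs_set_seq (by have := M.le_U; simp; omega) ?_
  simp only [Exp.eval_zero, Exp.eval_one, Exp.eval_add, hlow0, hlow1, Store.low_set]
  set h0 := ((h.set .n n).set .N N).set .p (1 + 1) with hh0
  have hl0 : h0.low = fun i => input.getD i 0 := hlow
  have e0 : h0.arr = h.arr := rfl
  refine M.runs_seq (runs_readLists_blocks (M := M) (pre := [n, N]) (L := extend A)
    (post := blocks N (extend B) ++ blocks N (extend L)) (k := n) (by decide) (by decide)
    (by simp [hh0]) (by simp [hh0]) hnU (by rw [hl0, hinput]; simp) (by simp; omega)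
    fun x _ y hy => (lt_of_mem_extend hy).le.trans hnU) ?_
  rintro h1 ⟨g1, p1, r1⟩
  refine M.runs_seq (runs_readLists_blocks (M := M) (pre := [n, N] ++ blocks n (extend A))
    (L := extend B) (post := blocks N (extend L)) (k := N) (by decide) (by decide)
    (by simp [g1.reg, hh0]) p1 hNU.le (by rw [g1.low, hl0, hinput]; simp) (by simp; omega)
    fun x _ y hy => (lt_of_mem_extend hy).le.trans hNU.le) ?_
  rintro h2 ⟨g2, p2, r2⟩
  refine M.runs_seq (runs_readLists_blocks (M := M)
    (pre := [n, N] ++ blocks n (extend A) ++ blocks N (extend B))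
    (L := extend L) (post := []) (k := N) (by decide) (by decide)
    (by simp [g2.reg, g1.reg, hh0]) p2 hNU.le (by rw [g2.low, g1.low, hl0, hinput]; simp)
    (by simp; omega) fun x _ y hy => (lt_of_mem_extend hy).le.trans hnU) ?_
  rintro h3 ⟨g3, -, r3⟩
  refine M.runs_seq (runs_buildAdj (M := M) (n := n) (L := extend A)
    (by simp [g3.reg, g2.reg, g1.reg, hh0]) hnU ((r1.of_agree g2).of_agree g3) (fun v _ => hAU v)
    (by simp [g3.arr, g2.arr, g1.arr, e0, harr])) ?_
  rintro h4 ⟨g4, r4⟩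
  refine M.runs_seq (runs_maxBag (M := M) (N := N) (L := extend L)
    (by simp [g4.reg, g3.reg, g2.reg, g1.reg, hh0]) hNU.le (r3.of_agree g4) fun v _ => hLU v) ?_
  rintro h5 ⟨g5, r5⟩
  rw [hK] at r5
  refine M.runs_seq (runs_powQ (M := M) (q := q) (D := K)
    (by simp [g5.reg, g4.reg, g3.reg, g2.reg, g1.reg, hh0, hreg]) r5 (by omega) hKU hQU) ?_
  rintro h6 ⟨g6, r6⟩
  refine M.runs_seq (runs_search (M := M) (N := N) (L := extend B)
    (by simp [g6.reg, g5.reg, g4.reg, g3.reg, g2.reg, g1.reg, hh0]) hNU hN0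
    ((((r2.of_agree g3).of_agree g4).of_agree g5).of_agree g6) (fun v _ => hBU v)
    (fun x _ y hy => lt_of_mem_extend hy) ?_
    (by simp [g6.arr, g5.arr, g4.arr, g3.arr, g2.arr, g1.arr, e0, harr])
    (by simp [g6.arr, g5.arr, g4.arr, g3.arr, g2.arr, g1.arr, e0, harr])) ?_
  · intro S hS0 hS x hx
    exact D.isTree.connected.forall_of_closed (S := fun x : Fin N => S x) (a := ⟨0, hN0⟩) hS0
      (fun x hx y hxy => hS x x.2 hx y ((mem_extend hB).2 ⟨y.2, hxy⟩)) ⟨x, hx⟩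
  rintro h7 ⟨g7, hlt, hinj, hprev⟩
  refine (runs_number (M := M) (n := n) (N := N) (D := K) (L := extend L)
    (by simp [g7.reg, g6.reg, g5.reg, g4.reg, g3.reg, g2.reg, g1.reg, hh0])
    (by simp [g7.reg, g6.reg, r5]) hKU hnU hNU.le
    ((((r3.of_agree g4).of_agree g5).of_agree g6).of_agree g7)
    (fun x _ y hy => lt_of_mem_extend hy) hLK hlt
    (by simp [g7.arr, g6.arr, g5.arr, g4.arr, g3.arr, g2.arr, g1.arr, e0, harr])).mono ?_ le_rfl
  rintro h8 ⟨g8, r8⟩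
  -- The value beyond `N` is a mere default.
  let τ : ℕ → Fin N := fun i => if hi : i < N then ⟨h7.arr .queue i 0, hlt i hi⟩ else ⟨0, hN0⟩
  have hτ : ∀ i < N, (τ i : ℕ) = h7.arr .queue i 0 := fun i hi => by simp [τ, hi]
  have hτB : ∀ a < N, ∀ v, v ∈ extend L (h7.arr .queue a 0) ↔
      ∃ h : v < n, (⟨v, h⟩ : Fin n) ∈ D.bag (τ a) := fun a ha v => by
    simp only [← hτ a ha, mem_extend hL, Finset.mem_coe]
  have hτp : ∀ i < N, 0 < i → ∃ p < i, T.Adj (τ i) (τ p) := fun i hi hi0 => by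
    obtain ⟨p, hp, hmem⟩ := hprev i hi hi0
    rw [← hτ i hi, ← hτ p (hp.trans hi), mem_extend hB] at hmem
    exact ⟨p, hp, hmem.2.symm⟩
  obtain ⟨E, hE1, hE2, hE3⟩ := exists_elimination D (τ := τ)
    (fun i hi j hj hij => hinj i hi j hj (by rw [← hτ i hi, ← hτ j hj, hij])) hτp hτB r8
  refine ⟨E, ⟨?_, ?_, ?_, ?_, hnU, hqU, hKU, hQU, hq, hE1, ?_, ?_, fun v w => mem_extend hA,
    fun v _ => hAU v⟩, hE3, hE2, ?_⟩
  · simp [g8.reg, g7.reg, g6.reg, g5.reg, g4.reg, g3.reg, g2.reg, g1.reg, hh0]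
  · simp [g8.reg, g7.reg, g6.reg, g5.reg, g4.reg, g3.reg, g2.reg, g1.reg, hh0, hreg]
  · simp [g8.reg, g7.reg, g6.reg, r5]
  · simp [g8.reg, g7.reg, r6]
  · intro u v
    simp only [g8.arr .adj (by decide), g7.arr .adj (by decide), g6.arr .adj (by decide),
      g5.arr .adj (by decide), r4 u u.2]
    by_cases huv : G.Adj u v
    · rw [ind_true huv, if_pos ((mem_extend hA).2 ⟨v.2, huv⟩)]
    · rw [ind_false huv, if_neg fun hc => huv ((mem_extend hA).1 hc).2]
  · exact (((((((r1.of_agree g2).of_agree g3).of_agree g4).of_agree g5).of_agree g6).of_agree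
      g7).of_agree g8)
  · intro u
    simp [colOf, g8.arr, g7.arr, g6.arr, g5.arr, g4.arr, g3.arr, g2.arr, g1.arr, e0, harr]

end RAM

/-! ### The algorithm -/

namespace RAM

section Solve

variable {M : Machine} {n D : ℕ} {G : SimpleGraph (Fin n)} {E : Elimination G n D} {q : ℕ}
  {L : ℕ → List ℕ} {h : Store}

/-- Find a clique coloring, by means of the elimination. -/
def solve : Cmd := buildTables ;; eliminate ;; extract ;; output

/-- The time units needed by `solve`. -/
def solveCost (n D q : ℕ) (L : ℕ → List ℕ) : ℕ :=
  (∑ v ∈ Finset.range n, (q ^ D * (D * (D * 7 + 27) + (L v).length * (D * 3 + 8) + 24) + 7) + 2) +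
  (((n - 1) * (q ^ D * (D * 4 + q * (D * 4 + 8) + 9) + 6) + 2) +
  ((n * (q * (D * 4 + 9) + 9) + 3) + (n * 3 + 3)))

theorem runs_solve (H : Env M E q L h) (hord : ∀ v : Fin n, h.arr .ord (E.rk v) 0 = v)
    (hpar : ∀ w : Fin n, 0 < E.rk w → h.arr .par w 0 = E.par w) (hcol : ∀ u, colOf n h u = 0)
    (hnb : n < M.base) :
    M.Runs solve h (solveCost n D q L) fun h' => IsAnswer q G h'.low := by
  have hq := H.two_le
  refine M.runs_seq (runs_buildTables H fun u => by rw [hcol]; omega) ?_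
  rintro h1 ⟨g1, c1, r1⟩
  have H1 := H.of_agree g1
  refine M.runs_seq (runs_eliminate H1 c1 (by simpa [g1.arr] using hord)
    (by simpa [g1.arr] using hpar) fun v φ hφ => ?_) ?_
  · rw [r1 v φ hφ]
    exact ind_congr (not_congr (by rw [Elimination.Feasible]))
  rintro h2 ⟨g2, c2, r2⟩
  have H2 := H1.of_agree g2
  refine M.runs_seq (runs_extract H2 c2 (by simpa [g2.arr, g1.arr] using hord) r2) ?_
  rintro h3 ⟨g3, c3, r3⟩
  refine (runs_output (M := M) (H2.of_agree g3).reg_n H.n_le hnb).mono ?_ le_rfl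
  rintro h4 ⟨r4, r5⟩
  refine r3.imp (fun hr => ⟨r4.trans hr.1, fun v => ⟨_, c3 v⟩, ?_, r5⟩)
    fun hr => ⟨r4.trans hr.1, ?_⟩
  · exact (E.isCliqueColoring_iff Fin.val Fin.val_injective _).2 hr.2
  · rintro ⟨φ, hφ⟩
    exact hr.2 ⟨fun u => φ u, fun v => (φ v).2,
      (E.isCliqueColoring_iff Fin.val Fin.val_injective _).1 hφ⟩

end Solve

/-- Here `Q` stands for `q ^ t` and `d` for `t + 1`. The tables have `q ^ K ≤ q * Q` entries, and a
second factor `q` comes from trying all colors of an eliminated vertex. The quadratic factor in `d`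
comes from the clique test and from scanning bags for each numbered vertex. -/
theorem cost_le {n N K d q Q : ℕ} {A B L : ℕ → List ℕ} (hq : 2 ≤ q) (hd : 1 ≤ d) (hK : K ≤ d)
    (hN : 1 ≤ N) (hQ : q ^ K ≤ q * Q)
    (hA : ∑ x ∈ Finset.range n, (A x).length ≤ 2 * (n * K))
    (hB : ∑ x ∈ Finset.range N, (B x).length ≤ 2 * N)
    (hL : ∑ x ∈ Finset.range N, (L x).length ≤ N * K) :
    prepareCost n N K A B L + solveCost n K q A ≤ 1000 * (q ^ 2 * d ^ 2 * (Q * n + N)) := by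
  have hP : 1 ≤ q ^ K := Nat.one_le_pow _ _ (by omega)
  have hn1 : (n - 1) * (q ^ K * (K * 4 + q * (K * 4 + 8) + 9) + 6) ≤
      n * (q ^ K * (K * 4 + q * (K * 4 + 8) + 9) + 6) := Nat.mul_le_mul_right _ (Nat.sub_le _ _)
  have e1 : ∑ v ∈ Finset.range n,
      (q ^ K * (K * (K * 7 + 27) + (A v).length * (K * 3 + 8) + 24) + 7) =
      n * (q ^ K * (K * (K * 7 + 27) + 24) + 7) +
        q ^ K * (K * 3 + 8) * ∑ x ∈ Finset.range n, (A x).length := by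
    have e (y : ℕ) : n * y = ∑ _v ∈ Finset.range n, y := by simp
    rw [Finset.mul_sum, e, ← Finset.sum_add_distrib]
    exact Finset.sum_congr rfl fun _ _ => by ring
  have e2 : ∀ (m i j : ℕ) (X : ℕ → List ℕ), ∑ x ∈ Finset.range m, ((X x).length * i + j) =
      (∑ x ∈ Finset.range m, (X x).length) * i + m * j := fun m i j X => by
    rw [Finset.sum_add_distrib, Finset.sum_mul, Finset.sum_const, Finset.card_range, smul_eq_mul]
  unfold prepareCost solveCost
  simp only [e1, e2]
  generalize ∑ x ∈ Finset.range n, (A x).length = a at *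
  generalize ∑ x ∈ Finset.range N, (B x).length = b at *
  generalize ∑ x ∈ Finset.range N, (L x).length = l at *
  generalize q ^ K = P at *
  set S := Q * n + N with hS
  set X := q ^ 2 * d ^ 2 * S with hX
  have hY : n * P ≤ q * S := by
    calc n * P ≤ n * (q * Q) := Nat.mul_le_mul_left _ hQ
      _ = q * (Q * n) := by ring
      _ ≤ q * S := Nat.mul_le_mul_left _ (by omega)
  -- Every monomial of the cost splits into three factors bounded by `q * S`, `q` and `d ^ 2`, hence
  -- is at most `X`. It then remains to add up coefficients.
  have key : ∀ y i j : ℕ, y ≤ q * S → i ≤ q → j ≤ d ^ 2 → y * i * j ≤ X := fun y i j hy hi hj =>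
    (Nat.mul_le_mul (Nat.mul_le_mul hy hi) hj).trans (le_of_eq (by rw [hX]; ring))
  have hNS : N ≤ q * S := (show N ≤ S by omega).trans (Nat.le_mul_of_pos_left _ (by omega))
  have hn : n ≤ n * P := Nat.le_mul_of_pos_right _ hP
  have hd2 : d ≤ d ^ 2 := Nat.le_self_pow (by omega) d
  have hK2 : K * K ≤ d ^ 2 := by rw [sq]; exact Nat.mul_le_mul hK hK
  have k1 := key (n * P) q 1 hY le_rfl (by omega)
  have k2 := key (n * P) q K hY le_rfl (by omega)
  have k3 := key (n * P) 1 (K * K) hY (by omega) hK2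
  have k4 := key N 1 (K * K) hNS (by omega) hK2
  have k5 := key N 1 K hNS (by omega) (by omega)
  have k6 := key N 1 1 hNS (by omega) (by omega)
  have k7 := key n q K (hn.trans hY) le_rfl (by omega)
  have k8 := key n q 1 (hn.trans hY) le_rfl (by omega)
  have k9 := key (n * P) 1 K hY (by omega) (by omega)
  have k10 := key (n * P) 1 1 hY (by omega) (by omega)
  have k11 := key n 1 K (hn.trans hY) (by omega) (by omega)
  have k12 := key n 1 1 (hn.trans hY) (by omega) (by omega)
  have k13 := key 1 1 K (hN.trans hNS) (by omega) (by omega)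
  have k14 := Nat.mul_le_mul_left (P * (K * 3 + 8)) hA
  simp only [mul_one, one_mul] at k1 k2 k3 k4 k5 k6 k7 k8 k9 k10 k11 k12 k13
  clear_value X
  nlinarith only [hA, hB, hL, hn1, hN, k1, k2, k3, k4, k5, k6, k7, k8, k9, k10, k11, k12, k13, k14]

/-! ### The complete program and its bounds -/

/-- Compute the beginning of the area of the arrays, and set the number of colors. -/
def prelude (q : ℕ) : Cmd :=
  .assign 0 (.bin .mul
    (.bin .add (.bin .add (.mem (.const 0)) (.mem (.const 1))) (.const 2))
    (.bin .add (.bin .add (.mem (.const 0)) (.mem (.const 1))) (.const 2))) ;;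
  .assign (Reg.q.idx + 1) (.const q)

/-- The state of the abstract machine after the prelude. -/
def initialStore (q : ℕ) (input : List ℕ) : Store where
  reg r := if r = .q then q else 0
  arr _ _ _ := 0
  low i := input.getD i 0

/-- The prelude runs before register 0 holds the base address, so it is executed directly on the
RAM. Of its 18 steps, 16 belong to the first assignment and 2 to the second. -/
theorem exec_prelude {M : Machine} {n N q : ℕ} {l : List ℕ}
    (hM : M.base = (n + N + 2) * (n + N + 2)) (hq : q ≤ M.U) (hle : ∀ w ∈ n :: N :: l, w ≤ M.U)
    (hlen : (n :: N :: l).length ≤ M.base) :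
    ∃ s, Exec M.W (prelude q) (State.init (n :: N :: l)) s 18 ∧
      M.Rel (initialStore q (n :: N :: l)) s := by
  have hU := M.le_U
  have hUW : M.U < M.W := lt_of_le_of_lt (Nat.le_self_pow (by omega) _) M.pow_lt
  have hmem : ∀ i, (State.init (n :: N :: l)).mem i ≤ M.U := by
    intro i
    rcases lt_or_ge i (n :: N :: l).length with hi | hi
    · simp only [State.init]
      rw [List.getD_eq_getElem _ _ hi]
      exact hle _ (List.getElem_mem hi)
    · simp only [State.init]
      rw [List.getD_eq_default _ _ hi]
      omega
  refine ⟨_, Exec.seq (Exec.assign (Expr.fits (U := M.U) (by omega) (fun _ => Nat.zero_le _) hmem _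
    ?_ (M.pow_weight_lt (by decide)))) (Exec.assign (e := .const q) (show q < M.W by omega)), ?_, ?_, ?_, ?_, ?_, ?_⟩
  · simp only [Expr.ConstLe]
    omega
  · simp [Function.update, Expr.eval, Op.eval, State.init, hM]
  · intro r
    simp only [initialStore, Function.update_apply, Nat.add_right_cancel_iff, Reg.idx_inj,
      Expr.eval, State.init]
    simp
  · intro A a b
    -- The arrays begin behind the input, where the initial memory is zero.
    exact List.getD_eq_default _ _ (by omega)
  · exact fun _ _ => rfl
  · intro i
    simp only [Function.update_apply, Expr.eval]
    split_ifs
    · exact hq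
    · simp only [State.init, Op.eval]
      exact hM ▸ M.base_le
    · exact Nat.zero_le _
  · exact hmem

/-- The whole program. -/
def cliqueColoring (q : ℕ) : Cmd := prelude q ;; prepare ;; solve

section Degrees

variable {k : ℕ} {G : SimpleGraph (Fin k)} {A : Fin k → List (Fin k)}

theorem sum_length_extend [DecidableRel G.Adj] (hA : ListsFamily A G.neighborSet) :
    ∑ x ∈ Finset.range k, (extend A x).length = ∑ v, G.degree v := by
  rw [Finset.sum_range]
  exact Finset.sum_congr rfl fun v _ => length_extend hA (G.coe_neighborFinset v)

end Degrees

/-- The program runs on the given machine. -/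
theorem exec_cliqueColoring {M : Machine} {n N q : ℕ} (hq : 2 ≤ q) {G : SimpleGraph (Fin n)}
    {T : SimpleGraph (Fin N)} (D : TreeDecomposition G T) {input : List ℕ}
    (hinput : IsEncoding D input) (hM : M.base = (n + N + 2) * (n + N + 2))
    (hQU : q ^ (D.width + 1) ≤ M.U) :
    ∃ s k, Exec M.W (cliqueColoring q) (State.init input) s k ∧
      k ≤ 18 + 1000 * (1000 * (q ^ 2 * (D.width + 1) ^ 2 * (q ^ D.width * n + N))) ∧
      IsAnswer q G s.mem := by
  classical
  obtain ⟨A, B, L, hA, hB, hL, hin⟩ := hinput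
  have : Nonempty (Fin N) := D.isTree.connected.nonempty
  have hN0 : 0 < N := Fin.pos_iff_nonempty.2 inferInstance
  have hlen : ∀ x : Fin N, (extend L x).length = (D.bag x).card := fun x => length_extend hL rfl
  set K := (Finset.range N).sup fun x => (extend L x).length with hK
  have hKd : K ≤ D.width + 1 := by
    refine Finset.sup_le fun x hx => ?_
    rw [hlen ⟨x, Finset.mem_range.1 hx⟩]
    have := Finset.le_sup (f := fun x => (D.bag x).card)
      (Finset.mem_univ (⟨x, Finset.mem_range.1 hx⟩ : Fin N))
    unfold TreeDecomposition.width
    omega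
  have hbU := M.base_le
  have hbn : n < M.base := by rw [hM]; nlinarith
  have hbN : N < M.base := by rw [hM]; nlinarith
  have hqU : q ≤ M.U := (Nat.le_self_pow (by omega) q).trans hQU
  have hQK : q ^ K ≤ q ^ (D.width + 1) := Nat.pow_le_pow_right (by omega) hKd
  have hsum : ∀ (k m : ℕ) (X : ℕ → List ℕ), (∀ x, (X x).length ≤ m) →
      (blocks k X).length ≤ k * (m + 1) := fun k m X hX => by
    rw [length_blocks]
    exact (Finset.sum_le_card_nsmul _ _ (m + 1) fun x _ => Nat.succ_le_succ (hX x)).trans (by simp)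
  -- The lists have no repetitions, so the input has at most `2 + n (n + 1) + N (N + 1) + N (n + 1)`
  -- words, which is below `(n + N + 2) ^ 2`.
  have hlenI : input.length ≤ M.base := by
    rw [hin, hM, encodeLists_eq, encodeLists_eq, encodeLists_eq]
    simp only [List.length_cons, List.length_append]
    have h1 := hsum n n _ (length_extend_le hA)
    have h2 := hsum N N _ (length_extend_le hB)
    have h3 := hsum N n _ (length_extend_le hL)
    nlinarith
  have hblock : ∀ (k m : ℕ) (X : ℕ → List ℕ), m ≤ M.U → (∀ x, (X x).length ≤ m) →
      (∀ x, ∀ y ∈ X x, y < m) → ∀ w ∈ blocks k X, w ≤ M.U := fun k m X hm h1 h2 w hw => by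
    obtain ⟨x, -, hw⟩ := List.mem_flatMap.1 hw
    rcases List.mem_cons.1 hw with rfl | hw
    · exact (h1 x).trans hm
    · exact (h2 x w hw).le.trans hm
  have hwords : ∀ w ∈ input, w ≤ M.U := by
    rw [hin, encodeLists_eq, encodeLists_eq, encodeLists_eq]
    intro w hw
    simp only [List.mem_cons, List.mem_append] at hw
    rcases hw with rfl | rfl | (hw | hw) | hw
    · omega
    · omega
    · exact hblock _ n _ (by omega) (length_extend_le hA) (fun _ _ => lt_of_mem_extend) w hw
    · exact hblock _ N _ (by omega) (length_extend_le hB) (fun _ _ => lt_of_mem_extend) w hw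
    · exact hblock _ n _ (by omega) (length_extend_le hL) (fun _ _ => lt_of_mem_extend) w hw
  obtain ⟨s, hs, hrel⟩ := exec_prelude (M := M) hM hqU (hin ▸ hwords) (hin ▸ hlenI)
  rw [← hin] at hs hrel
  obtain ⟨s1, k1, h1, hx1, hk1, hrel1, E, hE, hord, hpar, hcol⟩ :=
    runs_prepare (M := M) D hA hB hL hq hK.symm (by omega) (by omega) hqU (hQK.trans hQU) hin hlenI
      (h := initialStore q input) rfl rfl (fun _ _ _ => rfl) s hrel
  obtain ⟨s2, k2, h2, hx2, hk2, hrel2, hans⟩ := runs_solve hE hord hpar hcol hbn s1 hrel1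
  refine ⟨s2, _, Exec.seq hs (Exec.seq hx1 hx2), ?_, ?_⟩
  · have hcost := cost_le (n := n) (N := N) (K := K) (d := D.width + 1) (q := q)
      (Q := q ^ D.width) (A := extend A) (B := extend B) (L := extend L) hq (by omega) hKd hN0
      (hQK.trans (by rw [pow_succ']))
      (by rw [sum_length_extend hA]; simpa using E.sum_degree_le)
      (by
        rw [sum_length_extend hB, T.sum_degrees_eq_twice_card_edges]
        have := D.isTree.card_edgeFinset
        simp only [Fintype.card_fin] at this
        omega)
      (by
        refine (Finset.sum_le_card_nsmul _ _ K fun x hx => ?_).trans (by simp)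
        exact Finset.le_sup (f := fun x => (extend L x).length) hx)
    omega
  · have hlow : ∀ i ≤ n, s2.mem i = h2.low i := fun i hi => hrel2.low i (by omega)
    refine hans.imp (fun ha => ⟨(hlow 0 (by omega)).trans ha.1, ?_⟩)
      fun ha => ⟨(hlow 0 (by omega)).trans ha.1, ha.2⟩
    obtain ⟨φ, hφ, hv⟩ := ha.2
    exact ⟨φ, hφ, fun v => (hlow _ v.2).trans (hv v)⟩

end RAM

theorem theorem3p2 (q : ℕ) (hq : 2 ≤ q) :
    ∃ (P : RAM.Cmd) (C c : ℕ),
      ∀ (n N : ℕ) (G : SimpleGraph (Fin n)) (T : SimpleGraph (Fin N)) (D : TreeDecomposition G T)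
        (input : List ℕ), IsEncoding D input →
        ∃ (s : RAM.State) (k : ℕ),
          RAM.Exec (C * (q ^ D.width * (n + N)) ^ c) P (RAM.State.init input) s k ∧
          k ≤ C * (D.width + 1) ^ c * (q ^ D.width * n + N) ∧
          IsAnswer q G s.mem := by
  -- With `X = q ^ t * (n + N)`, stored values are bounded by `U = 32 * q * X ^ 2`. Its 256th power
  -- gives the first summand of the constant and the exponent 512. The second summand makes the word
  -- bound strict and absorbs the running time.
  refine ⟨RAM.cliqueColoring q, (32 * q) ^ 256 + 2000000 * q ^ 2, 512, ?_⟩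
  intro n N G T D input hinput
  have : Nonempty (Fin N) := D.isTree.connected.nonempty
  have hN0 : 0 < N := Fin.pos_iff_nonempty.2 inferInstance
  have hQ : 1 ≤ q ^ D.width := Nat.one_le_pow _ _ (by omega)
  have hq2 : 1 ≤ q ^ 2 := Nat.one_le_pow _ _ (by omega)
  set X := q ^ D.width * (n + N) with hX
  have hnX : n + N ≤ X := Nat.le_mul_of_pos_left _ hQ
  have hX1 : 1 ≤ X ^ 2 := Nat.one_le_pow _ _ (by omega)
  have hXX : X ≤ X ^ 2 := Nat.le_self_pow (by omega) X
  let M : RAM.Machine :=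
    { W := ((32 * q) ^ 256 + 2000000 * q ^ 2) * X ^ 512
      U := 32 * q * X ^ 2
      base := (n + N + 2) * (n + N + 2)
      le_U := by nlinarith
      base_le := by
        -- The tree has a node, so `X` is at least 1 and `n + N + 2` is at most `3 * X`.
        have : (n + N + 2) * (n + N + 2) ≤ (3 * X) * (3 * X) :=
          Nat.mul_le_mul (by omega) (by omega)
        nlinarith
      pow_lt := by
        rw [mul_pow, ← pow_mul]
        exact Nat.mul_lt_mul_of_pos_right (Nat.lt_add_of_pos_right (by positivity))
          (Nat.pow_pos (show 0 < X by omega)) }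
  have hQU : q ^ (D.width + 1) ≤ M.U := by
    have : q ^ D.width ≤ X := Nat.le_mul_of_pos_right _ (by omega)
    calc q ^ (D.width + 1) = q * q ^ D.width := pow_succ' _ _
      _ ≤ q * X ^ 2 := Nat.mul_le_mul_left _ (this.trans hXX)
      _ ≤ 32 * q * X ^ 2 := Nat.mul_le_mul_right _ (by omega)
  obtain ⟨s, k, h1, h2, h3⟩ := RAM.exec_cliqueColoring (M := M) hq D hinput rfl hQU
  refine ⟨s, k, h1, h2.trans ?_, h3⟩
  have hd : (D.width + 1) ^ 2 ≤ (D.width + 1) ^ 512 := Nat.pow_le_pow_right (by omega) (by omega)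
  have hpos : 1 ≤ q ^ 2 * (D.width + 1) ^ 2 * (q ^ D.width * n + N) :=
    Nat.mul_pos (Nat.mul_pos hq2 (Nat.pow_pos (by omega))) (by omega)
  calc 18 + 1000 * (1000 * (q ^ 2 * (D.width + 1) ^ 2 * (q ^ D.width * n + N)))
      ≤ 2000000 * (q ^ 2 * (D.width + 1) ^ 2 * (q ^ D.width * n + N)) := by omega
    _ = 2000000 * q ^ 2 * (D.width + 1) ^ 2 * (q ^ D.width * n + N) := by
      simp only [mul_assoc]
    _ ≤ _ := Nat.mul_le_mul_right _ (Nat.mul_le_mul (Nat.le_add_left _ _) hd)
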